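/- **Setting.** A smooth étale groupoid $\mathsf G$ has manifolds of objects $\mathsf G_0$ and arrows $\mathsf G_1$, smooth structure maps, and source and target local diffeomorphisms. $\mathsf G_k$ is the space of strings $(g_1,\dots,g_k)$ of $k$ composable arrows $x_0\to x_1\to\cdots\to x_k$. Write $\mathbb C^\times(p)$ for the complex $\mathbb C^\times\xrightarrow{d\log}\mathcal A^1\xrightarrow{d}\cdots\xrightarrow{d}\mathcal A^{p-1}$ of smooth $\mathbb C^\times$-valued functions and complex differential forms. The group $\breve C^i(\mathsf G,\mathbb C^\times(p))$ of Čech–Deligne cochains consists of families, indexed by $k+l=i$, $l<p$, of smooth $\mathbb C^\times$-valued functions ($l=0$) or $l$-forms ($l\ge 1$) on $\mathsf G_k$. The total differential from degree $i$ to $i+1$ is $\delta+(-1)^{i+1}d$, where $\delta=\sum_j(-1)^j\delta_j$ and $\delta_j$ is pullback along the face that drops $x_j$; $\mathbb H^i$ denotes its cohomology. A cochain is *normalized* if its components on $\mathsf G_k$, $k\ge1$, pull back to $0$ (to $1$, if $l=0$) along all degeneracies $\mathsf G_{k-1}\to\mathsf G_k$ (insertion of a unit arrow). An $m$-gerbe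 with connection is an $(m+1)$-cocycle with values in $\mathbb C^\times(m+2)$. For $i<p$ we identify $\breve C^i(\mathsf G,\mathbb C^\times(p))=\breve C^i(\mathsf G,\mathbb C^\times(p+1))$. An admissible cover $W$ is given by points $0=\alpha_0<\alpha_1<\cdots<\alpha_N=1$ $(N\ge1)$, extended by $\alpha_{j+N}=\alpha_j+1$ to $j\in\mathbb Z$, and $\epsilon>0$ with $2\epsilon\le\alpha_{j}-\alpha_{j-1}$ for all $j$; put $I_j=[\alpha_{j-1},\alpha_j]$ and $V_j=(\alpha_{j-1}-\epsilon,\alpha_j+\epsilon)$. The circle groupoid $\mathsf S^1_W$ has objects $\bigsqcup_{j\in\mathbb Z} V_j$ and one arrow from $x\in V_i$ to $x+m\in V_j$ whenever $m\in\mathbb Z$, $x\in V_i$, $x+m\in V_j$. $\mathsf{LG}(W)$ is the groupoid of smooth functors $\mathsf S^1_W\to\mathsf G$ and smooth natural transformations. Functions and forms on $\mathsf{LG}(W)_k$ are understood on smooth finite-dimensional families (functional diffeology). If $W'$ refines $W$ (more points, $\epsilon'\le\epsilon$) then $\mathsf{LG}(W)\hookrightarrow \mathsf{LG}(W')$. The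 loop groupoid $\mathsf{LG}$ is the union of the $\mathsf{LG}(W)$, so a cochain on $\mathsf{LG}$ is a family of cochains on the $\mathsf{LG}(W)$ compatible with all these inclusions. For a string $\mathbf\Lambda=(\Lambda^1,\dots,\Lambda^q)$ in $\mathsf{LG}(W)_q$ joining $\psi^0,\dots,\psi^q$, let $\mathbf\Lambda_i:I_i\to\mathsf G_q$ be its restriction to $I_i\subset V_i$, let $\psi^m(\alpha_i)$ be the value of $\psi^m$ on the arrow from $\alpha_i\in V_i$ to $\alpha_i\in V_{i+1}$ (to $0\in V_1$ if $i=N$; accordingly indices $i$ are read modulo $N$), and for $0\le m\le q$ put $$\vartheta_m\mathbf\Lambda(\alpha_i)=\big(\Lambda^1_i(\alpha_i),\dots,\Lambda^m_i(\alpha_i),\psi^m(\alpha_i),\Lambda^{m+1}_{i+1}(\alpha_i),\dots,\Lambda^q_{i+1}(\alpha_i)\big)\in\mathsf G_{q+1}.$$ The same notation is used for tangent vectors. **Theorem (Generalized holonomy).** 1. *(On $\mathsf{LG}(W)$.)* For every smooth étale groupoid $\mathsf G$, admissible cover $W$ and $n\ge1$ there is a homomorphism $$\tau_n^W:\breve C^n(\mathsf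 G,\mathbb C^\times(n+1))\to\breve C^{n-1}(\mathsf{LG}(W),\mathbb C^\times(n)),\qquad (\omega,\theta^1,\dots,\theta^n)\mapsto(F,\Delta^1,\dots,\Delta^{n-1}),$$ given by $$F(\mathbf\Lambda)=\exp\Big(\sum_{i=1}^N\int_{I_i}\mathbf\Lambda_i^*\theta^1\Big)\prod_{i=1}^N\prod_{m=0}^{n-1}\omega\big(\vartheta_m\mathbf\Lambda(\alpha_i)\big)^{(-1)^{m+n}},$$ $$\langle\Delta^k_{\mathbf\Lambda},(\Xi^1,\dots,\Xi^k)\rangle=\sum_{i=1}^N\int_{I_i}\theta^{k+1}\Big(\frac{d\mathbf\Lambda_i}{dt},\Xi^1_i(t),\dots,\Xi^k_i(t)\Big)dt+\sum_{i=1}^N\sum_{m=0}^{n-1-k}(-1)^{m+n}\big\langle\theta^k,(\vartheta_m\Xi^1(\alpha_i),\dots,\vartheta_m\Xi^k(\alpha_i))\big\rangle .$$ It sends $n$-cocycles to $(n-1)$-cocycles (so $(n-1)$-gerbes with connection on $\mathsf G$ to $(n-2)$-gerbes with connection). It satisfies $\tau^W_n\circ(\delta+(-1)^nd)=(\delta+(-1)^{n-1}d)\circ\tau^W_{n-1}$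 on $\breve C^{n-1}(\mathsf G,\mathbb C^\times(n))$ for $n\ge2$, and $\tau_1^W\circ(\delta-d)=0$ on $\breve C^0(\mathsf G,\mathbb C^\times(2))$. It induces a homomorphism $\mathbb H^n(\mathsf G,\mathbb C^\times(n+1))\to\mathbb H^{n-1}(\mathsf{LG}(W),\mathbb C^\times(n))$, and it is natural with respect to smooth functors $\mathsf G\to\mathsf G'$. 2. *(On $\mathsf{LG}$.)* There are homomorphisms $$\tau_n:\breve C^n(\mathsf G,\mathbb C^\times(n+1))\to\breve C^{n-1}(\mathsf{LG},\mathbb C^\times(n)),\qquad n\ge1,$$ whose value on every normalized cochain $c$ is the family $(\tau_n^W c)_W$ given by the above formula, and every class in $\mathbb H^n(\mathsf G,\mathbb C^\times(n+1))$ is represented by a normalized cocycle. The maps $\tau_n$ send $n$-cocycles to $(n-1)$-cocycles, satisfy $\tau_n\circ(\delta+(-1)^nd)=(\delta+(-1)^{n-1}d)\circ\tau_{n-1}$ for $n\ge2$ and $\tau_1\circ(\delta-d)=0$, induce homomorphisms $$\mathbb H^n(\mathsf G,\mathbb C^\times(n+1))\to\mathbb H^{n-1}(\mathsf{LG},\mathbb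 C^\times(n)),$$ and are natural with respect to smooth functors $\mathsf G\to\mathsf G'$. -/

import Mathlib

noncomputable section

set_option linter.unusedVariables false

namespace Holonomy

open scoped ContDiff Manifold Topology
open Diffeology

universe u v w

/-! ### Diffeological preliminaries -/

/-- Euclidean space `ℝⁿ`, the test spaces of diffeology. -/
abbrev Euc (n : ℕ) : Type := EuclideanSpace ℝ (Fin n)

/-- The initial (subspace / fibre product type) diffeology with respect to one map. -/
@[reducible]
def inducedDiffeology {X : Type u} {Y : Type v} [DiffeologicalSpace Y] (f : X → Y) :
    DiffeologicalSpace X where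
  plots _ := {p | IsPlot (f ∘ p)}
  constant_plots x := isPlot_const (x := f x)
  plot_reparam {n m p g} hp hg := isPlot_reparam (p := f ∘ p) hp hg
  locality {n p} h := by
    refine DiffeologicalSpace.locality (p := f ∘ p) fun x => ?_
    obtain ⟨s, hs, hx, H⟩ := h x
    exact ⟨s, hs, hx, fun {m g} hg hg' => H (f := g) hg hg'⟩

/-- The discrete diffeology: plots are the locally constant maps. -/
@[reducible]
def discreteDiffeology (X : Type u) : DiffeologicalSpace X :=
  .ofCorePlotsOn {
    isPlotOn := fun {_ s} _ p => ∀ x ∈ s, ∀ᶠ y in 𝓝 x, p y = p x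
    isPlotOn_congr := by
      intro n s hs p q h
      constructor
      · intro H x hx
        filter_upwards [H x hx, hs.mem_nhds hx] with y hy hys
        rw [← h hys, ← h hx, hy]
      · intro H x hx
        filter_upwards [H x hx, hs.mem_nhds hx] with y hy hys
        rw [h hys, h hx, hy]
    isPlot := fun p => ∀ x, ∀ᶠ y in 𝓝 x, p y = p x
    isPlotOn_univ := by simp
    isPlot_const := fun x _ => by simp
    isPlotOn_reparam := by
      intro n m s t hs ht p f hf H hfc x hx
      have hc : ContinuousAt f x := (hfc.continuousOn x hx).continuousAt (ht.mem_nhds hx)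
      exact hc.eventually (H (f x) (hf hx))
    locality := by
      intro n s hs p H x hx
      obtain ⟨t, _, hxt, h⟩ := H x hx
      exact h x hxt }

/-- The diffeology of a smooth manifold: plots are the smooth maps `ℝⁿ → M`. -/
@[reducible]
def manifoldDiffeology (d : ℕ) (M : Type u) [TopologicalSpace M] [ChartedSpace (Euc d) M] :
    DiffeologicalSpace M :=
  .ofCorePlotsOn {
    isPlotOn := fun {n s} _ p => ContMDiffOn 𝓘(ℝ, Euc n) 𝓘(ℝ, Euc d) ∞ p s
    isPlotOn_congr := fun _ _ _ h => contMDiffOn_congr (fun y hy => (h hy))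
    isPlot := fun {n} p => ContMDiff 𝓘(ℝ, Euc n) 𝓘(ℝ, Euc d) ∞ p
    isPlotOn_univ := contMDiffOn_univ
    isPlot_const := fun _ => contMDiff_const
    isPlotOn_reparam := fun _ _ _ h hp hf =>
      ContMDiffOn.comp hp hf.contMDiffOn h
    locality := by
      intro n s hs p H x hx
      obtain ⟨t, ht, hxt, h⟩ := H x hx
      exact ((h x hxt).contMDiffAt (ht.mem_nhds hxt)).contMDiffWithinAt }

/-- The set of smooth maps between two diffeological spaces. -/
structure SmoothMap (X : Type u) (Y : Type v) [DiffeologicalSpace X] [DiffeologicalSpace Y] where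
  toFun : X → Y
  smooth : DSmooth toFun

/-- The functional diffeology: `P : ℝⁿ → C^∞(X, Y)` is a plot iff `(s, x) ↦ P s x` is smooth. -/
instance {X : Type u} {Y : Type v} [DiffeologicalSpace X] [DiffeologicalSpace Y] :
    DiffeologicalSpace (SmoothMap X Y) where
  plots n := {P | ∀ (k : ℕ) (f : Euc k → Euc n) (q : Euc k → X), ContDiff ℝ ∞ f → IsPlot q →
    IsPlot (fun s => (P (f s)).1 (q s))}
  constant_plots F := fun k f q _ hq => F.2 k q hq
  plot_reparam {n m p g} hp hg := fun k f q hf hq => hp k (g ∘ f) q (hg.comp hf) hq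
  locality {n p} h := by
    intro k f q hf hq
    refine DiffeologicalSpace.locality fun x => ?_
    obtain ⟨s, hs, hx, H⟩ := h (f x)
    refine ⟨f ⁻¹' s, hs.preimage hf.continuous, hx, fun {m g} hg hg' => ?_⟩
    exact H (f := f ∘ g) (fun y => hg y) (hf.comp hg') m id (q ∘ g) contDiff_id
      (isPlot_reparam hq hg')

/-- Plots of `X` with parameter space `ℝⁿ`. -/
abbrev Plot (n : ℕ) (X : Type u) [DiffeologicalSpace X] : Type u := {p : Euc n → X // IsPlot p}

/-- Smooth reparametrisation of a plot. -/
def Plot.reparam {n m : ℕ} {X : Type u} [DiffeologicalSpace X] (p : Plot n X)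
    (f : Euc m → Euc n) (hf : ContDiff ℝ ∞ f) : Plot m X :=
  ⟨p.1 ∘ f, isPlot_reparam p.2 hf⟩

/-- Image of a plot under a smooth map. -/
def Plot.map {n : ℕ} {X : Type u} {Y : Type v} [DiffeologicalSpace X] [DiffeologicalSpace Y]
    (φ : X → Y) (hφ : DSmooth φ) (p : Plot n X) : Plot n Y :=
  ⟨φ ∘ p.1, hφ n p.1 p.2⟩

/-! ### Complex differential forms and smooth `ℂˣ`-valued functions -/

section Forms

variable (X : Type u) [DiffeologicalSpace X]

/-- Complex-valued differential `k`-forms on a diffeological space: a smooth `k`-form on `ℝⁿ` for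
every plot `ℝⁿ → X`, compatible with pullback along smooth reparametrisations.  On a manifold these
are the usual differential forms, a form `θ` being recorded by its pullbacks `p^*θ`. -/
def DForm (k : ℕ) :
    AddSubgroup (∀ n : ℕ, Plot n X → Euc n → (Euc n) [⋀^Fin k]→L[ℝ] ℂ) where
  carrier := {θ | (∀ (n : ℕ) (p : Plot n X), ContDiff ℝ ∞ (θ n p)) ∧
    ∀ (n m : ℕ) (p : Plot n X) (f : Euc m → Euc n) (hf : ContDiff ℝ ∞ f) (x : Euc m),
      θ m (p.reparam f hf) x = (θ n p (f x)).compContinuousLinearMap (fderiv ℝ f x)}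
  zero_mem' := ⟨fun n p => contDiff_const, fun n m p f hf x => by ext v; simp⟩
  add_mem' := by
    rintro a b ⟨ha, ha'⟩ ⟨hb, hb'⟩
    refine ⟨fun n p => (ha n p).add (hb n p), fun n m p f hf x => ?_⟩
    have h1 := ha' n m p f hf x
    have h2 := hb' n m p f hf x
    ext v
    simp [h1, h2]
  neg_mem' := by
    rintro a ⟨ha, ha'⟩
    refine ⟨fun n p => (ha n p).neg, fun n m p f hf x => ?_⟩
    have h1 := ha' n m p f hf x
    ext v
    simp [h1]

/-- The group of smooth functions `X → ℂˣ`. -/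
def smoothUnits : Subgroup (X → ℂˣ) where
  carrier := {f | ∀ (n : ℕ) (p : Plot n X), ContDiff ℝ ∞ (fun s => (f (p.1 s) : ℂ))}
  one_mem' := fun n p => by simpa using contDiff_const
  mul_mem' := fun {a b} ha hb n p => by simpa using (ha n p).mul (hb n p)
  inv_mem' := fun {a} ha n p => by
    have h := (ha n p).inv (fun s => (a (p.1 s)).ne_zero)
    have e : (fun s => ((a⁻¹ (p.1 s) : ℂˣ) : ℂ)) = (fun s => (a (p.1 s) : ℂ))⁻¹ := by
      funext s; simp
    rw [e]; exact h

/-- Sections of the terms of the complex `ℂˣ → 𝒜¹ → 𝒜² → ⋯`: smooth `ℂˣ`-valued functions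
(written additively) in degree `0`, complex `l`-forms in degree `l ≥ 1`. -/
def DSec : ℕ → Type u
  | 0 => Additive (smoothUnits X)
  | l + 1 => DForm X (l + 1)

instance : ∀ l : ℕ, AddCommGroup (DSec X l)
  | 0 => inferInstanceAs (AddCommGroup (Additive (smoothUnits X)))
  | l + 1 => inferInstanceAs (AddCommGroup (DForm X (l + 1)))

variable {X}

/-- The underlying function of a degree-`0` section. -/
def DSec.fn (f : DSec X 0) : X → ℂˣ := (Additive.toMul (f : Additive (smoothUnits X))).1

/-- The value of an `(l+1)`-form on a plot: a differential form on `ℝⁿ`. -/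
def DSec.form {l : ℕ} (θ : DSec X (l + 1)) {n : ℕ} (p : Plot n X) :
    Euc n → (Euc n) [⋀^Fin (l + 1)]→L[ℝ] ℂ :=
  (show DForm X (l + 1) from θ).1 n p

end Forms

section FormOps

variable {X : Type u} {Y : Type v} [DiffeologicalSpace X] [DiffeologicalSpace Y]

/-- Pullback of functions and forms along a smooth map. -/
def DSec.pull (φ : X → Y) (hφ : DSmooth φ) : ∀ l : ℕ, DSec Y l →+ DSec X l
  | 0 =>
    { toFun := fun f => show DSec X 0 from
        Additive.ofMul ⟨fun x => DSec.fn f (φ x), fun n p =>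
          (Additive.toMul (show Additive (smoothUnits Y) from f)).2 n (p.map φ hφ)⟩
      map_zero' := rfl
      map_add' := fun _ _ => rfl }
  | l + 1 =>
    { toFun := fun θ => show DForm X (l + 1) from
        ⟨fun _ p => DSec.form θ (p.map φ hφ),
          fun n p => (show DForm Y (l + 1) from θ).2.1 n (p.map φ hφ),
          fun n m p f hf x => (show DForm Y (l + 1) from θ).2.2 n m (p.map φ hφ) f hf x⟩
      map_zero' := rfl
      map_add' := fun _ _ => rfl }

/-- The exterior derivative of a form, computed plotwise. -/
def DForm.d {k : ℕ} : DForm X k →+ DForm X (k + 1) where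
  toFun θ := ⟨fun n p => extDeriv (θ.1 n p), by
    refine ⟨fun n p => ?_, fun n m p f hf x => ?_⟩
    · have h : ContDiff ℝ ∞ (fderiv ℝ (θ.1 n p)) :=
        (θ.2.1 n p).fderiv_right (m := ∞) (by simp)
      exact (ContinuousAlternatingMap.alternatizeUncurryFinCLM ℝ (Euc n) ℂ).contDiff.comp h
    · have h : θ.1 m (p.reparam f hf) =
          fun x => (θ.1 n p (f x)).compContinuousLinearMap (fderiv ℝ f x) :=
        funext fun x => θ.2.2 n m p f hf x
      change extDeriv (θ.1 m (p.reparam f hf)) x = _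
      rw [h]
      exact extDeriv_pullback (r := ∞) ((θ.2.1 n p).differentiable (by simp) _) hf.contDiffAt
        (by simp only [minSmoothness_of_isRCLikeNormedField]; exact WithTop.coe_le_coe.2 (le_top : (2 : ℕ∞) ≤ ⊤))⟩
  map_zero' := by
    ext n p x v
    change extDeriv (fun _ => 0) x v = 0
    rw [extDeriv, fderiv_fun_const, Pi.zero_apply,
      ← ContinuousAlternatingMap.alternatizeUncurryFinCLM_apply, map_zero]
    rfl
  map_add' a b := by
    ext n p x v
    change extDeriv (a.1 n p + b.1 n p) x v = (extDeriv (a.1 n p) x + extDeriv (b.1 n p) x) v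
    rw [extDeriv_add ((a.2.1 n p).differentiable (by simp) _)
      ((b.2.1 n p).differentiable (by simp) _)]

/-- The `1`-form `d log f = f⁻¹ df` on `ℝⁿ`, for a function `f` on `ℝⁿ`. -/
def dlogForm {n : ℕ} (f : Euc n → ℂ) (x : Euc n) : (Euc n) [⋀^Fin 1]→L[ℝ] ℂ :=
  (f x)⁻¹ • ContinuousAlternatingMap.ofSubsingleton ℝ (Euc n) ℂ (0 : Fin 1) (fderiv ℝ f x)

/-- `d log f = f⁻¹ df` for a smooth `ℂˣ`-valued function, computed plotwise. -/
def dlog : Additive (smoothUnits X) →+ DForm X 1 where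
  toFun f := ⟨fun _ p => dlogForm (fun s => ((Additive.toMul f).1 (p.1 s) : ℂ)), by
    have hf := (Additive.toMul f).2
    refine ⟨fun n p => ?_, fun n m p g hg x => ?_⟩
    · refine ((hf n p).inv (fun s => Units.ne_zero _)).smul ?_
      exact (ContinuousAlternatingMap.ofSubsingletonLIE (𝕜 := ℝ) (E := Euc n) (F := ℂ)
        (0 : Fin 1)).contDiff.comp
        ((hf n p).fderiv_right (m := ∞) (by simp))
    · have h : fderiv ℝ (fun s => ((Additive.toMul f).1 (p.1 (g s)) : ℂ)) x =
          (fderiv ℝ (fun s => ((Additive.toMul f).1 (p.1 s) : ℂ)) (g x)).comp (fderiv ℝ g x) :=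
        fderiv_comp (g := fun s => ((Additive.toMul f).1 (p.1 s) : ℂ)) x
          ((hf n p).differentiable (by simp) _) (hg.differentiable (by simp) x)
      ext v
      simp [dlogForm, Plot.reparam, h]⟩
  map_zero' := by
    ext n p x v
    simp [dlogForm]
  map_add' a b := by
    ext n p x v
    have ha := ((Additive.toMul a).2 n p).differentiable (by simp) x
    have hb := ((Additive.toMul b).2 n p).differentiable (by simp) x
    have h : fderiv ℝ (fun s => ((Additive.toMul a).1 (p.1 s) : ℂ) *
        ((Additive.toMul b).1 (p.1 s) : ℂ)) x = _ := fderiv_fun_mul ha hb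
    simp only [dlogForm, toMul_add, Subgroup.coe_mul, Pi.mul_apply, Units.val_mul, h]
    simp [dlogForm]
    field_simp [Units.ne_zero]
    try ring

/-- The differential of the complex `ℂˣ → 𝒜¹ → 𝒜² → ⋯`: `d log` in degree `0`, and the
exterior derivative in positive degrees. -/
def DSec.d : ∀ l : ℕ, DSec X l →+ DSec X (l + 1)
  | 0 => dlog (X := X)
  | l + 1 => DForm.d (X := X) (k := l + 1)

end FormOps

/-! ### Groupoids -/

/-- The algebraic structure of a groupoid with objects `Obj` and arrows `Arr`; composition is
written in diagrammatic order, `comp g h` being "first `g`, then `h`". -/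
structure GroupoidData (Obj Arr : Type u) where
  src : Arr → Obj
  tgt : Arr → Obj
  one : Obj → Arr
  inv : Arr → Arr
  comp : ∀ g h : Arr, tgt g = src h → Arr
  src_one : ∀ x, src (one x) = x
  tgt_one : ∀ x, tgt (one x) = x
  src_inv : ∀ g, src (inv g) = tgt g
  tgt_inv : ∀ g, tgt (inv g) = src g
  src_comp : ∀ g h e, src (comp g h e) = src g
  tgt_comp : ∀ g h e, tgt (comp g h e) = tgt h
  one_comp : ∀ g, comp (one (src g)) g (tgt_one _) = g
  comp_one : ∀ g, comp g (one (tgt g)) (src_one _).symm = g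
  inv_comp : ∀ g, comp (inv g) g (tgt_inv g) = one (tgt g)
  comp_inv : ∀ g, comp g (inv g) (src_inv g).symm = one (src g)
  assoc : ∀ f g h e e', comp (comp f g e) h ((tgt_comp f g e).trans e') =
    comp f (comp g h e') (e.trans (src_comp g h e').symm)

theorem GroupoidData.comp_congr {Obj Arr : Type u} (D : GroupoidData Obj Arr) {g g' h h' : Arr}
    (hg : g = g') (hh : h = h') (e : D.tgt g = D.src h) :
    D.comp g h e = D.comp g' h' (hg ▸ hh ▸ e) := by
  subst hg hh; rfl

theorem GroupoidData.one_comp' {Obj Arr : Type u} (D : GroupoidData Obj Arr) (x : Obj) (g : Arr)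
    (e : D.tgt (D.one x) = D.src g) : D.comp (D.one x) g e = g := by
  have h : x = D.src g := (D.tgt_one x).symm.trans e
  subst h; exact D.one_comp g

theorem GroupoidData.comp_one' {Obj Arr : Type u} (D : GroupoidData Obj Arr) (x : Obj) (g : Arr)
    (e : D.tgt g = D.src (D.one x)) : D.comp g (D.one x) e = g := by
  have h : D.tgt g = x := e.trans (D.src_one x)
  subst h; exact D.comp_one g

/-- A diffeological groupoid: objects and arrows are diffeological spaces and all structure maps
are smooth. -/
structure DGroupoid where
  Obj : Type u
  Arr : Type u
  data : GroupoidData Obj Arr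
  [diffObj : DiffeologicalSpace Obj]
  [diffArr : DiffeologicalSpace Arr]
  src_smooth : DSmooth data.src
  tgt_smooth : DSmooth data.tgt
  one_smooth : DSmooth data.one
  inv_smooth : DSmooth data.inv
  comp_smooth : ∀ (n : ℕ) (p q : Euc n → Arr) (e : ∀ s, data.tgt (p s) = data.src (q s)),
    IsPlot p → IsPlot q → IsPlot (fun s => data.comp (p s) (q s) (e s))

attribute [instance] DGroupoid.diffObj DGroupoid.diffArr

/-- A smooth étale groupoid: objects and arrows are smooth manifolds, the structure maps are
smooth, and source and target are local diffeomorphisms (hence so are all structure maps).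
Smoothness of the composition on the manifold of composable pairs is tested on smooth families of
composable pairs. -/
structure EtaleGroupoid where
  dim : ℕ
  Obj : Type u
  Arr : Type u
  [topObj : TopologicalSpace Obj]
  [chartObj : ChartedSpace (Euc dim) Obj]
  [smoothObj : IsManifold 𝓘(ℝ, Euc dim) ∞ Obj]
  [topArr : TopologicalSpace Arr]
  [chartArr : ChartedSpace (Euc dim) Arr]
  [smoothArr : IsManifold 𝓘(ℝ, Euc dim) ∞ Arr]
  data : GroupoidData Obj Arr
  src_etale : IsLocalDiffeomorph 𝓘(ℝ, Euc dim) 𝓘(ℝ, Euc dim) ∞ data.src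
  tgt_etale : IsLocalDiffeomorph 𝓘(ℝ, Euc dim) 𝓘(ℝ, Euc dim) ∞ data.tgt
  one_smooth : ContMDiff 𝓘(ℝ, Euc dim) 𝓘(ℝ, Euc dim) ∞ data.one
  inv_smooth : ContMDiff 𝓘(ℝ, Euc dim) 𝓘(ℝ, Euc dim) ∞ data.inv
  comp_smooth : ∀ (n : ℕ) (p q : Euc n → Arr) (e : ∀ s, data.tgt (p s) = data.src (q s)),
    ContMDiff 𝓘(ℝ, Euc n) 𝓘(ℝ, Euc dim) ∞ p → ContMDiff 𝓘(ℝ, Euc n) 𝓘(ℝ, Euc dim) ∞ q →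
    ContMDiff 𝓘(ℝ, Euc n) 𝓘(ℝ, Euc dim) ∞ (fun s => data.comp (p s) (q s) (e s))

attribute [instance] EtaleGroupoid.topObj EtaleGroupoid.chartObj EtaleGroupoid.smoothObj
  EtaleGroupoid.topArr EtaleGroupoid.chartArr EtaleGroupoid.smoothArr

/-- A smooth étale groupoid, with its manifolds of objects and arrows regarded as diffeological
spaces. -/
def EtaleGroupoid.toD (G : EtaleGroupoid.{u}) : DGroupoid.{u} where
  Obj := G.Obj
  Arr := G.Arr
  data := G.data
  diffObj := manifoldDiffeology G.dim G.Obj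
  diffArr := manifoldDiffeology G.dim G.Arr
  src_smooth := fun _ _ hp => G.src_etale.contMDiff.comp hp
  tgt_smooth := fun _ _ hp => G.tgt_etale.contMDiff.comp hp
  one_smooth := fun _ _ hp => G.one_smooth.comp hp
  inv_smooth := fun _ _ hp => G.inv_smooth.comp hp
  comp_smooth := fun n p q e hp hq => G.comp_smooth n p q e hp hq

/-- Smooth functors (morphisms of groupoids). -/
structure DFunctor (K : DGroupoid.{v}) (G : DGroupoid.{u}) where
  obj : K.Obj → G.Obj
  arr : K.Arr → G.Arr
  obj_smooth : DSmooth obj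
  arr_smooth : DSmooth arr
  src_arr : ∀ r, G.data.src (arr r) = obj (K.data.src r)
  tgt_arr : ∀ r, G.data.tgt (arr r) = obj (K.data.tgt r)
  map_one : ∀ x, arr (K.data.one x) = G.data.one (obj x)
  map_comp : ∀ r r' e, arr (K.data.comp r r' e) = G.data.comp (arr r) (arr r')
    ((tgt_arr r).trans ((congrArg obj e).trans (src_arr r').symm))

/-- Composition of smooth functors. -/
def DFunctor.comp {K : DGroupoid.{w}} {L : DGroupoid.{v}} {G : DGroupoid.{u}}
    (F : DFunctor K L) (H : DFunctor L G) : DFunctor K G where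
  obj := H.obj ∘ F.obj
  arr := H.arr ∘ F.arr
  obj_smooth := H.obj_smooth.comp F.obj_smooth
  arr_smooth := H.arr_smooth.comp F.arr_smooth
  src_arr r := (H.src_arr _).trans (congrArg H.obj (F.src_arr r))
  tgt_arr r := (H.tgt_arr _).trans (congrArg H.obj (F.tgt_arr r))
  map_one x := (congrArg H.arr (F.map_one x)).trans (H.map_one _)
  map_comp r r' e := (congrArg H.arr (F.map_comp r r' e)).trans (H.map_comp _ _ _)

/-- Smooth natural transformations between smooth functors. -/
structure DNatTrans (K : DGroupoid.{v}) (G : DGroupoid.{u}) where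
  dom : DFunctor K G
  cod : DFunctor K G
  app : K.Obj → G.Arr
  app_smooth : DSmooth app
  src_app : ∀ x, G.data.src (app x) = dom.obj x
  tgt_app : ∀ x, G.data.tgt (app x) = cod.obj x
  naturality : ∀ r : K.Arr,
    G.data.comp (dom.arr r) (app (K.data.tgt r)) ((dom.tgt_arr r).trans (src_app _).symm) =
    G.data.comp (app (K.data.src r)) (cod.arr r) ((tgt_app _).trans (cod.src_arr r).symm)

section MappingGroupoid

variable {K : DGroupoid.{v}} {G : DGroupoid.{u}}

theorem GroupoidData.swap {Obj Arr : Type u} (D : GroupoidData Obj Arr) {f a b h : Arr}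
    (e₁ : D.tgt f = D.src a) (e₂ : D.tgt b = D.src h) (H : D.comp f a e₁ = D.comp b h e₂)
    (e₃ : D.tgt h = D.src (D.inv a)) (e₄ : D.tgt (D.inv b) = D.src f) :
    D.comp h (D.inv a) e₃ = D.comp (D.inv b) f e₄ := by
  have h1 : D.comp (D.comp f a e₁) (D.inv a) ((D.tgt_comp _ _ _).trans (D.src_inv a).symm) = f := by
    rw [D.assoc _ _ _ e₁ (D.src_inv a).symm, D.comp_congr rfl (D.comp_inv a),
      D.comp_congr rfl (congrArg D.one e₁.symm), D.comp_one]
  have h2 : D.comp (D.inv b) (D.comp b h e₂) ((D.tgt_inv b).trans (D.src_comp _ _ _).symm) = h := by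
    rw [← D.assoc _ _ _ (D.tgt_inv b) e₂, D.comp_congr (D.inv_comp b) rfl,
      D.comp_congr (congrArg D.one e₂) rfl, D.one_comp]
  rw [D.comp_congr rfl h1.symm, D.comp_congr h2.symm rfl,
    D.comp_congr rfl (D.comp_congr H rfl _), D.assoc]

theorem DNatTrans.ext' {a b : DNatTrans K G} (h₁ : a.dom = b.dom) (h₂ : a.cod = b.cod)
    (h₃ : ∀ x, a.app x = b.app x) : a = b := by
  obtain ⟨F, H, f, hf, hfs, hft, hfn⟩ := a
  obtain ⟨F', H', g, hg, hgs, hgt, hgn⟩ := b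
  cases h₁; cases h₂; cases (funext h₃ : f = g); rfl

/-- Identity natural transformation. -/
def DNatTrans.one (F : DFunctor K G) : DNatTrans K G where
  dom := F
  cod := F
  app x := G.data.one (F.obj x)
  app_smooth := G.one_smooth.comp F.obj_smooth
  src_app x := G.data.src_one _
  tgt_app x := G.data.tgt_one _
  naturality r := by
    have h1 := G.data.comp_one (F.arr r)
    have h2 := G.data.one_comp (F.arr r)
    rw [G.data.comp_congr rfl (congrArg G.data.one (F.tgt_arr r).symm),
      G.data.comp_congr (congrArg G.data.one (F.src_arr r).symm) rfl, h1, h2]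

/-- Pointwise composition of natural transformations. -/
def DNatTrans.comp (a b : DNatTrans K G) (e : a.cod = b.dom) : DNatTrans K G where
  dom := a.dom
  cod := b.cod
  app x := G.data.comp (a.app x) (b.app x) (by rw [a.tgt_app, b.src_app, e])
  app_smooth := fun n p hp => G.comp_smooth n _ _ _ (a.app_smooth n p hp) (b.app_smooth n p hp)
  src_app x := by rw [G.data.src_comp, a.src_app]
  tgt_app x := by rw [G.data.tgt_comp, b.tgt_app]
  naturality r := by
    obtain ⟨F, H, f, hf, hfs, hft, hfn⟩ := a
    obtain ⟨H', L, g, hg, hgs, hgt, hgn⟩ := b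
    cases e
    dsimp only at *
    rw [← G.data.assoc _ _ _ ((F.tgt_arr r).trans (hfs _).symm), G.data.comp_congr (hfn r) rfl,
      G.data.assoc _ _ _ _ ((H.tgt_arr r).trans (hgs _).symm), G.data.comp_congr rfl (hgn r),
      ← G.data.assoc]

/-- Pointwise inverse of a natural transformation. -/
def DNatTrans.inv (a : DNatTrans K G) : DNatTrans K G where
  dom := a.cod
  cod := a.dom
  app x := G.data.inv (a.app x)
  app_smooth := G.inv_smooth.comp a.app_smooth
  src_app x := by rw [G.data.src_inv, a.tgt_app]
  tgt_app x := by rw [G.data.tgt_inv, a.src_app]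
  naturality r := by
    exact G.data.swap _ _ (a.naturality r) _ _

instance : DiffeologicalSpace (DFunctor K G) :=
  inducedDiffeology (fun F => (⟨F.obj, F.obj_smooth⟩ : SmoothMap K.Obj G.Obj)) ⊓
  inducedDiffeology (fun F => (⟨F.arr, F.arr_smooth⟩ : SmoothMap K.Arr G.Arr))

instance : DiffeologicalSpace (DNatTrans K G) :=
  inducedDiffeology DNatTrans.dom ⊓ inducedDiffeology DNatTrans.cod ⊓
  inducedDiffeology (fun a => (⟨a.app, a.app_smooth⟩ : SmoothMap K.Obj G.Arr))

theorem isPlot_functor {n : ℕ} {P : Euc n → DFunctor K G} : IsPlot P ↔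
    IsPlot (fun s => (⟨(P s).obj, (P s).obj_smooth⟩ : SmoothMap K.Obj G.Obj)) ∧
    IsPlot (fun s => (⟨(P s).arr, (P s).arr_smooth⟩ : SmoothMap K.Arr G.Arr)) :=
  DiffeologicalSpace.isPlot_inf_iff

theorem isPlot_natTrans {n : ℕ} {P : Euc n → DNatTrans K G} : IsPlot P ↔
    (IsPlot (fun s => (P s).dom) ∧ IsPlot (fun s => (P s).cod)) ∧
    IsPlot (fun s => (⟨(P s).app, (P s).app_smooth⟩ : SmoothMap K.Obj G.Arr)) :=
  DiffeologicalSpace.isPlot_inf_iff.trans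
    (and_congr_left' DiffeologicalSpace.isPlot_inf_iff)

variable (K G) in
/-- The groupoid of smooth functors `K → G` and smooth natural transformations between them,
with the functional diffeology. -/
def mappingGroupoid : DGroupoid.{max u v} where
  Obj := DFunctor K G
  Arr := DNatTrans K G
  data :=
    { src := DNatTrans.dom
      tgt := DNatTrans.cod
      one := DNatTrans.one
      inv := DNatTrans.inv
      comp := DNatTrans.comp
      src_one := fun _ => rfl
      tgt_one := fun _ => rfl
      src_inv := fun _ => rfl
      tgt_inv := fun _ => rfl
      src_comp := fun _ _ _ => rfl
      tgt_comp := fun _ _ _ => rfl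
      one_comp := fun a => DNatTrans.ext' rfl rfl fun x =>
        (G.data.comp_congr (congrArg G.data.one (a.src_app x).symm) rfl _).trans
          (G.data.one_comp _)
      comp_one := fun a => DNatTrans.ext' rfl rfl fun x =>
        (G.data.comp_congr rfl (congrArg G.data.one (a.tgt_app x).symm) _).trans
          (G.data.comp_one _)
      inv_comp := fun a => DNatTrans.ext' rfl rfl fun x =>
        (G.data.inv_comp _).trans (congrArg G.data.one (a.tgt_app x))
      comp_inv := fun a => DNatTrans.ext' rfl rfl fun x =>
        (G.data.comp_inv _).trans (congrArg G.data.one (a.src_app x))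
      assoc := fun _ _ _ _ _ => DNatTrans.ext' rfl rfl fun _ => G.data.assoc _ _ _ _ _ }
  src_smooth := fun _ _ hp => (isPlot_natTrans.1 hp).1.1
  tgt_smooth := fun _ _ hp => (isPlot_natTrans.1 hp).1.2
  one_smooth := fun n p hp => isPlot_natTrans.2 ⟨⟨hp, hp⟩, fun k f q hf hq =>
    G.one_smooth _ _ ((isPlot_functor.1 hp).1 k f q hf hq)⟩
  inv_smooth := fun n p hp => isPlot_natTrans.2
    ⟨⟨(isPlot_natTrans.1 hp).1.2, (isPlot_natTrans.1 hp).1.1⟩, fun k f q hf hq =>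
    G.inv_smooth _ _ ((isPlot_natTrans.1 hp).2 k f q hf hq)⟩
  comp_smooth := fun n p q e hp hq => isPlot_natTrans.2
    ⟨⟨(isPlot_natTrans.1 hp).1.1, (isPlot_natTrans.1 hq).1.2⟩, fun k f r hf hr =>
    G.comp_smooth _ _ _ _ ((isPlot_natTrans.1 hp).2 k f r hf hr)
      ((isPlot_natTrans.1 hq).2 k f r hf hr)⟩

end MappingGroupoid

/-- Precomposition with a smooth functor `K' → K`, as a functor of mapping groupoids. -/
def precompFunctor {K : DGroupoid.{v}} {K' : DGroupoid.{w}} (ρ : DFunctor K' K)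
    (G : DGroupoid.{u}) : DFunctor (mappingGroupoid K G) (mappingGroupoid K' G) where
  obj F := ρ.comp F
  arr a :=
    { dom := ρ.comp a.dom
      cod := ρ.comp a.cod
      app := a.app ∘ ρ.obj
      app_smooth := a.app_smooth.comp ρ.obj_smooth
      src_app := fun x => a.src_app _
      tgt_app := fun x => a.tgt_app _
      naturality := fun r => by
        have h := a.naturality (ρ.arr r)
        rw [G.data.comp_congr rfl (congrArg a.app (ρ.tgt_arr r)),
          G.data.comp_congr (congrArg a.app (ρ.src_arr r)) rfl] at h
        exact h }
  obj_smooth := fun n p hp => isPlot_functor.2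
    ⟨fun k f q hf hq => (isPlot_functor.1 hp).1 k f _ hf (ρ.obj_smooth k q hq),
      fun k f q hf hq => (isPlot_functor.1 hp).2 k f _ hf (ρ.arr_smooth k q hq)⟩
  arr_smooth := fun n p hp => by
    obtain ⟨⟨h1, h2⟩, h3⟩ := isPlot_natTrans.1 hp
    refine isPlot_natTrans.2 ⟨⟨isPlot_functor.2 ⟨?_, ?_⟩, isPlot_functor.2 ⟨?_, ?_⟩⟩, ?_⟩
    · exact fun k f q hf hq => (isPlot_functor.1 h1).1 k f _ hf (ρ.obj_smooth k q hq)
    · exact fun k f q hf hq => (isPlot_functor.1 h1).2 k f _ hf (ρ.arr_smooth k q hq)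
    · exact fun k f q hf hq => (isPlot_functor.1 h2).1 k f _ hf (ρ.obj_smooth k q hq)
    · exact fun k f q hf hq => (isPlot_functor.1 h2).2 k f _ hf (ρ.arr_smooth k q hq)
    · exact fun k f q hf hq => h3 k f _ hf (ρ.obj_smooth k q hq)
  src_arr _ := rfl
  tgt_arr _ := rfl
  map_one _ := rfl
  map_comp _ _ _ := rfl

/-- Postcomposition with a smooth functor `G → G'`, as a functor of mapping groupoids. -/
def postcompFunctor (K : DGroupoid.{v}) {G : DGroupoid.{u}} {G' : DGroupoid.{w}}
    (φ : DFunctor G G') : DFunctor (mappingGroupoid K G) (mappingGroupoid K G') where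
  obj F := F.comp φ
  arr a :=
    { dom := a.dom.comp φ
      cod := a.cod.comp φ
      app := φ.arr ∘ a.app
      app_smooth := φ.arr_smooth.comp a.app_smooth
      src_app := fun x => (φ.src_arr _).trans (congrArg φ.obj (a.src_app x))
      tgt_app := fun x => (φ.tgt_arr _).trans (congrArg φ.obj (a.tgt_app x))
      naturality := fun r => by
        have h := congrArg φ.arr (a.naturality r)
        rw [φ.map_comp, φ.map_comp] at h
        exact h }
  obj_smooth := fun n p hp => isPlot_functor.2
    ⟨fun k f q hf hq => φ.obj_smooth k _ ((isPlot_functor.1 hp).1 k f _ hf hq),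
      fun k f q hf hq => φ.arr_smooth k _ ((isPlot_functor.1 hp).2 k f _ hf hq)⟩
  arr_smooth := fun n p hp => by
    obtain ⟨⟨h1, h2⟩, h3⟩ := isPlot_natTrans.1 hp
    refine isPlot_natTrans.2 ⟨⟨isPlot_functor.2 ⟨?_, ?_⟩, isPlot_functor.2 ⟨?_, ?_⟩⟩, ?_⟩
    · exact fun k f q hf hq => φ.obj_smooth k _ ((isPlot_functor.1 h1).1 k f _ hf hq)
    · exact fun k f q hf hq => φ.arr_smooth k _ ((isPlot_functor.1 h1).2 k f _ hf hq)
    · exact fun k f q hf hq => φ.obj_smooth k _ ((isPlot_functor.1 h2).1 k f _ hf hq)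
    · exact fun k f q hf hq => φ.arr_smooth k _ ((isPlot_functor.1 h2).2 k f _ hf hq)
    · exact fun k f q hf hq => φ.arr_smooth k _ (h3 k f _ hf hq)
  src_arr _ := rfl
  tgt_arr _ := rfl
  map_one F := DNatTrans.ext' rfl rfl fun x => φ.map_one _
  map_comp a b e := DNatTrans.ext' rfl rfl fun x => φ.map_comp _ _ _

/-! ### The nerve and the Čech–Deligne complex -/

/-- The space `G_k` of strings of `k` composable arrows `x₀ → x₁ → ⋯ → x_k` of a groupoid,
presented together with all composites: `vtx i` is `x_i`, `arr i j` is the induced arrow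
`x_i → x_j` (for `j < i` the inverse of the composite).  The string itself is
`arr 0 1, arr 1 2, …, arr (k-1) k`, and it determines everything else; `G_0` is the space of
objects. -/
@[ext]
structure Nerve (G : DGroupoid.{u}) (k : ℕ) where
  vtx : Fin (k + 1) → G.Obj
  arr : Fin (k + 1) → Fin (k + 1) → G.Arr
  src_arr : ∀ i j, G.data.src (arr i j) = vtx i
  tgt_arr : ∀ i j, G.data.tgt (arr i j) = vtx j
  comp_arr : ∀ i j l, G.data.comp (arr i j) (arr j l)
    ((tgt_arr i j).trans (src_arr j l).symm) = arr i l

namespace Nerve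

variable {G : DGroupoid.{u}}

/-- A family of strings is smooth iff its vertices and arrows vary smoothly. -/
instance {k : ℕ} : DiffeologicalSpace (Nerve G k) :=
  (⨅ i, inducedDiffeology (fun x => x.vtx i)) ⊓
  ⨅ i, ⨅ j, inducedDiffeology (fun x => x.arr i j)

theorem isPlot_iff {k n : ℕ} {P : Euc n → Nerve G k} : IsPlot P ↔
    (∀ i, IsPlot (fun s => (P s).vtx i)) ∧ ∀ i j, IsPlot (fun s => (P s).arr i j) :=
  DiffeologicalSpace.isPlot_inf_iff.trans (and_congr DiffeologicalSpace.isPlot_iInf_iff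
    (DiffeologicalSpace.isPlot_iInf_iff.trans
      (forall_congr' fun _ => DiffeologicalSpace.isPlot_iInf_iff)))

/-- Reindexing of the vertices. -/
def reindex {k m : ℕ} (f : Fin (m + 1) → Fin (k + 1)) (x : Nerve G k) : Nerve G m where
  vtx i := x.vtx (f i)
  arr i j := x.arr (f i) (f j)
  src_arr _ _ := x.src_arr _ _
  tgt_arr _ _ := x.tgt_arr _ _
  comp_arr _ _ _ := x.comp_arr _ _ _

theorem reindex_smooth {k m : ℕ} (f : Fin (m + 1) → Fin (k + 1)) :
    DSmooth (reindex (G := G) f) := fun _ _ hp =>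
  isPlot_iff.2 ⟨fun i => (isPlot_iff.1 hp).1 (f i), fun i j => (isPlot_iff.1 hp).2 (f i) (f j)⟩

/-- The `i`-th face: drop the vertex `x_i` (drop the first or last arrow, or compose two
consecutive arrows). -/
def face {k : ℕ} (i : Fin (k + 2)) : Nerve G (k + 1) → Nerve G k := reindex i.succAbove

/-- The `i`-th degeneracy: repeat the vertex `x_i` (insert an identity arrow). -/
def degen {k : ℕ} (i : Fin (k + 1)) : Nerve G k → Nerve G (k + 1) := reindex i.predAbove

/-- The map of nerves induced by a smooth functor. -/
def map {H : DGroupoid.{v}} (F : DFunctor G H) {k : ℕ} (x : Nerve G k) : Nerve H k where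
  vtx i := F.obj (x.vtx i)
  arr i j := F.arr (x.arr i j)
  src_arr _ _ := (F.src_arr _).trans (congrArg F.obj (x.src_arr _ _))
  tgt_arr _ _ := (F.tgt_arr _).trans (congrArg F.obj (x.tgt_arr _ _))
  comp_arr i j l := (F.map_comp _ _ _).symm.trans (congrArg F.arr (x.comp_arr i j l))

theorem map_smooth {H : DGroupoid.{v}} (F : DFunctor G H) {k : ℕ} :
    DSmooth (map F (k := k)) := fun n _ hp =>
  isPlot_iff.2 ⟨fun i => F.obj_smooth n _ ((isPlot_iff.1 hp).1 i),
    fun i j => F.arr_smooth n _ ((isPlot_iff.1 hp).2 i j)⟩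

/-- The constant string at an object. -/
def const (x : G.Obj) (k : ℕ) : Nerve G k where
  vtx _ := x
  arr _ _ := G.data.one x
  src_arr _ _ := G.data.src_one x
  tgt_arr _ _ := G.data.tgt_one x
  comp_arr i j l := (G.data.comp_congr (congrArg G.data.one (G.data.src_one x).symm) rfl _).trans
    (G.data.one_comp _)

/-- The arrow between two of the ends of `r` (`false` the source, `true` the target). -/
def edgeArr (r : G.Arr) : Bool → Bool → G.Arr
  | false, false => G.data.one (G.data.src r)
  | false, true => r
  | true, false => G.data.inv r
  | true, true => G.data.one (G.data.tgt r)

theorem src_edgeArr (r : G.Arr) (b c : Bool) :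
    G.data.src (edgeArr r b c) = cond b (G.data.tgt r) (G.data.src r) := by
  cases b <;> cases c <;> simp [edgeArr, G.data.src_one, G.data.src_inv]

theorem tgt_edgeArr (r : G.Arr) (b c : Bool) :
    G.data.tgt (edgeArr r b c) = cond c (G.data.tgt r) (G.data.src r) := by
  cases b <;> cases c <;> simp [edgeArr, G.data.tgt_one, G.data.tgt_inv]

theorem comp_edgeArr (r : G.Arr) (b c d : Bool)
    (e : G.data.tgt (edgeArr r b c) = G.data.src (edgeArr r c d)) :
    G.data.comp (edgeArr r b c) (edgeArr r c d) e = edgeArr r b d := by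
  cases b <;> cases c <;> cases d <;> simp only [edgeArr]
  · exact G.data.one_comp' _ _ _
  · exact G.data.one_comp' _ _ _
  · exact G.data.comp_inv r
  · exact G.data.comp_one' _ _ _
  · exact G.data.comp_one' _ _ _
  · exact G.data.inv_comp r
  · exact G.data.one_comp' _ _ _
  · exact G.data.one_comp' _ _ _

/-- The string with vertices among the two ends of an arrow `r`: the vertex `i` is the source of
`r` if `b i = false` and its target if `b i = true`. -/
def edge (r : G.Arr) {k : ℕ} (b : Fin (k + 1) → Bool) : Nerve G k where
  vtx i := cond (b i) (G.data.tgt r) (G.data.src r)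
  arr i j := edgeArr r (b i) (b j)
  src_arr i j := src_edgeArr r _ _
  tgt_arr i j := tgt_edgeArr r _ _
  comp_arr i j l := comp_edgeArr r _ _ _ _

/-- The functors joined by a string of natural transformations. -/
def functor {K : DGroupoid.{v}} {q : ℕ} (Λ : Nerve (mappingGroupoid K G) q) (i : Fin (q + 1)) :
    DFunctor K G := Λ.vtx i

/-- The natural transformations of a string of natural transformations. -/
def trans {K : DGroupoid.{v}} {q : ℕ} (Λ : Nerve (mappingGroupoid K G) q) (i j : Fin (q + 1)) :
    DNatTrans K G := Λ.arr i j

theorem trans_dom {K : DGroupoid.{v}} {q : ℕ} (Λ : Nerve (mappingGroupoid K G) q)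
    (i j : Fin (q + 1)) : (Λ.trans i j).dom = Λ.functor i := Λ.src_arr i j

theorem trans_cod {K : DGroupoid.{v}} {q : ℕ} (Λ : Nerve (mappingGroupoid K G) q)
    (i j : Fin (q + 1)) : (Λ.trans i j).cod = Λ.functor j := Λ.tgt_arr i j

theorem eval_aux {K : DGroupoid.{v}} (α β γ : DNatTrans K G) (e : α.cod = β.dom)
    (hγ : DNatTrans.comp α β e = γ) (r r' : K.Arr) (hr : K.data.tgt r = K.data.src r')
    (e1 e2 e3 e4) :
    G.data.comp (G.data.comp (α.app (K.data.src r)) (α.cod.arr r) e1)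
      (G.data.comp (β.app (K.data.tgt r)) (β.cod.arr r') e2) e3 =
    G.data.comp (γ.app (K.data.src r)) (β.cod.arr (K.data.comp r r' hr)) e4 := by
  subst hγ
  obtain ⟨A, B, a, ha, has, hat, han⟩ := α
  obtain ⟨B', C, b, hb, hbs, hbt, hbn⟩ := β
  cases e
  dsimp only [DNatTrans.comp] at *
  have e5 : G.data.tgt (B.arr r) = G.data.src (b (K.data.tgt r)) :=
    (B.tgt_arr r).trans (hbs _).symm
  have e6 : G.data.tgt (b (K.data.src r)) = G.data.src (C.arr r) :=
    (hbt _).trans (C.src_arr r).symm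
  have e7 : G.data.tgt (C.arr r) = G.data.src (C.arr r') :=
    (C.tgt_arr r).trans ((congrArg C.obj hr).trans (C.src_arr r').symm)
  have e8 : G.data.tgt (a (K.data.src r)) = G.data.src (b (K.data.src r)) :=
    (hat _).trans (hbs _).symm
  have h1 : G.data.comp (B.arr r) (G.data.comp (b (K.data.tgt r)) (C.arr r') e2)
      (e5.trans (G.data.src_comp _ _ _).symm) =
      G.data.comp (b (K.data.src r)) (G.data.comp (C.arr r) (C.arr r') e7)
      (e6.trans (G.data.src_comp _ _ _).symm) := by
    rw [← G.data.assoc _ _ _ e5 e2, ← G.data.assoc _ _ _ e6 e7]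
    exact G.data.comp_congr (hbn r) rfl _
  rw [G.data.assoc _ _ _ e1 (e5.trans (G.data.src_comp _ _ _).symm), G.data.comp_congr rfl h1,
    ← G.data.assoc _ _ _ e8 (e6.trans (G.data.src_comp _ _ _).symm)]
  exact G.data.comp_congr rfl (C.map_comp r r' hr).symm _

/-- A string `Λ` of `q` composable natural transformations of functors `K → G`, a string `R` in
`K`, and a map `f` of indices give a string in `G` with vertices `Λ_{f i}(R_i)`: the arrow `i → j`
is `Λ_{f i}(R_i) → Λ_{f j}(R_i) → Λ_{f j}(R_j)`. -/
def eval {K : DGroupoid.{v}} {q k : ℕ} (Λ : Nerve (mappingGroupoid K G) q)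
    (f : Fin (k + 1) → Fin (q + 1)) (R : Nerve K k) : Nerve G k where
  vtx i := (Λ.functor (f i)).obj (R.vtx i)
  arr i j := G.data.comp ((Λ.trans (f i) (f j)).app (R.vtx i))
    ((Λ.functor (f j)).arr (R.arr i j))
    (by rw [DNatTrans.tgt_app, DFunctor.src_arr, trans_cod, R.src_arr])
  src_arr i j := by
    rw [G.data.src_comp, DNatTrans.src_app, trans_dom]
  tgt_arr i j := by
    rw [G.data.tgt_comp, DFunctor.tgt_arr, R.tgt_arr]
  comp_arr i j l := by
    have e : (Λ.trans (f i) (f j)).cod = (Λ.trans (f j) (f l)).dom :=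
      (trans_cod _ _ _).trans (trans_dom _ _ _).symm
    have h := eval_aux (Λ.trans (f i) (f j)) (Λ.trans (f j) (f l)) (Λ.trans (f i) (f l)) e
      (Λ.comp_arr (f i) (f j) (f l)) (R.arr i j) (R.arr j l)
      ((R.tgt_arr i j).trans (R.src_arr j l).symm)
    simp only [trans_cod, R.src_arr, R.tgt_arr, R.comp_arr] at h
    exact h (by rw [DNatTrans.tgt_app, DFunctor.src_arr, trans_cod, R.src_arr])
      (by rw [DNatTrans.tgt_app, DFunctor.src_arr, trans_cod, R.src_arr])
      (by rw [G.data.tgt_comp, G.data.src_comp, DFunctor.tgt_arr, R.tgt_arr, DNatTrans.src_app,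
        trans_dom])
      (by rw [DNatTrans.tgt_app, DFunctor.src_arr, trans_cod, R.src_arr])

theorem eval_plot {K : DGroupoid.{v}} {q k n : ℕ} {P : Euc n → Nerve (mappingGroupoid K G) q}
    (hP : IsPlot P) (f : Fin (k + 1) → Fin (q + 1)) {R : Euc n → Nerve K k} (hR : IsPlot R) :
    IsPlot (fun s => (P s).eval f (R s)) := by
  obtain ⟨hv, ha⟩ := isPlot_iff.1 hP
  obtain ⟨hv', ha'⟩ := isPlot_iff.1 hR
  refine isPlot_iff.2 ⟨fun i => ?_, fun i j => ?_⟩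
  · exact (isPlot_functor.1 (hv (f i))).1 n id _ contDiff_id (hv' i)
  · exact G.comp_smooth _ _ _ _
      ((isPlot_natTrans.1 (ha (f i) (f j))).2 n id _ contDiff_id (hv' i))
      ((isPlot_functor.1 (hv (f j))).2 n id _ contDiff_id (ha' i j))

theorem const_plot {n : ℕ} {x : Euc n → G.Obj} (hx : IsPlot x) (k : ℕ) :
    IsPlot (fun s => const (x s) k) :=
  isPlot_iff.2 ⟨fun _ => hx, fun _ _ => G.one_smooth n _ hx⟩

end Nerve

section Complex

variable (G : DGroupoid.{u})

/-- The Čech differential `δ = ∑ (-1)^i δ_i`, with `δ_i` the pullback along the `i`-th face. -/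
def cechDelta (k l : ℕ) : DSec (Nerve G k) l →+ DSec (Nerve G (k + 1)) l :=
  ∑ i : Fin (k + 2), ((-1 : ℤ) ^ (i : ℕ)) •
    DSec.pull (Nerve.face (G := G) i) (Nerve.reindex_smooth _) l

/-- The bidegrees `(k, l)` with `k + l = i` and `l < p`. -/
structure Bideg (p i : ℕ) where
  k : ℕ
  l : ℕ
  add : k + l = i
  lt : l < p

/-- The group of Čech cochains of total degree `i` with values in the complex
`ℂˣ(p) : ℂˣ → 𝒜¹ → ⋯ → 𝒜^{p-1}`: a section over `G_k` of the degree `l` term, for all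
`k + l = i` with `l < p`. -/
abbrev Cochain (p i : ℕ) : Type u :=
  ∀ a : Bideg p i, DSec (Nerve G a.k) a.l

variable {G} in
/-- The Čech part of the total differential. -/
def Cochain.delta {p i : ℕ} (c : Cochain G p i) : Cochain G p (i + 1)
  | ⟨0, _, _, _⟩ => 0
  | ⟨k + 1, l, h, hl⟩ => cechDelta G k l (c ⟨k, l, by omega, hl⟩)

variable {G} in
/-- The part of the total differential coming from the complex `ℂˣ(p)`. -/
def Cochain.vert {p i : ℕ} (c : Cochain G p i) : Cochain G p (i + 1)
  | ⟨_, 0, _, _⟩ => 0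
  | ⟨k, l + 1, h, hl⟩ => DSec.d l (c ⟨k, l, by omega, by omega⟩)

/-- The total differential `δ + (-1)^{i+1} d` from degree `i` to degree `i + 1`. -/
def Cochain.D (p i : ℕ) : Cochain G p i →+ Cochain G p (i + 1) where
  toFun c := c.delta + (-1 : ℤ) ^ (i + 1) • c.vert
  map_zero' := by
    funext ⟨k, l, h, hl⟩
    rcases k with _ | k <;> rcases l with _ | l <;>
      simp [Cochain.delta, Cochain.vert]
  map_add' a b := by
    funext ⟨k, l, h, hl⟩
    rcases k with _ | k <;> rcases l with _ | l <;>
      simp [Cochain.delta, Cochain.vert, add_add_add_comm]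

variable {G} in
/-- The identification `Č^i(G, ℂˣ(p)) = Č^i(G, ℂˣ(p+1))` for `i < p`: in these degrees the
truncation of the complex plays no role. -/
def Cochain.lift {p i : ℕ} (hp : i < p) (c : Cochain G p i) : Cochain G (p + 1) i :=
  fun a => c ⟨a.k, a.l, a.add, by have := a.add; omega⟩

variable {G} in
/-- Pullback of cochains along a smooth functor. -/
def Cochain.pull {H : DGroupoid.{v}} (F : DFunctor G H) (p i : ℕ) :
    Cochain H p i →+ Cochain G p i where
  toFun c := fun a => DSec.pull (Nerve.map F) (Nerve.map_smooth F) a.l (c a)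
  map_zero' := by funext a; simp
  map_add' a b := by funext a; simp

/-- The normalized cochains: those all of whose components vanish on degenerate strings, i.e.
restrict to zero along every degeneracy. -/
def normalized (p i : ℕ) : AddSubgroup (Cochain G p i) where
  carrier := {c | ∀ (k l : ℕ) (h : k + 1 + l = i) (hl : l < p) (j : Fin (k + 1)),
    DSec.pull (Nerve.degen (G := G) j) (Nerve.reindex_smooth _) l (c ⟨k + 1, l, h, hl⟩) = 0}
  zero_mem' := fun k l h hl j => map_zero _
  add_mem' := fun {a b} ha hb k l h hl j => by
    rw [Pi.add_apply, map_add, ha k l h hl j,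
      hb k l h hl j, add_zero]
  neg_mem' := fun {a} ha k l h hl j => by
    rw [Pi.neg_apply, map_neg, ha k l h hl j, neg_zero]

theorem DSec.pull_d {X : Type u} {Y : Type v} [DiffeologicalSpace X] [DiffeologicalSpace Y]
    (φ : X → Y) (hφ : DSmooth φ) : ∀ (l : ℕ) (s : DSec Y l),
    DSec.pull φ hφ (l + 1) (DSec.d l s) = DSec.d l (DSec.pull φ hφ l s)
  | 0, _ => rfl
  | _ + 1, _ => rfl

theorem DSec.pull_pull {X : Type u} {Y : Type v} {Z : Type w} [DiffeologicalSpace X]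
    [DiffeologicalSpace Y] [DiffeologicalSpace Z] (φ : X → Y) (hφ : DSmooth φ) (ψ : Y → Z)
    (hψ : DSmooth ψ) : ∀ (l : ℕ) (s : DSec Z l),
    DSec.pull φ hφ l (DSec.pull ψ hψ l s) = DSec.pull (ψ ∘ φ) (hψ.comp hφ) l s
  | 0, _ => rfl
  | _ + 1, _ => rfl

variable {G} in
theorem Cochain.pull_D {H : DGroupoid.{v}} (F : DFunctor G H) (p i : ℕ) (c : Cochain H p i) :
    Cochain.pull F p (i + 1) (Cochain.D H p i c) = Cochain.D G p i (Cochain.pull F p i c) := by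
  funext ⟨k, l, h, hl⟩
  have key : ∀ k l (s : DSec (Nerve H k) l),
      DSec.pull (Nerve.map F) (Nerve.map_smooth F) l (cechDelta H k l s) =
      cechDelta G k l (DSec.pull (Nerve.map F) (Nerve.map_smooth F) l s) := by
    intro k l s
    simp only [cechDelta, AddMonoidHom.finsetSum_apply, map_sum, AddMonoidHom.coe_smul,
      Pi.smul_apply, map_zsmul]
    exact Finset.sum_congr rfl fun x _ => congrArg _
      ((DSec.pull_pull _ _ _ _ _ _).trans
        (DSec.pull_pull (Nerve.face (G := G) x) (Nerve.reindex_smooth _) (Nerve.map F)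
          (Nerve.map_smooth F) l s).symm)
  rcases k with _ | k <;> rcases l with _ | l <;>
    simp [Cochain.D, Cochain.pull, Cochain.delta, Cochain.vert, key, DSec.pull_d]

end Complex

/-! ### Cohomology of a cochain complex -/

section Cohomology

variable {A : ℕ → Type u} [∀ i, AddCommGroup (A i)] (D : ∀ i, A i →+ A (i + 1))

/-- The coboundaries of a cochain complex concentrated in degrees `≥ 0`. -/
def coboundaries : ∀ i : ℕ, AddSubgroup (A i)
  | 0 => ⊥
  | i + 1 => (D i).range

/-- The `i`-th cohomology group: cocycles modulo coboundaries. -/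
abbrev Cohomology (i : ℕ) : Type u :=
  (D i).ker ⧸ (coboundaries D i).addSubgroupOf (D i).ker

/-- The cohomology class of a cocycle. -/
def cls (i : ℕ) (c : A i) (hc : D i c = 0) : Cohomology D i :=
  QuotientAddGroup.mk ⟨c, hc⟩

end Cohomology

/-! ### The circle groupoids and the loop groupoid -/

/-- An admissible cover of the circle: subdivision points
`0 = pt 0 < pt 1 < ⋯ < pt N = 1`, continued periodically to all of `ℝ`, and a small `ε`.  The
cover of `ℝ` consists of the intervals `V j = (pt j - ε, pt (j+1) + ε)`, `j ∈ ℤ`; the bound on `ε`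
says that `V j` and `V (j + 1)` meet in `(pt (j+1) - ε, pt (j+1) + ε)` and that intervals whose
indices are further apart are disjoint. -/
structure AdmissibleCover where
  N : ℕ
  N_pos : 0 < N
  pt : ℤ → ℝ
  pt_strictMono : StrictMono pt
  pt_zero : pt 0 = 0
  pt_periodic : ∀ j, pt (j + N) = pt j + 1
  ε : ℝ
  ε_pos : 0 < ε
  ε_small : ∀ j, 2 * ε ≤ pt (j + 1) - pt j

namespace AdmissibleCover

variable (W : AdmissibleCover)

/-- The intervals of the cover of `ℝ`. -/
def V (j : ℤ) : Set ℝ := Set.Ioo (W.pt j - W.ε) (W.pt (j + 1) + W.ε)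

/-- Objects of the circle groupoid: points of the disjoint union of the intervals `V j`. -/
@[ext]
structure CObj where
  idx : ℤ
  x : ℝ
  mem : x ∈ W.V idx

/-- Arrows of the circle groupoid: from the point `x` of `V i` to the point `x + m` of `V j`. -/
@[ext]
structure CArr where
  i : ℤ
  j : ℤ
  m : ℤ
  x : ℝ
  mem_src : x ∈ W.V i
  mem_tgt : x + m ∈ W.V j

instance : DiffeologicalSpace W.CObj :=
  @inducedDiffeology _ _ (discreteDiffeology ℤ) CObj.idx ⊓ inducedDiffeology CObj.x

instance : DiffeologicalSpace W.CArr :=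
  @inducedDiffeology _ _ (discreteDiffeology ℤ) CArr.i ⊓
  @inducedDiffeology _ _ (discreteDiffeology ℤ) CArr.j ⊓
  @inducedDiffeology _ _ (discreteDiffeology ℤ) CArr.m ⊓ inducedDiffeology CArr.x

variable {W}

theorem isPlot_CObj {n : ℕ} {P : Euc n → W.CObj} : IsPlot P ↔
    (∀ x, ∀ᶠ y in 𝓝 x, (P y).idx = (P x).idx) ∧ ContDiff ℝ ∞ (fun s => (P s).x) :=
  DiffeologicalSpace.isPlot_inf_iff.trans (and_congr Iff.rfl
    (isPlot_iff_contDiff (p := fun s => (P s).x)))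

theorem isPlot_CArr {n : ℕ} {P : Euc n → W.CArr} : IsPlot P ↔
    (((∀ x, ∀ᶠ y in 𝓝 x, (P y).i = (P x).i) ∧ ∀ x, ∀ᶠ y in 𝓝 x, (P y).j = (P x).j) ∧
      ∀ x, ∀ᶠ y in 𝓝 x, (P y).m = (P x).m) ∧ ContDiff ℝ ∞ (fun s => (P s).x) :=
  DiffeologicalSpace.isPlot_inf_iff.trans (and_congr
    (DiffeologicalSpace.isPlot_inf_iff.trans (and_congr
      (DiffeologicalSpace.isPlot_inf_iff.trans Iff.rfl) Iff.rfl))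
      (isPlot_iff_contDiff (p := fun s => (P s).x)))

theorem contDiff_locConst {n : ℕ} {f : Euc n → ℤ} (hf : ∀ x, ∀ᶠ y in 𝓝 x, f y = f x) :
    ContDiff ℝ ∞ (fun s => (f s : ℝ)) :=
  contDiff_iff_contDiffAt.2 fun x =>
    (contDiffAt_const (c := (f x : ℝ))).congr_of_eventuallyEq
      ((hf x).mono fun y hy => by simp [hy])

variable (W)

/-- The groupoid presenting the circle that is associated with an admissible cover: the groupoid of
the cover of `ℝ`, enlarged by the translations by integers. -/
def circle : DGroupoid.{0} where
  Obj := W.CObj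
  Arr := W.CArr
  data :=
    { src := fun r => ⟨r.i, r.x, r.mem_src⟩
      tgt := fun r => ⟨r.j, r.x + r.m, r.mem_tgt⟩
      one := fun a => ⟨a.idx, a.idx, 0, a.x, a.mem, by simpa using a.mem⟩
      inv := fun r => ⟨r.j, r.i, -r.m, r.x + r.m, r.mem_tgt, by simpa using r.mem_src⟩
      comp := fun r r' e => ⟨r.i, r'.j, r.m + r'.m, r.x, r.mem_src, by
        have h : r.x + r.m = r'.x := congrArg CObj.x e
        have h' := r'.mem_tgt
        rw [← h] at h'
        push_cast
        rwa [← add_assoc]⟩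
      src_one := fun _ => rfl
      tgt_one := fun a => by ext <;> simp
      src_inv := fun _ => rfl
      tgt_inv := fun r => by ext <;> simp
      src_comp := fun _ _ _ => rfl
      tgt_comp := fun r r' e => by
        have h : r.x + r.m = r'.x := congrArg CObj.x e
        ext
        · rfl
        · simp [← h, add_assoc]
      one_comp := fun r => by ext <;> simp
      comp_one := fun r => by ext <;> simp
      inv_comp := fun r => by ext <;> simp
      comp_inv := fun r => by ext <;> simp
      assoc := fun _ _ _ _ _ => by ext <;> simp [add_assoc] }
  src_smooth := fun n p hp => by
    obtain ⟨⟨⟨h1, h2⟩, h3⟩, h4⟩ := isPlot_CArr.1 hp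
    exact isPlot_CObj.2 ⟨h1, h4⟩
  tgt_smooth := fun n p hp => by
    obtain ⟨⟨⟨h1, h2⟩, h3⟩, h4⟩ := isPlot_CArr.1 hp
    exact isPlot_CObj.2 ⟨h2, h4.add (contDiff_locConst h3)⟩
  one_smooth := fun n p hp => by
    obtain ⟨h1, h4⟩ := isPlot_CObj.1 hp
    exact isPlot_CArr.2 ⟨⟨⟨h1, h1⟩, fun x => by simp⟩, h4⟩
  inv_smooth := fun n p hp => by
    obtain ⟨⟨⟨h1, h2⟩, h3⟩, h4⟩ := isPlot_CArr.1 hp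
    exact isPlot_CArr.2 ⟨⟨⟨h2, h1⟩, fun x => (h3 x).mono fun y hy => by simp [hy]⟩,
      h4.add (contDiff_locConst h3)⟩
  comp_smooth := fun n p q e hp hq => by
    obtain ⟨⟨⟨h1, h2⟩, h3⟩, h4⟩ := isPlot_CArr.1 hp
    obtain ⟨⟨⟨k1, k2⟩, k3⟩, k4⟩ := isPlot_CArr.1 hq
    exact isPlot_CArr.2 ⟨⟨⟨h1, k2⟩, fun x => by
      filter_upwards [h3 x, k3 x] with y hy hy'
      simp [hy, hy']⟩, h4⟩

variable {W}

/-- `Refines W W'` says that `W'` refines `W`, i.e. its subdivision points contain those of `W` and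
its `ε` is not larger: the segment `[pt j, pt (j+1)]` of `W'` lies in the segment of `W` with index
`idx j`. -/
structure Refines (W W' : AdmissibleCover) where
  idx : ℤ → ℤ
  le_pt : ∀ j, W.pt (idx j) ≤ W'.pt j
  pt_le : ∀ j, W'.pt (j + 1) ≤ W.pt (idx j + 1)
  ε_le : W'.ε ≤ W.ε

theorem Refines.mem {W W' : AdmissibleCover} (r : Refines W W') {j : ℤ} {x : ℝ}
    (hx : x ∈ W'.V j) : x ∈ W.V (r.idx j) := by
  have h1 := r.le_pt j
  have h2 := r.pt_le j
  have h3 := r.ε_le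
  obtain ⟨a, b⟩ := hx
  exact ⟨by linarith, by linarith⟩

/-- The functor of circle groupoids given by a refinement: it is the identity on coordinates. -/
def Refines.functor {W W' : AdmissibleCover} (r : Refines W W') : DFunctor W'.circle W.circle where
  obj a := ⟨r.idx a.idx, a.x, r.mem a.mem⟩
  arr a := ⟨r.idx a.i, r.idx a.j, a.m, a.x, r.mem a.mem_src, r.mem a.mem_tgt⟩
  obj_smooth := fun n p hp => by
    obtain ⟨h1, h4⟩ := isPlot_CObj.1 hp
    exact isPlot_CObj.2 ⟨fun x => (h1 x).mono fun y hy => congrArg r.idx hy, h4⟩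
  arr_smooth := fun n p hp => by
    obtain ⟨⟨⟨h1, h2⟩, h3⟩, h4⟩ := isPlot_CArr.1 hp
    exact isPlot_CArr.2 ⟨⟨⟨fun x => (h1 x).mono fun y hy => congrArg r.idx hy,
      fun x => (h2 x).mono fun y hy => congrArg r.idx hy⟩, h3⟩, h4⟩
  src_arr _ := rfl
  tgt_arr _ := rfl
  map_one _ := rfl
  map_comp _ _ _ := rfl

/-- The groupoid `LG(W)` of loops adapted to the cover `W`: smooth functors from the circle groupoid
to `G`, and smooth natural transformations between them. -/
abbrev LG (G : EtaleGroupoid.{u}) (W : AdmissibleCover) : DGroupoid.{u} :=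
  mappingGroupoid W.circle G.toD

/-- The inclusion `LG(W) → LG(W')` for a refinement `W'` of `W`. -/
def incl (G : EtaleGroupoid.{u}) {W W' : AdmissibleCover} (r : Refines W W') :
    DFunctor (LG G W) (LG G W') := precompFunctor r.functor G.toD

/-- The functor `LG(W) → LG'(W)` induced by a smooth functor `G → G'`. -/
def loopMap {G G' : EtaleGroupoid.{u}} (f : DFunctor G.toD G'.toD) (W : AdmissibleCover) :
    DFunctor (LG G W) (LG G' W) := postcompFunctor W.circle f

end AdmissibleCover

open AdmissibleCover

section LoopCochains

variable (G : EtaleGroupoid.{u})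

/-- Cochains on the loop groupoid `LG`, the union (colimit) of the groupoids `LG(W)` over all
admissible covers `W`: functions and forms on a union are families of functions and forms on the
`LG(W)` that are compatible with the inclusions `LG(W) → LG(W')`. -/
def LoopCochain (p i : ℕ) : AddSubgroup (∀ W : AdmissibleCover, Cochain (LG G W) p i) where
  carrier := {c | ∀ (W W' : AdmissibleCover) (r : Refines W W'),
    Cochain.pull (incl G r) p i (c W') = c W}
  zero_mem' := fun W W' r => map_zero _
  add_mem' := fun {a b} ha hb W W' r => by
    rw [Pi.add_apply, Pi.add_apply, map_add, ha W W' r, hb W W' r]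
  neg_mem' := fun {a} ha W W' r => by
    rw [Pi.neg_apply, Pi.neg_apply, map_neg, ha W W' r]

/-- The total differential of cochains on `LG`. -/
def LoopCochain.D (p i : ℕ) : LoopCochain G p i →+ LoopCochain G p (i + 1) where
  toFun c := ⟨fun W => Cochain.D (LG G W) p i (c.1 W), fun W W' r => by
    rw [Cochain.pull_D, c.2 W W' r]⟩
  map_zero' := by ext W; simp
  map_add' a b := by ext W; simp

variable {G}

/-- The identification `Č^i(LG, ℂˣ(p)) = Č^i(LG, ℂˣ(p+1))` for `i < p`. -/
def LoopCochain.lift {p i : ℕ} (hp : i < p) (c : LoopCochain G p i) : LoopCochain G (p + 1) i :=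
  ⟨fun W => (c.1 W).lift hp, fun W W' r => by
    funext a
    exact congrFun (c.2 W W' r) ⟨a.k, a.l, a.add, by have := a.add; omega⟩⟩

/-- Pullback of cochains on loop groupoids along the functor `LG → LG'` induced by a smooth functor
`G → G'`. -/
def LoopCochain.pull {G' : EtaleGroupoid.{u}} (f : DFunctor G.toD G'.toD) (p i : ℕ)
    (c : LoopCochain G' p i) : LoopCochain G p i :=
  ⟨fun W => Cochain.pull (loopMap f W) p i (c.1 W), fun W W' r => by
    dsimp only
    rw [← c.2 W W' r]
    funext a
    exact (DSec.pull_pull _ _ _ _ _ _).trans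
      (DSec.pull_pull (Nerve.map (loopMap f W)) (Nerve.map_smooth _) (Nerve.map (incl G' r))
        (Nerve.map_smooth _) a.l (c.1 W' a)).symm⟩

end LoopCochains

/-! ### The holonomy formula -/

section Formula

variable {G : EtaleGroupoid.{u}} (W : AdmissibleCover)

/-- The centre of the segment `[pt j, pt (j+1)]`. -/
def AdmissibleCover.mid (j : ℤ) : ℝ := (W.pt j + W.pt (j + 1)) / 2

/-- A bump function equal to `1` on `[pt j, pt (j+1)]` and supported in `V j`. -/
def AdmissibleCover.bump (j : ℤ) : ContDiffBump (W.mid j) where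
  rIn := (W.pt (j + 1) - W.pt j) / 2
  rOut := (W.pt (j + 1) - W.pt j) / 2 + W.ε
  rIn_pos := by have := W.pt_strictMono (lt_add_one j); linarith
  rIn_lt_rOut := by have := W.ε_pos; linarith

/-- A smooth map from `ℝ` to the interval `V j` which is the identity on `[pt j, pt (j+1)]`. -/
def AdmissibleCover.clamp (j : ℤ) (t : ℝ) : ℝ := W.mid j + W.bump j t * (t - W.mid j)

theorem AdmissibleCover.clamp_mem (j : ℤ) (t : ℝ) : W.clamp j t ∈ W.V j := by
  have h0 := (W.bump j).nonneg (x := t)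
  have h1 := (W.bump j).le_one (x := t)
  have hpos : 0 < (W.bump j).rOut := (W.bump j).rOut_pos
  have key : |W.bump j t * (t - W.mid j)| < (W.bump j).rOut := by
    by_cases h : (W.bump j).rOut ≤ dist t (W.mid j)
    · rw [(W.bump j).zero_of_le_dist h]; simpa using hpos
    · rw [abs_mul, abs_of_nonneg h0]
      rw [not_le, Real.dist_eq] at h
      calc W.bump j t * |t - W.mid j| ≤ 1 * |t - W.mid j| :=
            mul_le_mul_of_nonneg_right h1 (abs_nonneg _)
        _ < _ := by rwa [one_mul]
  have e : (W.bump j).rOut = (W.pt (j + 1) - W.pt j) / 2 + W.ε := rfl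
  have e' : W.mid j = (W.pt j + W.pt (j + 1)) / 2 := rfl
  rw [abs_lt, e] at key
  obtain ⟨k1, k2⟩ := key
  constructor <;> rw [clamp] <;> linarith

theorem AdmissibleCover.clamp_of_mem (j : ℤ) (t : ℝ) (ht : t ∈ Set.Icc (W.pt j) (W.pt (j + 1))) :
    W.clamp j t = t := by
  have h : W.bump j t = 1 := by
    refine (W.bump j).one_of_mem_closedBall ?_
    rw [Metric.mem_closedBall, Real.dist_eq, abs_le]
    simp only [bump, mid]
    constructor <;> linarith [ht.1, ht.2]
  rw [clamp, h]; ring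

theorem AdmissibleCover.clamp_contDiff (j : ℤ) : ContDiff ℝ ∞ (W.clamp j) :=
  contDiff_const.add ((W.bump j).contDiff.mul (contDiff_id.sub contDiff_const))

/-- The point of the `j`-th interval with coordinate `t`, for `t ∈ [pt j, pt (j+1)]`. -/
def AdmissibleCover.seg (j : ℤ) (t : ℝ) : W.circle.Obj := (⟨j, W.clamp j t, W.clamp_mem j t⟩ : W.CObj)

/-- The arrow of the circle groupoid over the end `pt (j+1)` of the `j`-th interval, `j < N`, that
leads into the next interval: from `pt (j+1) ∈ V j` to `pt (j+1) ∈ V (j+1)` if `j + 1 < N`, and from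
`pt N = 1 ∈ V (N-1)` to `0 ∈ V 0` if `j + 1 = N`. -/
def AdmissibleCover.glue (j : Fin W.N) : W.circle.Arr :=
  if h : (j : ℕ) + 1 < W.N then
    (⟨j, j + 1, 0, W.pt (j + 1),
      ⟨by have := W.pt_strictMono (lt_add_one (j : ℤ)); have := W.ε_pos; linarith,
        by have := W.ε_pos; linarith⟩,
      ⟨by have := W.ε_pos; push_cast; linarith,
        by have := W.pt_strictMono (lt_add_one ((j : ℤ) + 1)); have := W.ε_pos
           push_cast; linarith⟩⟩ : W.CArr)
  else
    (⟨j, 0, -1, W.pt (j + 1),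
      ⟨by have := W.pt_strictMono (lt_add_one (j : ℤ)); have := W.ε_pos; linarith,
        by have := W.ε_pos; linarith⟩, by
      have hN : ((j : ℕ) : ℤ) + 1 = 0 + W.N := by have := j.2; omega
      have h1 : W.pt (((j : ℕ) : ℤ) + 1) = 1 := by rw [hN, W.pt_periodic, W.pt_zero]; norm_num
      have h2 := W.pt_strictMono (lt_add_one (0 : ℤ))
      have h3 := W.ε_pos
      rw [h1, V, W.pt_zero]
      rw [W.pt_zero, zero_add] at h2
      rw [zero_add]
      constructor <;> push_cast <;> linarith⟩ : W.CArr)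

/-- Prepend a coordinate. -/
def Euc.cons {m : ℕ} (t : ℝ) (u : Euc m) : Euc (m + 1) := WithLp.toLp 2 (Fin.cons t u)

/-- Forget the first coordinate. -/
def Euc.tail {m : ℕ} (w : Euc (m + 1)) : Euc m := WithLp.toLp 2 (fun i => w i.succ)

theorem Euc.tail_contDiff {m : ℕ} : ContDiff ℝ ∞ (Euc.tail (m := m)) := by
  unfold Euc.tail
  fun_prop

/-- For a smooth family `P u` of strings of loops, the family of strings
`(t, u) ↦ (P u)_j(t)` in `G`, where `t` runs through the `j`-th segment. -/
def pathPlot {q m : ℕ} (P : Plot m (Nerve (LG G W) q)) (j : ℤ) :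
    Plot (m + 1) (Nerve G.toD q) :=
  ⟨fun w => (P.1 (Euc.tail w)).eval id (Nerve.const (W.seg j (w 0)) q), by
    refine Nerve.eval_plot (isPlot_reparam P.2 Euc.tail_contDiff) id (Nerve.const_plot ?_ q)
    refine isPlot_CObj.2 ⟨fun x => by simp [seg], ?_⟩
    exact (W.clamp_contDiff j).comp (by fun_prop)⟩

/-- The string `(Λ¹_j(α), …, Λᵐ_j(α), ψᵐ(α), Λ^{m+1}_{j+1}(α), …, Λ^q_{j+1}(α))` of `q + 1` arrows of
`G` for `α = pt (j+1)`: it consists of the objects `ψ⁰_j(α) → ⋯ → ψᵐ_j(α)`, followed by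
`ψᵐ_{j+1}(α) → ⋯ → ψ^q_{j+1}(α)`. -/
def prism {q : ℕ} (Λ : Nerve (LG G W) q) (j : Fin W.N) (m : Fin (q + 1)) : Nerve G.toD (q + 1) :=
  Λ.eval m.predAbove (Nerve.edge (W.glue j) (fun b => decide (m.castSucc < b)))

/-- The previous string for a smooth family of strings of loops. -/
def prismPlot {q n : ℕ} (P : Plot n (Nerve (LG G W) q)) (j : Fin W.N) (m : Fin (q + 1)) :
    Plot n (Nerve G.toD (q + 1)) :=
  ⟨fun s => prism W (P.1 s) j m, Nerve.eval_plot P.2 _ isPlot_const⟩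

/-- The cochain `b = (F, Δ¹, …, Δⁿ)` on `LG(W)` is the generalized holonomy of the cochain
`c = (ω, θ¹, …, θ^{n+1})` on `G`.  On a string `Λ` of `n` composable arrows of `LG(W)`,
`F(Λ) = exp (∑_j ∫_{I_j} Λ_j^* θ¹) ∏_j ∏_m ω(prism Λ j m)^{(-1)^{m+n+1}}`, and
`Δ^{k}` is, on a smooth family of strings of `q = n - k` arrows with parameter `u` and on tangent
vectors `v₁, …, v_k` to the family, the sum of `∑_j ∫_{I_j} θ^{k+1}(∂/∂t, v₁, …, v_k) dt` and
`∑_j ∑_m (-1)^{m+n+1} (prism j m)^*θ^k (v₁, …, v_k)`. -/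
structure IsHolonomy {n : ℕ} (c : Cochain G.toD (n + 2) (n + 1))
    (b : Cochain (LG G W) (n + 1) n) : Prop where
  deg_zero : ∀ Λ : Nerve (LG G W) n,
    ((DSec.fn (b ⟨n, 0, by omega, by omega⟩) Λ : ℂˣ) : ℂ) =
      Complex.exp (∑ j : Fin W.N, ∫ t in (W.pt j)..(W.pt (j + 1)),
        DSec.form (c ⟨n, 0 + 1, by omega, by omega⟩)
          (pathPlot W (⟨fun _ : Euc 0 => Λ, isPlot_const⟩ : Plot 0 _) j)
          (Euc.cons t 0) (fun _ => Euc.cons 1 0)) *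
      ∏ j : Fin W.N, ∏ m : Fin (n + 1),
        ((DSec.fn (c ⟨n + 1, 0, by omega, by omega⟩) (prism W Λ j m) : ℂˣ) : ℂ) ^
          ((-1 : ℤ) ^ ((m : ℕ) + n + 1))
  deg_pos : ∀ (q k : ℕ) (h : q + (k + 1) = n) (d : ℕ) (P : Plot d (Nerve (LG G W) q))
    (u : Euc d) (v : Fin (k + 1) → Euc d),
    DSec.form (b ⟨q, k + 1, h, by omega⟩) P u v =
      (∑ j : Fin W.N, ∫ t in (W.pt j)..(W.pt (j + 1)),
        DSec.form (c ⟨q, k + 1 + 1, by omega, by omega⟩) (pathPlot W P j) (Euc.cons t u)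
          (Fin.cons (Euc.cons 1 0) (fun i => Euc.cons 0 (v i)))) +
      ∑ j : Fin W.N, ∑ m : Fin (q + 1), (-1 : ℂ) ^ ((m : ℕ) + n + 1) *
        DSec.form (c ⟨q + 1, k + 1, by omega, by omega⟩) (prismPlot W P j m) u v

end Formula

end Holonomy

end

open Holonomy AdmissibleCover

universe u

/-! The index `n` below stands for one less than the degree of the cochain on `G`. The holonomy is
`I + (-1)^(n+1) P`. Here `I` (`loopInt`) integrates over the segments of the circle, and
exponentiates the result in form degree 0. `P` (`gluePrism`) is the alternating sum of pullbacks to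
the prisms that a string of natural transformations spans over each glueing arrow.

Four facts make it commute with the total differentials. `I` commutes with the Čech differential δ,
because restriction to a segment commutes with faces (`cechDelta_loopInt`). `P` commutes with `d`,
because it is a signed sum of pullbacks (`d_gluePrism`). By Stokes, `I d + d I` is the sum over the
segments of the evaluation at the end minus the evaluation at the start
(`PathFamily.d_fiberInt_add`, `PathFamily.fiberInt_dlog`). By the prism homotopy, `P δ + δ P` is the
sum over the glueing arrows of the evaluation at the target minus the evaluation at the source
(`prismOp_cechDelta_succ`). Segments and glueing arrows close up around the circle, so the two
right-hand sides cancel (`sum_ends`), and `I d + d I + P δ + δ P = 0`. With the signs this is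
`holonomy_D`. Truncating the complex discards only the curvature, which the components involved
never use, so cocycles go to cocycles.

Under a refinement of the cover the integrals merely get subdivided, but each new subdivision point
inserts a prism over a unit arrow. Its strings are degenerate, so the formula is compatible with
refinements on normalized cochains. On all cochains, the map to the loop groupoid is therefore the
holonomy of the normalization. Sections over the nerve form a cosimplicial abelian group, that is, a
simplicial object of the opposite category, and the Dold–Kan projection `PInfty` normalizes them.
Since `PInfty` and its homotopy to the identity are natural, they commute with `d`. Hence
normalization commutes with the total differential and changes a cocycle only by a coboundary
(`exists_normalize_eq_add`). -/

noncomputable section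

set_option linter.unusedVariables false

namespace Holonomy

open scoped ContDiff Manifold Topology
open Diffeology AdmissibleCover

universe v w

/-! ### Integrals of smooth functions along the first coordinate -/

section ParametricIntegral

variable {m : ℕ} {F : Type} [NormedAddCommGroup F] [NormedSpace ℝ F]

/-- The inclusion `u ↦ (0, u)`. -/
def Euc.incl (m : ℕ) : Euc m →L[ℝ] Euc (m + 1) :=
  LinearMap.toContinuousLinearMap
    { toFun := fun u => Euc.cons 0 u
      map_add' := fun a b => by
        ext i; refine Fin.cases ?_ (fun i => ?_) i <;> simp [Euc.cons]
      map_smul' := fun c a => by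
        ext i; refine Fin.cases ?_ (fun i => ?_) i <;> simp [Euc.cons] }

theorem Euc.incl_apply (u : Euc m) : Euc.incl m u = Euc.cons 0 u := rfl

/-- The first basis vector. -/
abbrev Euc.e0 (m : ℕ) : Euc (m + 1) := Euc.cons 1 0

theorem Euc.cons_eq (t : ℝ) (u : Euc m) : Euc.cons t u = t • Euc.e0 m + Euc.incl m u := by
  ext i; refine Fin.cases ?_ (fun i => ?_) i <;> simp [Euc.cons, Euc.incl_apply]

@[simp] theorem Euc.cons_zero (t : ℝ) (u : Euc m) : Euc.cons t u 0 = t := rfl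

@[simp] theorem Euc.tail_cons (t : ℝ) (u : Euc m) : Euc.tail (Euc.cons t u) = u := by
  ext i; simp [Euc.cons, Euc.tail]

theorem Euc.cons_contDiff : ContDiff ℝ ∞ (fun p : ℝ × Euc m => Euc.cons p.1 p.2) := by
  rw [funext fun p : ℝ × Euc m => Euc.cons_eq p.1 p.2]; fun_prop

theorem Euc.cons_comp_contDiff {k : ℕ} {f : Euc k → ℝ} {g : Euc k → Euc m}
    (hf : ContDiff ℝ ∞ f) (hg : ContDiff ℝ ∞ g) :
    ContDiff ℝ ∞ (fun w => Euc.cons (f w) (g w)) :=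
  Euc.cons_contDiff.comp (hf.prodMk hg)

theorem Euc.hasFDerivAt_cons_right (t : ℝ) (u : Euc m) :
    HasFDerivAt (fun u => Euc.cons t u) (Euc.incl m) u := by
  rw [funext fun u => Euc.cons_eq t u]
  exact (Euc.incl m).hasFDerivAt.const_add _

theorem Euc.hasDerivAt_cons_left (t : ℝ) (u : Euc m) :
    HasDerivAt (fun t => Euc.cons t u) (Euc.e0 m) t := by
  rw [funext fun t => Euc.cons_eq t u]
  simpa using ((hasDerivAt_id t).smul_const (Euc.e0 m)).add_const (Euc.incl m u)

theorem Euc.continuous_cons_left (u : Euc m) : Continuous (fun t : ℝ => Euc.cons t u) :=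
  Euc.cons_contDiff.continuous.comp (g := fun p : ℝ × Euc m => Euc.cons p.1 p.2)
    (Continuous.prodMk_left u)

theorem intervalIntegrable_cons {m : ℕ} {F : Type} [NormedAddCommGroup F] {f : Euc (m + 1) → F} (hf : Continuous f) (u : Euc m) (a b : ℝ) :
    IntervalIntegrable (fun t => f (Euc.cons t u)) MeasureTheory.volume a b :=
  (hf.comp (Euc.continuous_cons_left u)).intervalIntegrable _ _

theorem intervalIntegral_zsmul (z : ℤ) (f : ℝ → ℂ) (a b : ℝ) :
    ∫ t in a..b, z • f t = z • ∫ t in a..b, f t := by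
  simp only [zsmul_eq_mul, intervalIntegral.integral_const_mul]

theorem hasFDerivAt_integral_cons [CompleteSpace F] {f : Euc (m + 1) → F} (hf : ContDiff ℝ 1 f) (a b : ℝ)
    (u : Euc m) :
    HasFDerivAt (fun u => ∫ t in a..b, f (Euc.cons t u))
      (∫ t in a..b, (fderiv ℝ f (Euc.cons t u)).comp (Euc.incl m)) u := by
  have hc : Continuous fun w => (fderiv ℝ f w).comp (Euc.incl m) :=
    (hf.continuous_fderiv one_ne_zero).clm_comp continuous_const
  -- The derivative is bounded on the compact product of the interval with a closed ball, and a
  -- constant dominates on a bounded interval.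
  obtain ⟨C, hC⟩ := ((isCompact_uIcc (a := a) (b := b)).prod
    (ProperSpace.isCompact_closedBall u 1)).exists_bound_of_continuousOn
    (f := fun p : ℝ × Euc m => (fderiv ℝ f (Euc.cons p.1 p.2)).comp (Euc.incl m))
    (hc.comp Euc.cons_contDiff.continuous).continuousOn
  refine intervalIntegral.hasFDerivAt_integral_of_dominated_of_fderiv_le
    (F' := fun u t => (fderiv ℝ f (Euc.cons t u)).comp (Euc.incl m))
    (bound := fun _ => C) (Metric.closedBall_mem_nhds u one_pos) ?_
    (intervalIntegrable_cons hf.continuous u a b)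
    (hc.comp (Euc.continuous_cons_left u)).aestronglyMeasurable ?_ (by simp) ?_
  · exact Filter.Eventually.of_forall fun x =>
      (hf.continuous.comp (Euc.continuous_cons_left x)).aestronglyMeasurable
  · exact Filter.Eventually.of_forall fun t ht x hx =>
      hC (t, x) ⟨Set.uIoc_subset_uIcc ht, hx⟩
  · exact Filter.Eventually.of_forall fun t ht x hx =>
      ((hf.differentiable one_ne_zero _).hasFDerivAt).comp x (Euc.hasFDerivAt_cons_right t x)

/-- The derivative of the integral is again an integral of the same kind, with values in a space of
linear maps. The induction on the order of differentiability therefore has to let the target space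
vary. -/
theorem contDiff_integral_cons [CompleteSpace F] {f : Euc (m + 1) → F} (hf : ContDiff ℝ ∞ f) (a b : ℝ) :
    ContDiff ℝ ∞ (fun u => ∫ t in a..b, f (Euc.cons t u)) := by
  rw [contDiff_infty]
  intro n
  induction n generalizing F with
  | zero =>
    exact contDiff_zero.2 (continuous_iff_continuousAt.2 fun u =>
      (hasFDerivAt_integral_cons (hf.of_le (by simp)) a b u).continuousAt)
  | succ n ih =>
    have h1 := fun u => hasFDerivAt_integral_cons (hf.of_le (by simp)) a b u
    refine (contDiff_succ_iff_fderiv (n := n)).2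
      ⟨fun u => (h1 u).differentiableAt, by simp, ?_⟩
    have e : fderiv ℝ (fun u => ∫ t in a..b, f (Euc.cons t u)) = fun u =>
        ∫ t in a..b, (fderiv ℝ f (Euc.cons t u)).comp (Euc.incl m) := funext fun u => (h1 u).fderiv
    rw [e]
    exact ih (f := fun w => (fderiv ℝ f w).comp (Euc.incl m))
      ((hf.fderiv_right (m := ∞) (by simp)).clm_comp contDiff_const)

theorem fderiv_integral_cons [CompleteSpace F] {f : Euc (m + 1) → F} (hf : ContDiff ℝ ∞ f) (a b : ℝ)
    (u v : Euc m) :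
    fderiv ℝ (fun u => ∫ t in a..b, f (Euc.cons t u)) u v =
      ∫ t in a..b, fderiv ℝ f (Euc.cons t u) (Euc.incl m v) := by
  rw [(hasFDerivAt_integral_cons (hf.of_le (by simp)) a b u).fderiv,
    ContinuousLinearMap.intervalIntegral_apply]
  · rfl
  · exact intervalIntegrable_cons (f := fun w => (fderiv ℝ f w).comp (Euc.incl m))
      ((hf.continuous_fderiv (by simp)).clm_comp continuous_const) u a b

theorem integral_fderiv_cons [CompleteSpace F] {f : Euc (m + 1) → F} (hf : ContDiff ℝ ∞ f) (a b : ℝ)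
    (u : Euc m) :
    ∫ t in a..b, fderiv ℝ f (Euc.cons t u) (Euc.e0 m) = f (Euc.cons b u) - f (Euc.cons a u) := by
  refine intervalIntegral.integral_eq_sub_of_hasDerivAt (f := fun t => f (Euc.cons t u))
    (fun t _ => ?_) ?_
  · exact ((hf.differentiable (by simp) _).hasFDerivAt).comp_hasDerivAt t
      (Euc.hasDerivAt_cons_left t u)
  · exact intervalIntegrable_cons (f := fun w => fderiv ℝ f w (Euc.e0 m))
      ((hf.continuous_fderiv (by simp)).clm_apply continuous_const) u a b

end ParametricIntegral

/-! ### Integration of forms along the first coordinate -/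

section FlatIntegral

variable {m l : ℕ}

/-- The contraction of a form with the first basis vector, restricted to the last coordinates. -/
def slice (m l : ℕ) :
    ((Euc (m + 1)) [⋀^Fin (l + 1)]→L[ℝ] ℂ) →L[ℝ] (Euc m) [⋀^Fin l]→L[ℝ] ℂ :=
  (ContinuousAlternatingMap.compContinuousLinearMapCLM (Euc.incl m)).comp
    ((ContinuousLinearMap.apply ℝ _ (Euc.e0 m)).comp
      (ContinuousAlternatingMap.curryLeftLI (𝕜 := ℝ) (E := Euc (m + 1)) (F := ℂ)
        (n := l)).toContinuousLinearMap)

/-- Integration of a form along the first coordinate. -/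
def flatInt (a b : ℝ) (Θ : Euc (m + 1) → (Euc (m + 1)) [⋀^Fin (l + 1)]→L[ℝ] ℂ) (u : Euc m) :
    (Euc m) [⋀^Fin l]→L[ℝ] ℂ :=
  ∫ t in a..b, slice m l (Θ (Euc.cons t u))

variable {a b : ℝ} {Θ Θ' : Euc (m + 1) → (Euc (m + 1)) [⋀^Fin (l + 1)]→L[ℝ] ℂ}

theorem flatInt_contDiff (hΘ : ContDiff ℝ ∞ Θ) : ContDiff ℝ ∞ (flatInt a b Θ) :=
  contDiff_integral_cons (f := fun w => slice m l (Θ w)) ((slice m l).contDiff.comp hΘ) a b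

theorem flatInt_apply (hΘ : Continuous Θ) (u : Euc m) (v : Fin l → Euc m) :
    flatInt a b Θ u v =
      ∫ t in a..b, Θ (Euc.cons t u) (Fin.cons (Euc.e0 m) (fun i => Euc.incl m (v i))) :=
  ((ContinuousAlternatingMap.apply ℝ (Euc m) ℂ v).intervalIntegral_comp_comm
    (intervalIntegrable_cons (f := fun w => slice m l (Θ w))
      ((slice m l).continuous.comp hΘ) u a b)).symm

theorem flatInt_add (hΘ : Continuous Θ) (hΘ' : Continuous Θ') :
    flatInt a b (Θ + Θ') = flatInt a b Θ + flatInt a b Θ' := by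
  funext u
  simp only [flatInt, Pi.add_apply, map_add]
  exact intervalIntegral.integral_add
    (intervalIntegrable_cons (f := fun w => slice m l (Θ w)) ((slice m l).continuous.comp hΘ) u a b)
    (intervalIntegrable_cons (f := fun w => slice m l (Θ' w))
      ((slice m l).continuous.comp hΘ') u a b)

theorem contDiff_apply_const (hΘ : ContDiff ℝ ∞ Θ) (v : Fin (l + 1) → Euc (m + 1)) :
    ContDiff ℝ ∞ (fun w => Θ w v) :=
  (ContinuousAlternatingMap.apply ℝ (Euc (m + 1)) ℂ v).contDiff.comp hΘ

/-- Stokes' theorem for the integration along the first coordinate. -/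
theorem extDeriv_flatInt (hΘ : ContDiff ℝ ∞ Θ) (u : Euc m) (v : Fin (l + 1) → Euc m) :
    extDeriv (flatInt a b Θ) u v + flatInt a b (extDeriv Θ) u v =
      Θ (Euc.cons b u) (fun i => Euc.incl m (v i)) -
        Θ (Euc.cons a u) (fun i => Euc.incl m (v i)) := by
  have hd : Continuous (extDeriv Θ) :=
    (ContinuousAlternatingMap.alternatizeUncurryFinCLM ℝ (Euc (m + 1)) ℂ).continuous.comp
      (hΘ.continuous_fderiv (by simp))
  have hint : ∀ (V : Fin (l + 1) → Euc (m + 1)) (e : Euc (m + 1)), IntervalIntegrable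
      (fun t => fderiv ℝ (fun w => Θ w V) (Euc.cons t u) e) MeasureTheory.volume a b := fun V e =>
    intervalIntegrable_cons (f := fun w => fderiv ℝ (fun w => Θ w V) w e)
      (((contDiff_apply_const hΘ V).continuous_fderiv (by simp)).clm_apply continuous_const) u a b
  have hz : ∀ (z : ℤ) {f : ℝ → ℂ}, IntervalIntegrable f MeasureTheory.volume a b →
      IntervalIntegrable (fun t => z • f t) MeasureTheory.volume a b := fun z f hf => by
    simpa only [zsmul_eq_mul] using hf.const_mul (z : ℂ)
  -- Differentiation under the integral: every derivative is taken in a direction `v i`, with the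
  -- first basis vector occupying the first slot.
  have h1 : extDeriv (flatInt a b Θ) u v = ∑ i : Fin (l + 1), (-1 : ℤ) ^ (i : ℕ) •
      ∫ t in a..b, fderiv ℝ (fun w => Θ w (Fin.cons (Euc.e0 m)
        (fun j => Euc.incl m (i.removeNth v j)))) (Euc.cons t u) (Euc.incl m (v i)) := by
    rw [extDeriv_apply ((flatInt_contDiff hΘ).differentiable (by simp) _)]
    refine Finset.sum_congr rfl fun i _ => ?_
    congr 1
    have e : (fun u => flatInt a b Θ u (i.removeNth v)) = fun u => ∫ t in a..b,
        Θ (Euc.cons t u) (Fin.cons (Euc.e0 m) (fun j => Euc.incl m (i.removeNth v j))) :=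
      funext fun u => flatInt_apply hΘ.continuous u _
    rw [e]
    exact fderiv_integral_cons (f := fun w => Θ w (Fin.cons (Euc.e0 m)
      (fun j => Euc.incl m (i.removeNth v j)))) (contDiff_apply_const hΘ _) a b u (v i)
  -- In the expansion of the exterior derivative on the first basis vector followed by `v`, the
  -- leading term is the derivative in the integration variable. The others are the terms of `h1`,
  -- shifted by one slot and hence with the opposite sign.
  have h2 : flatInt a b (extDeriv Θ) u v =
      (∫ t in a..b, fderiv ℝ (fun w => Θ w (fun i => Euc.incl m (v i))) (Euc.cons t u)
        (Euc.e0 m)) - ∑ i : Fin (l + 1), (-1 : ℤ) ^ (i : ℕ) •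
      ∫ t in a..b, fderiv ℝ (fun w => Θ w (Fin.cons (Euc.e0 m)
        (fun j => Euc.incl m (i.removeNth v j)))) (Euc.cons t u) (Euc.incl m (v i)) := by
    rw [flatInt_apply hd, sub_eq_add_neg, ← Finset.sum_neg_distrib]
    simp only [← neg_smul]
    simp only [← intervalIntegral_zsmul]
    rw [← intervalIntegral.integral_finsetSum, ← intervalIntegral.integral_add]
    · refine intervalIntegral.integral_congr fun t _ => ?_
      simp only [extDeriv_apply (hΘ.differentiable (by simp) _), Fin.sum_univ_succ (n := l + 1)]
      congr 1
      · simp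
      · refine Finset.sum_congr rfl fun i _ => ?_
        have e : i.succ.removeNth (Fin.cons (α := fun _ => Euc (m + 1)) (Euc.e0 m)
            fun j => Euc.incl m (v j)) =
            Fin.cons (Euc.e0 m) (fun j => Euc.incl m (i.removeNth v j)) := by
          funext j
          refine Fin.cases ?_ (fun j => ?_) j <;> simp [Fin.removeNth]
        rw [e, Fin.cons_succ, Fin.val_succ, pow_succ, mul_neg_one]
    · exact hint _ _
    · simpa only [Finset.sum_fn] using IntervalIntegrable.sum Finset.univ fun i _ => hz _ (hint _ _)
    · exact fun i _ => hz _ (hint _ _)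
  -- Only the derivative in the integration variable survives; the fundamental theorem of calculus
  -- gives the two ends.
  rw [h1, h2, add_sub_cancel, integral_fderiv_cons (contDiff_apply_const hΘ _)]

end FlatIntegral

/-! ### Evaluation of sections -/

section Sections

variable {X : Type u} [DiffeologicalSpace X] {Y : Type v} [DiffeologicalSpace Y]

/-- The value of a degree-`0` section at a point, as a homomorphism. -/
def DSec.fnHom (x : X) : DSec X 0 →+ Additive ℂˣ where
  toFun f := Additive.ofMul (DSec.fn f x)
  map_zero' := rfl
  map_add' _ _ := rfl

/-- The value of a form on tangent vectors to a plot, as a homomorphism. -/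
def DSec.formHom {l n : ℕ} (p : Plot n X) (u : Euc n) (v : Fin (l + 1) → Euc n) :
    DSec X (l + 1) →+ ℂ where
  toFun θ := DSec.form θ p u v
  map_zero' := rfl
  map_add' _ _ := rfl

theorem DSec.ext_fn {f g : DSec X 0} (h : ∀ x, DSec.fn f x = DSec.fn g x) : f = g :=
  Subtype.ext (funext h)

theorem DSec.ext_form {l : ℕ} {θ η : DSec X (l + 1)}
    (h : ∀ (n : ℕ) (p : Plot n X) (u : Euc n) (v : Fin (l + 1) → Euc n),
      DSec.form θ p u v = DSec.form η p u v) : θ = η :=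
  Subtype.ext (funext fun n => funext fun p => funext fun u =>
    ContinuousAlternatingMap.ext fun v => h n p u v)

theorem DSec.fn_contDiff (f : DSec X 0) {n : ℕ} (p : Plot n X) :
    ContDiff ℝ ∞ (fun s => (DSec.fn f (p.1 s) : ℂ)) :=
  (Additive.toMul (show Additive (smoothUnits X) from f)).2 n p

theorem DSec.form_contDiff {l : ℕ} (θ : DSec X (l + 1)) {n : ℕ} (p : Plot n X) :
    ContDiff ℝ ∞ (DSec.form θ p) := (show DForm X (l + 1) from θ).2.1 n p

theorem DSec.form_reparam {l : ℕ} (θ : DSec X (l + 1)) {n m : ℕ} (p : Plot n X)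
    (f : Euc m → Euc n) (hf : ContDiff ℝ ∞ f) (x : Euc m) :
    DSec.form θ (p.reparam f hf) x =
      (DSec.form θ p (f x)).compContinuousLinearMap (fderiv ℝ f x) :=
  (show DForm X (l + 1) from θ).2.2 n m p f hf x

@[simp] theorem DSec.fn_add (f g : DSec X 0) (x : X) :
    DSec.fn (f + g) x = DSec.fn f x * DSec.fn g x := rfl

@[simp] theorem DSec.fn_sub (f g : DSec X 0) (x : X) :
    DSec.fn (f - g) x = DSec.fn f x / DSec.fn g x := map_sub (DSec.fnHom x) f g

@[simp] theorem DSec.fn_zsmul (z : ℤ) (f : DSec X 0) (x : X) :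
    DSec.fn (z • f) x = DSec.fn f x ^ z := map_zsmul (DSec.fnHom x) z f

theorem DSec.fn_sum {ι : Type*} (s : Finset ι) (f : ι → DSec X 0) (x : X) :
    DSec.fn (∑ i ∈ s, f i) x = ∏ i ∈ s, DSec.fn (f i) x :=
  map_sum (DSec.fnHom x) f s

@[simp] theorem DSec.form_add {l n : ℕ} (θ η : DSec X (l + 1)) (p : Plot n X) (u : Euc n)
    (v : Fin (l + 1) → Euc n) :
    DSec.form (θ + η) p u v = DSec.form θ p u v + DSec.form η p u v := rfl

@[simp] theorem DSec.form_sub {l n : ℕ} (θ η : DSec X (l + 1)) (p : Plot n X) (u : Euc n)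
    (v : Fin (l + 1) → Euc n) :
    DSec.form (θ - η) p u v = DSec.form θ p u v - DSec.form η p u v :=
  map_sub (DSec.formHom p u v) θ η

@[simp] theorem DSec.form_zsmul {l n : ℕ} (z : ℤ) (θ : DSec X (l + 1)) (p : Plot n X) (u : Euc n)
    (v : Fin (l + 1) → Euc n) :
    DSec.form (z • θ) p u v = z • DSec.form θ p u v :=
  map_zsmul (DSec.formHom p u v) z θ

theorem DSec.form_sum {l n : ℕ} {ι : Type*} (s : Finset ι) (θ : ι → DSec X (l + 1))
    (p : Plot n X) (u : Euc n) (v : Fin (l + 1) → Euc n) :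
    DSec.form (∑ i ∈ s, θ i) p u v = ∑ i ∈ s, DSec.form (θ i) p u v :=
  map_sum (DSec.formHom p u v) θ s

theorem DSec.pull_congr {φ ψ : X → Y} (h : φ = ψ) (hφ : DSmooth φ) (hψ : DSmooth ψ) (l : ℕ)
    (s : DSec Y l) : DSec.pull φ hφ l s = DSec.pull ψ hψ l s := by
  subst h; rfl

theorem DSec.pull_id {φ : X → X} (h : φ = id) (hφ : DSmooth φ) : ∀ (l : ℕ) (s : DSec X l),
    DSec.pull φ hφ l s = s := by
  subst h
  intro l s
  cases l <;> rfl

/-- Two plots that agree near a point give the same value of a form there. -/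
theorem DSec.form_congr_of_eventuallyEq {l n : ℕ} (θ : DSec X (l + 1)) {p q : Plot n X}
    {x : Euc n} (h : p.1 =ᶠ[𝓝 x] q.1) : DSec.form θ p x = DSec.form θ q x := by
  obtain ⟨r, hr, hb⟩ := Metric.eventually_nhds_iff_ball.1 h
  -- Plots are defined on all of Euclidean space, so locality needs a smooth map `f` into the ball
  -- where `p` and `q` agree that is the identity near `x`. Then `p ∘ f = q ∘ f`, and pulling back
  -- along `f` does nothing at `x`.
  let β : ContDiffBump x := ⟨r / 4, r / 2, by linarith, by linarith⟩
  let f : Euc n → Euc n := fun y => x + β y • (y - x)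
  have hf : ContDiff ℝ ∞ f := contDiff_const.add (β.contDiff.smul (contDiff_id.sub contDiff_const))
  have hmem : ∀ y, f y ∈ Metric.ball x r := fun y => by
    rw [Metric.mem_ball, dist_eq_norm, add_sub_cancel_left, norm_smul,
      Real.norm_of_nonneg β.nonneg]
    by_cases hy : β.rOut ≤ dist y x
    · rw [β.zero_of_le_dist hy]; simpa using hr
    · rw [not_le, dist_eq_norm] at hy
      calc β y * ‖y - x‖ ≤ 1 * ‖y - x‖ := mul_le_mul_of_nonneg_right β.le_one (norm_nonneg _)
        _ < r / 2 := by rw [one_mul]; exact hy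
        _ < r := by linarith
  have hx : f x = x := by simp [f]
  have hid : fderiv ℝ f x = ContinuousLinearMap.id ℝ (Euc n) := by
    have e : f =ᶠ[𝓝 x] id := by
      filter_upwards [β.eventuallyEq_one] with y hy
      simp only [f, hy, Pi.one_apply, one_smul, add_sub_cancel, id]
    rw [e.fderiv_eq, fderiv_id]
  have e : p.reparam f hf = q.reparam f hf := Subtype.ext (funext fun y => hb _ (hmem y))
  have h1 := DSec.form_reparam θ p f hf x
  have h2 := DSec.form_reparam θ q f hf x
  rw [hx, hid] at h1 h2
  rw [e, h2] at h1
  ext v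
  simpa using congrArg (fun ω' => ω' v) h1.symm

end Sections

/-! ### Fibre integration -/

/-- Smooth families of paths in `Y`, parametrised by `X`. -/
structure PathFamily (X : Type u) (Y : Type v) [DiffeologicalSpace X] [DiffeologicalSpace Y] where
  toFun : ℝ → X → Y
  smooth : ∀ (m : ℕ) (P : Plot m X), IsPlot fun w : Euc (m + 1) => toFun (w 0) (P.1 (Euc.tail w))

namespace PathFamily

variable {X : Type u} [DiffeologicalSpace X] {Y : Type v} [DiffeologicalSpace Y]
  (φ : PathFamily X Y)

/-- The family of paths over a plot. -/
def cyl {m : ℕ} (P : Plot m X) : Plot (m + 1) Y :=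
  ⟨fun w => φ.toFun (w 0) (P.1 (Euc.tail w)), φ.smooth m P⟩

theorem at_smooth (t : ℝ) : DSmooth (φ.toFun t) := fun n p hp => by
  have h := isPlot_reparam (φ.smooth n ⟨p, hp⟩)
    (f := fun u => Euc.cons t u) (Euc.cons_comp_contDiff contDiff_const contDiff_id)
  simpa [Function.comp_def] using h

theorem cyl_reparam {m k : ℕ} (P : Plot m X) (f : Euc k → Euc m) (hf : ContDiff ℝ ∞ f) :
    φ.cyl (P.reparam f hf) = (φ.cyl P).reparam (fun w => Euc.cons (w 0) (f (Euc.tail w)))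
      (Euc.cons_comp_contDiff (by fun_prop) (hf.comp Euc.tail_contDiff)) :=
  Subtype.ext (funext fun w => by simp [cyl, Plot.reparam])

variable (a b : ℝ)

/-- A reparametrisation `f` of the base lifts to the cylinder as the identity times `f`. The
derivative of this lift fixes the first basis vector and acts as that of `f` on the remaining
directions, so contracting and integrating commute with the pullback. -/
theorem flatInt_cyl_reparam {l m k : ℕ} (θ : DSec Y (l + 1)) (P : Plot m X) (f : Euc k → Euc m)
    (hf : ContDiff ℝ ∞ f) (u : Euc k) :
    flatInt a b (DSec.form θ (φ.cyl (P.reparam f hf))) u =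
      (flatInt a b (DSec.form θ (φ.cyl P)) (f u)).compContinuousLinearMap (fderiv ℝ f u) := by
  ext v
  rw [ContinuousAlternatingMap.compContinuousLinearMap_apply,
    flatInt_apply (DSec.form_contDiff _ _).continuous,
    flatInt_apply (DSec.form_contDiff _ _).continuous]
  refine intervalIntegral.integral_congr fun t _ => ?_
  have hg : ContDiff ℝ ∞ (fun w : Euc (k + 1) => Euc.cons (w 0) (f (Euc.tail w))) :=
    Euc.cons_comp_contDiff (by fun_prop) (hf.comp Euc.tail_contDiff)
  have hgd := (hg.differentiable (by simp) (Euc.cons t u)).hasFDerivAt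
  have h1 : fderiv ℝ (fun w : Euc (k + 1) => Euc.cons (w 0) (f (Euc.tail w))) (Euc.cons t u)
      (Euc.e0 k) = Euc.e0 m := by
    have := hgd.comp_hasDerivAt t (Euc.hasDerivAt_cons_left t u)
    simp only [Function.comp_def, Euc.cons_zero, Euc.tail_cons] at this
    exact this.unique (Euc.hasDerivAt_cons_left t (f u))
  have h2 : ∀ x, fderiv ℝ (fun w : Euc (k + 1) => Euc.cons (w 0) (f (Euc.tail w))) (Euc.cons t u)
      (Euc.incl k x) = Euc.incl m (fderiv ℝ f u x) := fun x => by
    have := hgd.comp u (Euc.hasFDerivAt_cons_right t u)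
    simp only [Function.comp_def, Euc.cons_zero, Euc.tail_cons] at this
    exact DFunLike.congr_fun (this.unique ((Euc.hasFDerivAt_cons_right t (f u)).comp u
      (hf.differentiable (by simp) u).hasFDerivAt)) x
  change DSec.form θ (φ.cyl (P.reparam f hf)) _ _ = _
  rw [φ.cyl_reparam, DSec.form_reparam, ContinuousAlternatingMap.compContinuousLinearMap_apply]
  simp only [Euc.cons_zero, Euc.tail_cons]
  congr 1
  funext i
  refine Fin.cases ?_ (fun i => ?_) i
  · exact h1
  · exact h2 _

/-- The constant plot at a point. -/
def constPlot (x : X) : Plot 0 X := ⟨fun _ => x, isPlot_const⟩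

/-- A point of a plot is its reparametrisation along a constant map from `Euc 0`. Hence the integral
of a 1-form depends only on the point of `X`, which makes it a function on `X` that can be computed,
and seen to be smooth, on any plot. -/
theorem flatInt_cyl_const {m : ℕ} (θ : DSec Y 1) (P : Plot m X) (u : Euc m) (v : Fin 0 → Euc m)
    (v' : Fin 0 → Euc 0) :
    flatInt a b (DSec.form θ (φ.cyl (constPlot (P.1 u)))) 0 v' =
      flatInt a b (DSec.form θ (φ.cyl P)) u v := by
  have h := φ.flatInt_cyl_reparam a b θ P (fun _ : Euc 0 => u) contDiff_const 0
  have e : P.reparam (fun _ : Euc 0 => u) contDiff_const = constPlot (P.1 u) := rfl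
  rw [e] at h
  rw [h, ContinuousAlternatingMap.compContinuousLinearMap_apply]
  exact congrArg _ (Subsingleton.elim _ _)

/-- The exponential of the integral of a `1`-form along the paths of a family. -/
def fiberExp (θ : DSec Y 1) : DSec X 0 :=
  show Additive (smoothUnits X) from Additive.ofMul
    ⟨fun x => Units.mk0 (Complex.exp (flatInt a b (DSec.form θ (φ.cyl (constPlot x))) 0 ![]))
      (Complex.exp_ne_zero _), fun n p => by
      have h : ContDiff ℝ ∞ (fun u => flatInt a b (DSec.form θ (φ.cyl p)) u ![]) :=
        (ContinuousAlternatingMap.apply ℝ (Euc n) ℂ ![]).contDiff.comp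
          (flatInt_contDiff (DSec.form_contDiff _ _))
      simp only [Units.val_mk0, φ.flatInt_cyl_const a b θ p _ ![] ![]]
      exact h.cexp⟩

theorem fn_fiberExp (θ : DSec Y 1) (x : X) :
    (DSec.fn (φ.fiberExp a b θ) x : ℂ) =
      Complex.exp (flatInt a b (DSec.form θ (φ.cyl (constPlot x))) 0 ![]) := rfl

/-- The integral of a form of degree at least `2` along the paths of a family. -/
def fiberForm {l : ℕ} (θ : DSec Y (l + 2)) : DSec X (l + 1) :=
  show DForm X (l + 1) from
    ⟨fun _ P => flatInt a b (DSec.form θ (φ.cyl P)),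
      fun _ P => flatInt_contDiff (DSec.form_contDiff _ _),
      fun n m p f hf x => φ.flatInt_cyl_reparam a b θ p f hf x⟩

theorem form_fiberForm {l : ℕ} (θ : DSec Y (l + 2)) {m : ℕ} (P : Plot m X) :
    DSec.form (φ.fiberForm a b θ) P = flatInt a b (DSec.form θ (φ.cyl P)) := rfl

theorem flatInt_form_add {l m : ℕ} (θ η : DSec Y (l + 1)) (P : Plot (m + 1) Y) :
    flatInt a b (DSec.form (θ + η) P) =
      flatInt a b (DSec.form θ P) + flatInt a b (DSec.form η P) :=
  flatInt_add (DSec.form_contDiff _ _).continuous (DSec.form_contDiff _ _).continuous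

/-- Integration of forms on `Y` along the paths of a family parametrised by `X`; a `1`-form is sent
to the exponential of its integral. -/
def fiberInt : ∀ l : ℕ, DSec Y (l + 1) →+ DSec X l
  | 0 => AddMonoidHom.mk' (φ.fiberExp a b) fun θ η => DSec.ext_fn fun x => Units.ext <| by
      rw [DSec.fn_add, Units.val_mul, fn_fiberExp, fn_fiberExp, fn_fiberExp, flatInt_form_add,
        ← Complex.exp_add]
      rfl
  | l + 1 => AddMonoidHom.mk' (φ.fiberForm a b) fun θ η => DSec.ext_form fun n p u v => by
      rw [DSec.form_add, form_fiberForm, form_fiberForm, form_fiberForm, flatInt_form_add]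
      rfl

theorem fn_fiberInt (θ : DSec Y 1) {m : ℕ} (P : Plot m X) (u : Euc m) (v : Fin 0 → Euc m) :
    (DSec.fn (φ.fiberInt a b 0 θ) (P.1 u) : ℂ) =
      Complex.exp (flatInt a b (DSec.form θ (φ.cyl P)) u v) :=
  congrArg Complex.exp (φ.flatInt_cyl_const a b θ P u v ![])

theorem form_fiberInt {l : ℕ} (θ : DSec Y (l + 2)) {m : ℕ} (P : Plot m X) :
    DSec.form (φ.fiberInt a b (l + 1) θ) P = flatInt a b (DSec.form θ (φ.cyl P)) := rfl

theorem form_d_zero (f : DSec X 0) {m : ℕ} (P : Plot m X) (u : Euc m) (v : Fin 1 → Euc m) :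
    DSec.form (DSec.d 0 f) P u v =
      (DSec.fn f (P.1 u) : ℂ)⁻¹ * fderiv ℝ (fun s => (DSec.fn f (P.1 s) : ℂ)) u (v 0) := rfl

theorem form_d_succ {l : ℕ} (θ : DSec X (l + 1)) {m : ℕ} (P : Plot m X) :
    DSec.form (DSec.d (l + 1) θ) P = extDeriv (DSec.form θ P) := rfl

/-- The restriction of a form to the end of the paths over a plot. -/
theorem form_cyl_incl {l m : ℕ} (θ : DSec Y (l + 1)) (P : Plot m X) (t : ℝ) (u : Euc m)
    (v : Fin (l + 1) → Euc m) :
    DSec.form θ (φ.cyl P) (Euc.cons t u) (fun i => Euc.incl m (v i)) =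
      DSec.form (DSec.pull (φ.toFun t) (φ.at_smooth t) (l + 1) θ) P u v := by
  have hc : ContDiff ℝ ∞ (fun u : Euc m => Euc.cons t u) :=
    Euc.cons_comp_contDiff contDiff_const contDiff_id
  have e : P.map (φ.toFun t) (φ.at_smooth t) = (φ.cyl P).reparam (fun u => Euc.cons t u) hc :=
    Subtype.ext (funext fun w => by simp [cyl, Plot.reparam, Plot.map])
  change _ = DSec.form θ (P.map (φ.toFun t) (φ.at_smooth t)) u v
  rw [e, DSec.form_reparam, (Euc.hasFDerivAt_cons_right t u).fderiv]
  rfl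

/-- Stokes' theorem for fibre integration. -/
theorem d_fiberInt_add (l : ℕ) (θ : DSec Y (l + 1)) :
    DSec.d l (φ.fiberInt a b l θ) + φ.fiberInt a b (l + 1) (DSec.d (l + 1) θ) =
      DSec.pull (φ.toFun b) (φ.at_smooth b) (l + 1) θ -
        DSec.pull (φ.toFun a) (φ.at_smooth a) (l + 1) θ := by
  refine DSec.ext_form fun m P u v => ?_
  have key := extDeriv_flatInt (a := a) (b := b) (DSec.form_contDiff θ (φ.cyl P)) u v
  rw [φ.form_cyl_incl, φ.form_cyl_incl, ← form_d_succ] at key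
  rw [DSec.form_add, DSec.form_sub, ← key, form_fiberInt]
  congr 1
  -- For `l = 0` the left-hand side is `d log` of an exponential, in which the exponential cancels
  -- and the derivative of the exponent remains.
  rcases l with _ | l
  · have hsm := flatInt_contDiff (a := a) (b := b) (DSec.form_contDiff θ (φ.cyl P))
    have e : (fun s => (DSec.fn (φ.fiberInt a b 0 θ) (P.1 s) : ℂ)) =
        fun s => Complex.exp (flatInt a b (DSec.form θ (φ.cyl P)) s ![]) :=
      funext fun s => φ.fn_fiberInt a b θ P s ![]
    have hd : DifferentiableAt ℝ (fun s => flatInt a b (DSec.form θ (φ.cyl P)) s ![]) u :=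
      ((ContinuousAlternatingMap.apply ℝ (Euc m) ℂ ![]).contDiff.comp hsm).differentiable
        (by simp) u
    rw [form_d_zero, e, φ.fn_fiberInt a b θ P u ![], hd.hasFDerivAt.cexp.fderiv,
      extDeriv_apply (hsm.differentiable (by simp) _)]
    simp only [smul_apply, smul_eq_mul, Nat.reduceAdd, Fin.sum_univ_one]
    rw [inv_mul_cancel_left₀ (Complex.exp_ne_zero _), Subsingleton.elim (Fin.removeNth 0 v) ![]]
    simp
  · rfl

/-- The fundamental theorem of calculus for `d log`. -/
theorem fiberInt_dlog (f : DSec Y 0) :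
    φ.fiberInt a b 0 (DSec.d 0 f) =
      DSec.pull (φ.toFun b) (φ.at_smooth b) 0 f - DSec.pull (φ.toFun a) (φ.at_smooth a) 0 f := by
  refine DSec.ext_fn fun x => Units.ext ?_
  let g : ℝ → ℂ := fun t => (DSec.fn f (φ.toFun t x) : ℂ)
  have hg0 : ∀ t, g t ≠ 0 := fun t => Units.ne_zero _
  have hF := DSec.fn_contDiff f (φ.cyl (constPlot x))
  have hg' : ∀ t, HasDerivAt g (fderiv ℝ
      (fun s => (DSec.fn f ((φ.cyl (constPlot x)).1 s) : ℂ)) (Euc.cons t 0) (Euc.e0 0)) t :=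
    fun t => (hF.differentiable (by simp) _).hasFDerivAt.comp_hasDerivAt t
      (Euc.hasDerivAt_cons_left t 0)
  have hgd : Continuous fun t => fderiv ℝ
      (fun s => (DSec.fn f ((φ.cyl (constPlot x)).1 s) : ℂ)) (Euc.cons t 0) (Euc.e0 0) :=
    ((hF.continuous_fderiv (by simp)).comp (Euc.continuous_cons_left 0)).clm_apply
      continuous_const
  have hgc : Continuous g := continuous_iff_continuousAt.2 fun t => (hg' t).continuousAt
  have e1 : flatInt a b (DSec.form (DSec.d 0 f) (φ.cyl (constPlot x))) 0 ![] =
      ∫ t in a..b, (g t)⁻¹ * deriv g t := by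
    rw [flatInt_apply (DSec.form_contDiff _ _).continuous]
    refine intervalIntegral.integral_congr fun t _ => ?_
    rw [(hg' t).deriv]
    rfl
  have hcont : Continuous fun t => (g t)⁻¹ * deriv g t := by
    rw [funext fun t => (hg' t).deriv]
    exact (hgc.inv₀ hg0).mul hgd
  -- No logarithm of `g` is chosen: `g` times the exponential of minus the integral of its
  -- logarithmic derivative has derivative zero, so its values at `a` and `b` agree.
  have hderiv : ∀ s, HasDerivAt (fun s => g s * Complex.exp (-∫ t in a..s, (g t)⁻¹ * deriv g t))
      0 s := fun s => by
    have h1 := (hg' s).differentiableAt.hasDerivAt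
    have h2 := (intervalIntegral.integral_hasDerivAt_right (hcont.intervalIntegrable a s)
      (hcont.stronglyMeasurableAtFilter _ _) hcont.continuousAt).neg.cexp
    have h3 : HasDerivAt (fun s => g s * Complex.exp (-∫ t in a..s, (g t)⁻¹ * deriv g t))
        (deriv g s * Complex.exp (-∫ t in a..s, (g t)⁻¹ * deriv g t) +
          g s * (Complex.exp (-∫ t in a..s, (g t)⁻¹ * deriv g t) * -((g s)⁻¹ * deriv g s))) s :=
      h1.mul h2
    have h4 := hg0 s
    have e : deriv g s * Complex.exp (-∫ t in a..s, (g t)⁻¹ * deriv g t) +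
        g s * (Complex.exp (-∫ t in a..s, (g t)⁻¹ * deriv g t) * -((g s)⁻¹ * deriv g s)) = 0 := by
      field_simp
      ring
    rwa [e] at h3
  have hconst := is_const_of_deriv_eq_zero (fun s => (hderiv s).differentiableAt)
    (fun s => (hderiv s).deriv) b a
  simp only [intervalIntegral.integral_same, neg_zero, Complex.exp_zero, mul_one] at hconst
  change Complex.exp (flatInt a b (DSec.form (DSec.d 0 f) (φ.cyl (constPlot x))) 0 ![]) = _
  rw [e1, DSec.fn_sub, Units.val_div_eq_div_val]
  change _ = g b / g a
  rw [← hconst, Complex.exp_neg]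
  have := hg0 b
  have := Complex.exp_ne_zero (∫ t in a..b, (g t)⁻¹ * deriv g t)
  field_simp

/-- The hypothesis says that the cylinder over a plot pushed along `ψ` is the cylinder of `φ'`
pushed along `η`. With `ψ` and `η` both faces this gives compatibility with δ; with maps induced by
functors it gives naturality. -/
theorem pull_fiberInt {X' : Type w} [DiffeologicalSpace X'] {Y' : Type*} [DiffeologicalSpace Y']
    (φ' : PathFamily X' Y') (ψ : X' → X) (hψ : DSmooth ψ) (η : Y' → Y) (hη : DSmooth η)
    (h : ∀ t x, φ.toFun t (ψ x) = η (φ'.toFun t x)) : ∀ (l : ℕ) (θ : DSec Y (l + 1)),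
    DSec.pull ψ hψ l (φ.fiberInt a b l θ) = φ'.fiberInt a b l (DSec.pull η hη (l + 1) θ) := by
  have e : ∀ (m : ℕ) (P : Plot m X'), φ.cyl (P.map ψ hψ) = (φ'.cyl P).map η hη := fun m P =>
    Subtype.ext (funext fun w => h _ _)
  rintro (_ | l) θ
  · refine DSec.ext_fn fun x => Units.ext ?_
    change Complex.exp (flatInt a b (DSec.form θ (φ.cyl ((constPlot x).map ψ hψ))) 0 ![]) = _
    rw [e]
    rfl
  · refine DSec.ext_form fun m P u v => ?_
    change flatInt a b (DSec.form θ (φ.cyl (P.map ψ hψ))) u v = _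
    rw [e]
    rfl

end PathFamily

/-! ### The prism operators -/

/-- The alternating sum of the faces of the prisms over a simplex, minus the prisms over its faces,
is the difference of the two ends. -/
theorem prism_sum_nat {A : Type*} [AddCommGroup A] (M : ℕ) (t s : ℕ → ℕ → A)
    (h₁ : ∀ m i, m < M → i ≤ m → t (m + 1) i = s i m)
    (h₂ : ∀ m i, m < i → i ≤ M → t m (i + 1) = s i m)
    (h₃ : ∀ m, m < M → t m (m + 1) = t (m + 1) (m + 1)) :
    ∑ m ∈ Finset.range (M + 1), ∑ i ∈ Finset.range (M + 2), (-1 : ℤ) ^ (m + i) • t m i +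
      ∑ m ∈ Finset.range M, ∑ i ∈ Finset.range (M + 1), (-1 : ℤ) ^ (m + i) • s i m =
      t 0 0 - t M (M + 1) := by
  -- Read `t m i` as the `i`-th face of the `m`-th prism and `s i m` as the `m`-th prism over the
  -- `i`-th face. Apart from the two inner faces `m` and `m + 1`, the faces of the `m`-th prism
  -- split into those below `m`, collected in `a`, and those above `m + 1`, collected in `b`.
  let a : ℕ → A := fun m => ∑ i ∈ Finset.range m, (-1 : ℤ) ^ (m + i) • t m i
  let b : ℕ → A := fun m => ∑ i ∈ Finset.Ico (m + 1) (M + 1), (-1 : ℤ) ^ (m + (i + 1)) • t m (i + 1)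
  have row : ∀ m ∈ Finset.range (M + 1),
      ∑ i ∈ Finset.range (M + 2), (-1 : ℤ) ^ (m + i) • t m i =
        a m + (t m m - t m (m + 1)) + b m := fun m hm => by
    have hm' : m < M + 1 := Finset.mem_range.1 hm
    rw [Finset.range_eq_Ico, ← Finset.sum_Ico_consecutive _ (Nat.zero_le m) (by omega : m ≤ M + 2),
      Finset.sum_eq_sum_Ico_succ_bot (by omega : m < M + 2),
      Finset.sum_eq_sum_Ico_succ_bot (by omega : m + 1 < M + 2),
      ← Finset.sum_Ico_add' _ (m + 1) (M + 1) 1, ← Finset.range_eq_Ico]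
    have e1 : (-1 : ℤ) ^ (m + m) = 1 := Even.neg_one_pow ⟨m, rfl⟩
    have e2 : (-1 : ℤ) ^ (m + (m + 1)) = -1 := by rw [← add_assoc, pow_succ, e1, one_mul]
    rw [e1, e2, one_smul, neg_one_zsmul]
    simp only [a, b]
    abel
  -- By `h₁` and `h₂` the prisms over faces reproduce the outer faces with the opposite sign, those
  -- below coming from the next prism. Everything outer cancels, since `a 0` and `b M` are empty
  -- sums.
  have col : ∀ m ∈ Finset.range M,
      ∑ i ∈ Finset.range (M + 1), (-1 : ℤ) ^ (m + i) • s i m = -a (m + 1) - b m := fun m hm => by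
    have hm' : m < M := Finset.mem_range.1 hm
    rw [Finset.range_eq_Ico, ← Finset.sum_Ico_consecutive _ (Nat.zero_le (m + 1))
      (by omega : m + 1 ≤ M + 1), sub_eq_add_neg, ← Finset.range_eq_Ico]
    simp only [a, b, ← Finset.sum_neg_distrib]
    congr 1
    · refine Finset.sum_congr rfl fun i hi => ?_
      rw [h₁ m i hm' (Nat.lt_succ_iff.1 (Finset.mem_range.1 hi)), ← neg_smul]
      congr 1
      ring
    · refine Finset.sum_congr rfl fun i hi => ?_
      rw [Finset.mem_Ico] at hi
      rw [h₂ m i hi.1 (by omega), ← neg_smul]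
      congr 1
      ring
  -- By `h₃` consecutive prisms share an inner face, so the inner faces telescope.
  have tel : ∑ m ∈ Finset.range M, (t m m - t m (m + 1)) = t 0 0 - t M M := by
    rw [← Finset.sum_range_sub' (fun m => t m m)]
    exact Finset.sum_congr rfl fun m hm => by rw [h₃ m (Finset.mem_range.1 hm)]
  rw [Finset.sum_congr rfl row, Finset.sum_congr rfl col, Finset.sum_add_distrib,
    Finset.sum_add_distrib, Finset.sum_sub_distrib (fun m => -a (m + 1)), Finset.sum_neg_distrib,
    Finset.sum_range_succ' a, Finset.sum_range_succ b, Finset.sum_range_succ (fun m => t m m - t m (m + 1)),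
    tel]
  simp only [a, b, Finset.range_zero, Finset.sum_empty, Finset.Ico_self]
  abel

theorem prism_sum_fin {A : Type*} [AddCommGroup A] (M : ℕ) (t : Fin (M + 1) → Fin (M + 2) → A)
    (s : Fin (M + 1) → Fin M → A)
    (h₁ : ∀ (m : Fin M) (i : Fin (M + 1)), i ≤ m.castSucc → t m.succ i.castSucc = s i m)
    (h₂ : ∀ (m : Fin M) (i : Fin (M + 1)), m.castSucc < i → t m.castSucc i.succ = s i m)
    (h₃ : ∀ m : Fin M, t m.castSucc m.succ.castSucc = t m.succ m.succ.castSucc) :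
    ∑ m : Fin (M + 1), ∑ i : Fin (M + 2), (-1 : ℤ) ^ ((m : ℕ) + i) • t m i +
      ∑ m : Fin M, ∑ i : Fin (M + 1), (-1 : ℤ) ^ ((m : ℕ) + i) • s i m =
      t 0 0 - t (Fin.last M) (Fin.last (M + 1)) := by
  -- Extending by zero allows the index shifts to be made in `ℕ`; no value outside the ranges enters
  -- the sums.
  let t' : ℕ → ℕ → A := fun m i => if h : m < M + 1 ∧ i < M + 2 then t ⟨m, h.1⟩ ⟨i, h.2⟩ else 0
  let s' : ℕ → ℕ → A := fun i m => if h : i < M + 1 ∧ m < M then s ⟨i, h.1⟩ ⟨m, h.2⟩ else 0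
  have ht : ∀ m i, t' (m : Fin (M + 1)) (i : Fin (M + 2)) = t m i := fun m i =>
    dif_pos (⟨m.2, i.2⟩ : (m : ℕ) < M + 1 ∧ (i : ℕ) < M + 2)
  have hs : ∀ i m, s' (i : Fin (M + 1)) (m : Fin M) = s i m := fun i m =>
    dif_pos (⟨i.2, m.2⟩ : (i : ℕ) < M + 1 ∧ (m : ℕ) < M)
  have key := prism_sum_nat M t' s'
    (fun m i hm hi => by
      have := h₁ ⟨m, hm⟩ ⟨i, by omega⟩ hi
      rwa [← ht, ← hs] at this)
    (fun m i hm hi => by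
      have := h₂ ⟨m, by omega⟩ ⟨i, by omega⟩ hm
      rwa [← ht, ← hs] at this)
    (fun m hm => by
      have := h₃ ⟨m, hm⟩
      rwa [← ht, ← ht] at this)
  simp only [Finset.sum_range, ht, hs] at key
  rw [key]
  exact congrArg₂ _ (ht 0 0) (ht (Fin.last M) (Fin.last (M + 1)))

section Prism

variable {K : DGroupoid.{v}} {G : DGroupoid.{u}}

/-- The string with vertices among the values of a string of natural transformations at the two ends
of an arrow of `K`. -/
def Nerve.evalEdge {q k : ℕ} (g : K.Arr) (f : Fin (k + 1) → Fin (q + 1)) (b : Fin (k + 1) → Bool)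
    (Λ : Nerve (mappingGroupoid K G) q) : Nerve G k :=
  Λ.eval f (Nerve.edge g b)

theorem Nerve.evalEdge_smooth {q k : ℕ} (g : K.Arr) (f : Fin (k + 1) → Fin (q + 1))
    (b : Fin (k + 1) → Bool) : DSmooth (Nerve.evalEdge (G := G) g f b) :=
  fun _ _ hp => Nerve.eval_plot hp _ isPlot_const

/-- Evaluation of a string of natural transformations at an object. -/
def Nerve.evalAt {q : ℕ} (x : K.Obj) (Λ : Nerve (mappingGroupoid K G) q) : Nerve G q :=
  Λ.eval id (Nerve.const x q)

theorem Nerve.evalAt_smooth {q : ℕ} (x : K.Obj) :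
    DSmooth (Nerve.evalAt (G := G) (q := q) x) :=
  fun _ _ hp => Nerve.eval_plot hp _ isPlot_const

/-- The pullback of sections along `Nerve.evalEdge`. -/
def edgePull {q k : ℕ} (g : K.Arr) (l : ℕ) (s : DSec (Nerve G k) l)
    (f : Fin (k + 1) → Fin (q + 1)) (b : Fin (k + 1) → Bool) :
    DSec (Nerve (mappingGroupoid K G) q) l :=
  DSec.pull (Nerve.evalEdge g f b) (Nerve.evalEdge_smooth g f b) l s

/-- The map of the vertices of the `m`-th prism to those of the simplex. -/
abbrev prismBit {q : ℕ} (m : Fin (q + 1)) (b : Fin (q + 2)) : Bool := decide (m.castSucc < b)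

variable (G) in
/-- The prism operator of an arrow. -/
def prismOp (g : K.Arr) (q l : ℕ) :
    DSec (Nerve G (q + 1)) l →+ DSec (Nerve (mappingGroupoid K G) q) l :=
  ∑ m : Fin (q + 1), ((-1 : ℤ) ^ (m : ℕ)) •
    DSec.pull (Nerve.evalEdge g m.predAbove (prismBit m)) (Nerve.evalEdge_smooth _ _ _) l

theorem prismOp_apply (g : K.Arr) (q l : ℕ) (s : DSec (Nerve G (q + 1)) l) :
    prismOp G g q l s = ∑ m : Fin (q + 1), ((-1 : ℤ) ^ (m : ℕ)) •
      edgePull g l s m.predAbove (prismBit m) := by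
  simp only [prismOp, AddMonoidHom.finsetSum_apply, AddMonoidHom.smul_apply]
  rfl

theorem cechDelta_apply (G : DGroupoid.{u}) (k l : ℕ) (s : DSec (Nerve G k) l) :
    cechDelta G k l s = ∑ i : Fin (k + 2), ((-1 : ℤ) ^ (i : ℕ)) •
      DSec.pull (Nerve.face (G := G) i) (Nerve.reindex_smooth _) l s := by
  simp only [cechDelta, AddMonoidHom.finsetSum_apply, AddMonoidHom.smul_apply]

theorem edgePull_face {q k : ℕ} (g : K.Arr) (l : ℕ) (s : DSec (Nerve G k) l) (i : Fin (k + 2))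
    (f : Fin (k + 2) → Fin (q + 1)) (b : Fin (k + 2) → Bool) :
    edgePull g l (DSec.pull (Nerve.face (G := G) i) (Nerve.reindex_smooth _) l s) f b =
      edgePull g l s (f ∘ i.succAbove) (b ∘ i.succAbove) :=
  DSec.pull_pull _ _ _ _ _ _

theorem pull_face_edgePull {q k : ℕ} (g : K.Arr) (l : ℕ) (s : DSec (Nerve G k) l)
    (i : Fin (q + 2)) (f : Fin (k + 1) → Fin (q + 1)) (b : Fin (k + 1) → Bool) :
    DSec.pull (Nerve.face (G := mappingGroupoid K G) i) (Nerve.reindex_smooth _) l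
      (edgePull g l s f b) = edgePull g l s (i.succAbove ∘ f) b :=
  DSec.pull_pull _ _ _ _ _ _

/-- The pullback of sections along the evaluation at an object. -/
def evalPull (q l : ℕ) (s : DSec (Nerve G q) l) (x : K.Obj) :
    DSec (Nerve (mappingGroupoid K G) q) l :=
  DSec.pull (Nerve.evalAt x) (Nerve.evalAt_smooth x) l s

theorem edgePull_true {q : ℕ} (g : K.Arr) (l : ℕ) (s : DSec (Nerve G q) l) :
    edgePull g l s id (fun _ => true) = evalPull q l s (K.data.tgt g) := rfl

theorem edgePull_false {q : ℕ} (g : K.Arr) (l : ℕ) (s : DSec (Nerve G q) l) :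
    edgePull g l s id (fun _ => false) = evalPull q l s (K.data.src g) := rfl

theorem prismOp_cechDelta_apply (g : K.Arr) (q l : ℕ) (s : DSec (Nerve G q) l) :
    prismOp G g q l (cechDelta G q l s) = ∑ m : Fin (q + 1), ∑ i : Fin (q + 2),
      (-1 : ℤ) ^ ((m : ℕ) + i) •
        edgePull g l s (m.predAbove ∘ i.succAbove) (prismBit m ∘ i.succAbove) := by
  rw [prismOp_apply]
  refine Finset.sum_congr rfl fun m _ => ?_
  rw [cechDelta_apply]
  simp only [edgePull, map_sum, map_zsmul, Finset.smul_sum, smul_smul, ← pow_add]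
  exact Finset.sum_congr rfl fun i _ => congrArg _ (edgePull_face g l s i _ _)

theorem cechDelta_prismOp_apply (g : K.Arr) (q l : ℕ) (s : DSec (Nerve G (q + 1)) l) :
    cechDelta (mappingGroupoid K G) q l (prismOp G g q l s) = ∑ m : Fin (q + 1),
      ∑ i : Fin (q + 2), (-1 : ℤ) ^ ((m : ℕ) + i) •
        edgePull g l s (i.succAbove ∘ m.predAbove) (prismBit m) := by
  rw [prismOp_apply, cechDelta_apply, Finset.sum_comm]
  refine Finset.sum_congr rfl fun i _ => ?_
  simp only [map_sum, map_zsmul, Finset.smul_sum, smul_smul, ← pow_add]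
  exact Finset.sum_congr rfl fun m _ => by
    rw [add_comm (m : ℕ)]
    exact congrArg _ (pull_face_edgePull g l s i _ _)

theorem val_predAbove {M : ℕ} (m : Fin M) (x : Fin (M + 1)) :
    (m.predAbove x : ℕ) = if (m : ℕ) < x then (x : ℕ) - 1 else x := by
  simp only [Fin.predAbove, Fin.lt_def, Fin.val_castSucc]
  split_ifs <;> rfl

theorem val_succAbove {M : ℕ} (i : Fin (M + 1)) (x : Fin M) :
    (i.succAbove x : ℕ) = if (x : ℕ) < i then (x : ℕ) else x + 1 := by
  simp only [Fin.succAbove, Fin.lt_def, Fin.val_castSucc]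
  split_ifs <;> rfl

/-- Prism 0 has only its vertex 0 over the source of the arrow. Dropping that vertex leaves the
evaluation of the whole simplex at the target. -/
theorem prism_first_face (M : ℕ) :
    (Fin.predAbove (0 : Fin (M + 1)) ∘ Fin.succAbove 0 = id) ∧
      (prismBit (0 : Fin (M + 1)) ∘ Fin.succAbove 0 = fun _ => true) := by
  constructor <;> funext x <;> simp

/-- The last prism has only its last vertex over the target. Dropping that vertex leaves the
evaluation at the source. -/
theorem prism_last_face (M : ℕ) :
    (Fin.predAbove (Fin.last M) ∘ Fin.succAbove (Fin.last (M + 1)) = id) ∧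
      (prismBit (Fin.last M) ∘ Fin.succAbove (Fin.last (M + 1)) = fun _ => false) := by
  constructor <;> funext x <;> simp [Fin.le_last]

/-- The dropped vertex lies strictly before the repeated source vertex of the prism over `m.succ`,
so it can be dropped from the simplex first; this shifts the jump down by one. -/
theorem prism_lower_face {M : ℕ} (m : Fin (M + 1)) (i : Fin (M + 2)) (h : i ≤ m.castSucc) :
    (m.succ.predAbove ∘ i.castSucc.succAbove = i.succAbove ∘ m.predAbove) ∧
      (prismBit m.succ ∘ i.castSucc.succAbove = prismBit m) := by
  constructor <;> funext x
  · apply Fin.ext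
    simp only [val_predAbove, val_succAbove, Function.comp, Fin.le_def,
      Fin.val_castSucc, Fin.val_succ] at h ⊢
    split_ifs <;> omega
  · simp only [prismBit, Function.comp, decide_eq_decide, val_succAbove, Fin.lt_def, Fin.le_def,
      Fin.val_castSucc, Fin.val_succ] at h ⊢
    split_ifs <;> omega

/-- The dropped vertex lies beyond the jump, so it can be dropped from the simplex first without
moving the jump. -/
theorem prism_upper_face {M : ℕ} (m : Fin (M + 1)) (i : Fin (M + 2)) (h : m.castSucc < i) :
    (m.castSucc.predAbove ∘ i.succ.succAbove = i.succAbove ∘ m.predAbove) ∧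
      (prismBit m.castSucc ∘ i.succ.succAbove = prismBit m) := by
  constructor <;> funext x
  · apply Fin.ext
    simp only [val_predAbove, val_succAbove, Function.comp, Fin.lt_def,
      Fin.val_castSucc, Fin.val_succ] at h ⊢
    split_ifs <;> omega
  · simp only [prismBit, Function.comp, decide_eq_decide, val_succAbove, Fin.lt_def,
      Fin.val_castSucc, Fin.val_succ] at h ⊢
    split_ifs <;> omega

/-- Dropping the target copy of vertex `m` from prism `m`, or the source copy of vertex `m + 1` from
prism `m + 1`, leaves the same string, in which the jump goes from vertex `m` to vertex `m + 1`. -/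
theorem prism_middle_face {M : ℕ} (m : Fin M) :
    (m.castSucc.predAbove ∘ m.succ.castSucc.succAbove = m.succ.predAbove ∘ m.succ.castSucc.succAbove) ∧
      (prismBit m.castSucc ∘ m.succ.castSucc.succAbove = prismBit m.succ ∘ m.succ.castSucc.succAbove) := by
  constructor <;> funext x
  · apply Fin.ext
    simp only [val_predAbove, val_succAbove, Function.comp,
      Fin.val_castSucc, Fin.val_succ]
    split_ifs <;> omega
  · simp only [prismBit, Function.comp, decide_eq_decide, val_succAbove, Fin.lt_def,
      Fin.val_castSucc, Fin.val_succ]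
    split_ifs <;> omega

/-- The lowest degree of the homotopy formula: a point has no faces, so the term with the prism
operator inside the Čech differential is absent. -/
theorem prismOp_cechDelta_zero (g : K.Arr) (l : ℕ) (s : DSec (Nerve G 0) l) :
    prismOp G g 0 l (cechDelta G 0 l s) =
      evalPull 0 l s (K.data.tgt g) - evalPull 0 l s (K.data.src g) := by
  have key := prism_sum_fin 0 (fun (m : Fin 1) (i : Fin 2) =>
      edgePull g l s (m.predAbove ∘ i.succAbove) (prismBit m ∘ i.succAbove))
    (fun _ m => m.elim0) (fun m => m.elim0) (fun m => m.elim0) (fun m => m.elim0)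
  rw [prismOp_cechDelta_apply, ← edgePull_true, ← edgePull_false]
  rw [Finset.univ_eq_empty (α := Fin 0), Finset.sum_empty, add_zero] at key
  rw [key, (prism_first_face 0).1, (prism_first_face 0).2, (prism_last_face 0).1,
    (prism_last_face 0).2]

/-- The arrow `g` relates the evaluations at its two ends by a natural isomorphism, and the prism
operator is the resulting cochain homotopy. The boundary of the triangulated prism consists of its
two ends and the prisms over the faces. -/
theorem prismOp_cechDelta_succ (g : K.Arr) (q l : ℕ) (s : DSec (Nerve G (q + 1)) l) :
    prismOp G g (q + 1) l (cechDelta G (q + 1) l s) +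
        cechDelta (mappingGroupoid K G) q l (prismOp G g q l s) =
      evalPull (q + 1) l s (K.data.tgt g) - evalPull (q + 1) l s (K.data.src g) := by
  have key := prism_sum_fin (q + 1) (fun m i =>
      edgePull g l s (m.predAbove ∘ i.succAbove) (prismBit m ∘ i.succAbove))
    (fun i m => edgePull g l s (i.succAbove ∘ m.predAbove) (prismBit m))
    (fun m i h => by rw [(prism_lower_face m i h).1, (prism_lower_face m i h).2])
    (fun m i h => by rw [(prism_upper_face m i h).1, (prism_upper_face m i h).2])
    (fun m => by rw [(prism_middle_face m).1, (prism_middle_face m).2])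
  rw [prismOp_cechDelta_apply, cechDelta_prismOp_apply, key, ← edgePull_true, ← edgePull_false]
  rw [(prism_first_face _).1, (prism_first_face _).2, (prism_last_face _).1,
    (prism_last_face _).2]

theorem d_prismOp (g : K.Arr) (q l : ℕ) (s : DSec (Nerve G (q + 1)) l) :
    DSec.d l (prismOp G g q l s) = prismOp G g q (l + 1) (DSec.d l s) := by
  simp only [prismOp_apply, map_sum, map_zsmul, edgePull, DSec.pull_d]

end Prism

/-! ### The holonomy homomorphism -/

section Holonomy

variable (G : EtaleGroupoid.{u}) (W : AdmissibleCover)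

/-- The restrictions of strings of loops to a segment, as a family of paths. -/
def segPath (q : ℕ) (j : ℤ) : PathFamily (Nerve (LG G W) q) (Nerve G.toD q) where
  toFun t := Nerve.evalAt (W.seg j t)
  smooth _ P := (pathPlot W P j).2

/-- Integration over all segments of the circle. -/
def loopInt (q l : ℕ) : DSec (Nerve G.toD q) (l + 1) →+ DSec (Nerve (LG G W) q) l :=
  ∑ j : Fin W.N, (segPath G W q j).fiberInt (W.pt j) (W.pt (j + 1)) l

/-- The sum of the prism operators of all glueing arrows. -/
def gluePrism (q l : ℕ) : DSec (Nerve G.toD (q + 1)) l →+ DSec (Nerve (LG G W) q) l :=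
  ∑ j : Fin W.N, prismOp G.toD (W.glue j) q l

theorem loopInt_apply (q l : ℕ) (s : DSec (Nerve G.toD q) (l + 1)) :
    loopInt G W q l s =
      ∑ j : Fin W.N, (segPath G W q j).fiberInt (W.pt j) (W.pt (j + 1)) l s := by
  simp only [loopInt, AddMonoidHom.finsetSum_apply]

theorem gluePrism_apply (q l : ℕ) (s : DSec (Nerve G.toD (q + 1)) l) :
    gluePrism G W q l s = ∑ j : Fin W.N, prismOp G.toD (W.glue j) q l s := by
  simp only [gluePrism, AddMonoidHom.finsetSum_apply]

/-- Dropping a functor from a string and restricting to a segment commute, so integration is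
compatible with each face separately. -/
theorem cechDelta_loopInt (q l : ℕ) (s : DSec (Nerve G.toD q) (l + 1)) :
    cechDelta (LG G W) q l (loopInt G W q l s) =
      loopInt G W (q + 1) l (cechDelta G.toD q (l + 1) s) := by
  rw [cechDelta_apply, cechDelta_apply, loopInt_apply, loopInt_apply]
  simp only [map_sum, map_zsmul, Finset.smul_sum]
  rw [Finset.sum_comm]
  exact Finset.sum_congr rfl fun j _ => Finset.sum_congr rfl fun i _ => congrArg _
    ((segPath G W q j).pull_fiberInt _ _ (segPath G W (q + 1) j) _ _ _
      (Nerve.reindex_smooth _) (fun t x => rfl) l s)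

theorem d_gluePrism (q l : ℕ) (s : DSec (Nerve G.toD (q + 1)) l) :
    DSec.d l (gluePrism G W q l s) = gluePrism G W q (l + 1) (DSec.d l s) := by
  simp only [gluePrism_apply, map_sum, d_prismOp]

/-- With the two lemmas on targets below, this makes segments and glueing arrows consecutive. The
smooth cutoff inside `seg` is invisible here, since `clamp` is the identity on the closed segment.
-/
theorem src_glue (j : Fin W.N) : W.circle.data.src (W.glue j) = W.seg j (W.pt (j + 1)) := by
  have hc : W.clamp j (W.pt (j + 1)) = W.pt (j + 1) :=
    W.clamp_of_mem _ _ ⟨(W.pt_strictMono (lt_add_one _)).le, le_rfl⟩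
  by_cases h : (j : ℕ) + 1 < W.N
  · exact (congrArg W.circle.data.src (dif_pos h : W.glue j = _)).trans (CObj.ext rfl hc.symm)
  · exact (congrArg W.circle.data.src (dif_neg h : W.glue j = _)).trans (CObj.ext rfl hc.symm)

theorem clamp_left (j : ℤ) : W.clamp j (W.pt j) = W.pt j :=
  W.clamp_of_mem _ _ ⟨le_rfl, (W.pt_strictMono (lt_add_one _)).le⟩

theorem pt_N : W.pt W.N = 1 := by
  have := W.pt_periodic 0
  rwa [zero_add, W.pt_zero, zero_add] at this

theorem tgt_glue_of_lt (j : Fin W.N) (h : (j : ℕ) + 1 < W.N) :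
    W.circle.data.tgt (W.glue j) = W.seg (j + 1 : ℕ) (W.pt (j + 1 : ℕ)) := by
  refine (congrArg W.circle.data.tgt (dif_pos h : W.glue j = _)).trans
    (CObj.ext (Nat.cast_succ _).symm ?_)
  change W.pt (j + 1) + ((0 : ℤ) : ℝ) = W.clamp _ _
  rw [clamp_left, Int.cast_zero, add_zero]
  rfl

/-- The last glueing arrow translates by −1 and so carries the end 1 of the last segment to the
start 0 of the first. -/
theorem tgt_glue_of_not_lt (j : Fin W.N) (h : ¬ (j : ℕ) + 1 < W.N) :
    W.circle.data.tgt (W.glue j) = W.seg (0 : ℕ) (W.pt (0 : ℕ)) := by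
  refine (congrArg W.circle.data.tgt (dif_neg h : W.glue j = _)).trans (CObj.ext rfl ?_)
  change W.pt (j + 1) + ((-1 : ℤ) : ℝ) = W.clamp _ _
  have hN : ((j : ℕ) : ℤ) + 1 = W.N := by omega
  rw [clamp_left, hN, pt_N, Nat.cast_zero, W.pt_zero]
  simp

/-- Going once around the circle, the segments and the glueing arrows form a closed path. -/
theorem sum_ends {A : Type*} [AddCommGroup A] (f : W.circle.Obj → A) :
    ∑ j : Fin W.N, (f (W.seg j (W.pt (j + 1))) - f (W.seg j (W.pt j))) +
      ∑ j : Fin W.N, (f (W.circle.data.tgt (W.glue j)) - f (W.circle.data.src (W.glue j))) = 0 := by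
  let e : ℕ → A := fun i => f (W.seg i (W.pt i))
  have ht : ∀ j : Fin W.N, f (W.circle.data.tgt (W.glue j)) =
      if (j : ℕ) + 1 < W.N then e (j + 1) else e 0 := fun j => by
    split_ifs with h
    · rw [tgt_glue_of_lt W j h]
    · rw [tgt_glue_of_not_lt W j h]
  -- The ends of the segments cancel against the sources of the glueing arrows. What remains is a
  -- cyclic shift of the values at the starts of the segments.
  have hsum : ∀ N : ℕ, 0 < N →
      ∑ i ∈ Finset.range N, ((if i + 1 < N then e (i + 1) else e 0) - e i) = 0 := by
    rintro (_ | N) hN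
    · omega
    · rw [Finset.sum_range_succ, if_neg (lt_irrefl _), Finset.sum_congr rfl fun i hi => by
        rw [if_pos (Nat.succ_lt_succ (Finset.mem_range.1 hi))], Finset.sum_range_sub]
      abel
  rw [← Finset.sum_add_distrib, ← hsum W.N W.N_pos, Finset.sum_range]
  refine Finset.sum_congr rfl fun j _ => ?_
  rw [ht, src_glue]
  abel

/-- In form degree 0 there is no lower term `d I`; the formula is the fundamental theorem of
calculus for `d log`. -/
theorem loopInt_stokes_zero (q : ℕ) (s : DSec (Nerve G.toD q) 0) :
    loopInt G W q 0 (DSec.d 0 s) = ∑ j : Fin W.N,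
      (evalPull q 0 s (W.seg j (W.pt (j + 1))) - evalPull q 0 s (W.seg j (W.pt j))) := by
  rw [loopInt_apply]
  exact Finset.sum_congr rfl fun j _ => (segPath G W q j).fiberInt_dlog _ _ s

theorem loopInt_stokes_succ (q l : ℕ) (s : DSec (Nerve G.toD q) (l + 1)) :
    loopInt G W q (l + 1) (DSec.d (l + 1) s) + DSec.d l (loopInt G W q l s) = ∑ j : Fin W.N,
      (evalPull q (l + 1) s (W.seg j (W.pt (j + 1))) -
        evalPull q (l + 1) s (W.seg j (W.pt j))) := by
  rw [loopInt_apply, loopInt_apply, map_sum, ← Finset.sum_add_distrib]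
  exact Finset.sum_congr rfl fun j _ => (add_comm _ _).trans
    ((segPath G W q j).d_fiberInt_add _ _ l s)

theorem gluePrism_cechDelta_zero (l : ℕ) (s : DSec (Nerve G.toD 0) l) :
    gluePrism G W 0 l (cechDelta G.toD 0 l s) = ∑ j : Fin W.N,
      (evalPull 0 l s (W.circle.data.tgt (W.glue j)) -
        evalPull 0 l s (W.circle.data.src (W.glue j))) := by
  rw [gluePrism_apply]
  exact Finset.sum_congr rfl fun j _ => prismOp_cechDelta_zero _ l s

theorem gluePrism_cechDelta_succ (q l : ℕ) (s : DSec (Nerve G.toD (q + 1)) l) :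
    gluePrism G W (q + 1) l (cechDelta G.toD (q + 1) l s) +
        cechDelta (LG G W) q l (gluePrism G W q l s) = ∑ j : Fin W.N,
      (evalPull (q + 1) l s (W.circle.data.tgt (W.glue j)) -
        evalPull (q + 1) l s (W.circle.data.src (W.glue j))) := by
  rw [gluePrism_apply, gluePrism_apply, map_sum, ← Finset.sum_add_distrib]
  exact Finset.sum_congr rfl fun j _ => prismOp_cechDelta_succ _ q l s

/-- The generalized holonomy. -/
def holonomy (n : ℕ) : Cochain G.toD (n + 2) (n + 1) →+ Cochain (LG G W) (n + 1) n where
  toFun c := fun a =>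
    loopInt G W a.k a.l (c ⟨a.k, a.l + 1, by have := a.add; omega, by have := a.lt; omega⟩) +
      (-1 : ℤ) ^ (n + 1) • gluePrism G W a.k a.l
        (c ⟨a.k + 1, a.l, by have := a.add; omega, by have := a.lt; omega⟩)
  map_zero' := by
    funext a
    simp only [Pi.zero_apply, map_zero, smul_zero, add_zero]
  map_add' b c := by
    funext a
    simp only [Pi.add_apply, map_add, smul_add]
    abel

theorem holonomy_apply (n : ℕ) (c : Cochain G.toD (n + 2) (n + 1)) (k l : ℕ) (h : k + l = n)
    (hl : l < n + 1) :
    holonomy G W n c ⟨k, l, h, hl⟩ = loopInt G W k l (c ⟨k, l + 1, by omega, by omega⟩) +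
      (-1 : ℤ) ^ (n + 1) • gluePrism G W k l (c ⟨k + 1, l, by omega, by omega⟩) := rfl

/-! ### Components of the total differential. -/

section Differential

variable {H : DGroupoid.{u}} {p i : ℕ} (c : Cochain H p i)

theorem Cochain.D_apply (a : Bideg p (i + 1)) :
    Cochain.D H p i c a = c.delta a + (-1 : ℤ) ^ (i + 1) • c.vert a := rfl

theorem Cochain.D_zero_succ (l : ℕ) (h : 0 + (l + 1) = i + 1) (hl : l + 1 < p) :
    Cochain.D H p i c ⟨0, l + 1, h, hl⟩ =
      (-1 : ℤ) ^ (i + 1) • DSec.d l (c ⟨0, l, by omega, by omega⟩) :=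
  (Cochain.D_apply c _).trans (zero_add _)

theorem Cochain.D_succ_zero (k : ℕ) (h : k + 1 + 0 = i + 1) (hl : 0 < p) :
    Cochain.D H p i c ⟨k + 1, 0, h, hl⟩ = cechDelta H k 0 (c ⟨k, 0, by omega, hl⟩) := by
  rw [Cochain.D_apply, show c.vert ⟨k + 1, 0, h, hl⟩ = 0 from rfl, smul_zero, add_zero]
  rfl

theorem Cochain.D_succ_succ (k l : ℕ) (h : k + 1 + (l + 1) = i + 1) (hl : l + 1 < p) :
    Cochain.D H p i c ⟨k + 1, l + 1, h, hl⟩ = cechDelta H k (l + 1) (c ⟨k, l + 1, by omega, hl⟩) +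
      (-1 : ℤ) ^ (i + 1) • DSec.d l (c ⟨k + 1, l, by omega, by omega⟩) := rfl

/-- The component of form degree `l` involves only components of form degree at most `l`, so the
truncation does not affect it. -/
theorem Cochain.D_lift_apply (hp : i < p) (k l : ℕ) (h : k + l = i + 1) (hl : l < p) :
    Cochain.D H (p + 1) i (c.lift hp) ⟨k, l, h, hl.trans (Nat.lt_succ_self p)⟩ =
      Cochain.D H p i c ⟨k, l, h, hl⟩ := by
  rcases k with _ | k <;> rcases l with _ | l <;> rfl

end Differential

theorem holonomy_lift_apply (n : ℕ) (c : Cochain G.toD (n + 2) (n + 1)) (k l : ℕ)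
    (h : k + l = n) (hl : l < n + 1 + 1) :
    (holonomy G W n c).lift (Nat.lt_succ_self _) ⟨k, l, h, hl⟩ =
      loopInt G W k l (c ⟨k, l + 1, by omega, by omega⟩) +
      (-1 : ℤ) ^ (n + 1) • gluePrism G W k l (c ⟨k + 1, l, by omega, by omega⟩) := rfl

/-- This is `(I − εP)(δ − εd) = (δ + εd)(I + εP)`. The terms are `a₁ = Iδ = δI`, `a₂ = Id`, `a₃ =
Pδ`, `a₄ = Pd = dP`, `b₂ = dI`, `b₃ = δP`, and the hypothesis is the vanishing of `Id + dI + Pδ +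
δP`. The two variants that follow serve the edges of the double complex, where either the terms `Iδ`
and `δP` or the terms `Pd` and `dI` are absent. -/
theorem sign_identity {A : Type*} [AddCommGroup A] (ε : ℤ) {a₁ a₂ a₃ a₄ b₂ b₃ : A}
    (h : a₂ + b₂ + (a₃ + b₃) = 0) :
    a₁ + -ε • a₂ + -ε • (a₃ + -ε • a₄) = a₁ + ε • b₃ + ε • (b₂ + ε • a₄) := by
  rw [add_assoc] at h
  obtain rfl := eq_neg_of_add_eq_zero_left h
  module

theorem sign_identity_left {A : Type*} [AddCommGroup A] (ε : ℤ) {a₂ a₃ a₄ b₂ : A}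
    (h : a₂ + b₂ + a₃ = 0) :
    -ε • a₂ + -ε • (a₃ + -ε • a₄) = ε • (b₂ + ε • a₄) := by
  rw [add_assoc] at h
  obtain rfl := eq_neg_of_add_eq_zero_left h
  module

theorem sign_identity_right {A : Type*} [AddCommGroup A] (ε : ℤ) {a₁ a₂ a₃ b₃ : A}
    (h : a₂ + (a₃ + b₃) = 0) :
    a₁ + -ε • a₂ + -ε • a₃ = a₁ + ε • b₃ := by
  obtain rfl := eq_neg_of_add_eq_zero_left h
  module

/-- The holonomy intertwines the total differentials. -/
theorem holonomy_D (n : ℕ) (c : Cochain G.toD (n + 2) (n + 1)) :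
    holonomy G W (n + 1) (Cochain.D G.toD (n + 3) (n + 1) (c.lift (Nat.lt_succ_self _))) =
      Cochain.D (LG G W) (n + 2) n ((holonomy G W n c).lift (Nat.lt_succ_self _)) := by
  funext ⟨k, l, h, hl⟩
  rw [holonomy_apply]
  have hn : (-1 : ℤ) ^ (n + 1 + 1) = -(-1 : ℤ) ^ (n + 1) := by rw [pow_succ]; ring
  rcases k with _ | k <;> rcases l with _ | l
  · omega
  -- In each bidegree `sum_ends`, applied to evaluation of the relevant component of `c`, states
  -- that the boundary terms of Stokes and of the prism homotopy cancel.
  · have e := sum_ends W (evalPull 0 (l + 1) (c ⟨0, l + 1, by omega, by omega⟩))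
    rw [← loopInt_stokes_succ, ← gluePrism_cechDelta_zero] at e
    rw [Cochain.D_zero_succ, Cochain.D_zero_succ, Cochain.D_succ_succ, holonomy_lift_apply, hn]
    simp only [map_add, map_zsmul, d_gluePrism]
    exact sign_identity_left _ e
  · have e := sum_ends W (evalPull (k + 1) 0 (c ⟨k + 1, 0, by omega, by omega⟩))
    rw [← loopInt_stokes_zero, ← gluePrism_cechDelta_succ] at e
    rw [Cochain.D_succ_zero, Cochain.D_succ_zero, Cochain.D_succ_succ, holonomy_lift_apply, hn]
    simp only [map_add, map_zsmul, cechDelta_loopInt]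
    exact sign_identity_right _ e
  · have e := sum_ends W (evalPull (k + 1) (l + 1) (c ⟨k + 1, l + 1, by omega, by omega⟩))
    rw [← loopInt_stokes_succ, ← gluePrism_cechDelta_succ] at e
    rw [Cochain.D_succ_succ, Cochain.D_succ_succ, Cochain.D_succ_succ, holonomy_lift_apply,
      holonomy_lift_apply, hn]
    simp only [map_add, map_zsmul, cechDelta_loopInt, d_gluePrism]
    exact sign_identity _ e

/-- The holonomy of the coboundary of a function is trivial. -/
theorem holonomy_D_zero (b : Cochain G.toD 2 0) :
    holonomy G W 0 (Cochain.D G.toD 2 0 b) = 0 := by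
  funext ⟨k, l, h, hl⟩
  obtain rfl : k = 0 := by omega
  obtain rfl : l = 0 := by omega
  have e := sum_ends W (evalPull 0 0 (b ⟨0, 0, rfl, by omega⟩))
  rw [← loopInt_stokes_zero, ← gluePrism_cechDelta_zero] at e
  rw [holonomy_apply, Cochain.D_zero_succ, Cochain.D_succ_zero, map_zsmul,
    ← smul_add, e, smul_zero]
  rfl

/-- The holonomy of a cocycle is a cocycle. -/
theorem holonomy_D_eq_zero (n : ℕ) (c : Cochain G.toD (n + 2) (n + 1))
    (hc : Cochain.D G.toD (n + 2) (n + 1) c = 0) :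
    Cochain.D (LG G W) (n + 1) n (holonomy G W n c) = 0 := by
  funext ⟨k, l, h, hl⟩
  -- After lifting, the component of form degree `n + 2`, which is the curvature, may be nonzero.
  -- Only components below it enter the bidegrees under consideration.
  have hz : ∀ (k l : ℕ) (h : k + l = n + 1 + 1) (hl : l < n + 2),
      Cochain.D G.toD (n + 3) (n + 1) (c.lift (Nat.lt_succ_self _))
        ⟨k, l, h, hl.trans (Nat.lt_succ_self _)⟩ = 0 := fun k l h hl => by
    rw [Cochain.D_lift_apply c (Nat.lt_succ_self _) k l h hl, hc]
    rfl
  rw [← Cochain.D_lift_apply _ (Nat.lt_succ_self _) k l h hl, ← holonomy_D, holonomy_apply,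
    hz k (l + 1) (by omega) (by omega), hz (k + 1) l (by omega) (by omega), map_zero, map_zero,
    smul_zero, add_zero]
  rfl

/-- The holonomy is given by the explicit formula. -/
theorem isHolonomy_holonomy (n : ℕ) (c : Cochain G.toD (n + 2) (n + 1)) :
    IsHolonomy W c (holonomy G W n c) where
  deg_zero Λ := by
    rw [holonomy_apply, DSec.fn_add, DSec.fn_zsmul, loopInt_apply, gluePrism_apply, DSec.fn_sum,
      DSec.fn_sum, Units.val_mul, Complex.exp_sum, Units.coe_prod]
    congr 1
    · refine Finset.prod_congr rfl fun j _ => ?_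
      refine ((segPath G W n j).fn_fiberInt _ _ _ (PathFamily.constPlot Λ) 0 ![]).trans ?_
      congr 1
      rw [flatInt_apply (DSec.form_contDiff _ _).continuous]
      refine intervalIntegral.integral_congr fun t _ => ?_
      refine congrArg₂ _ rfl (funext fun i => ?_)
      rw [Fin.eq_zero i]
      rfl
    · rw [← Finset.prod_zpow, Units.coe_prod]
      refine Finset.prod_congr rfl fun j _ => ?_
      rw [prismOp_apply, DSec.fn_sum, ← Finset.prod_zpow, Units.coe_prod]
      refine Finset.prod_congr rfl fun m _ => ?_
      rw [DSec.fn_zsmul, ← zpow_mul, ← pow_add, Units.val_zpow_eq_zpow_val, ← add_assoc]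
      rfl
  deg_pos q k h d P x v := by
    rw [holonomy_apply, DSec.form_add, DSec.form_zsmul, loopInt_apply, gluePrism_apply,
      DSec.form_sum, DSec.form_sum]
    congr 1
    · refine Finset.sum_congr rfl fun j _ => ?_
      rw [PathFamily.form_fiberInt]
      exact flatInt_apply (DSec.form_contDiff _ _).continuous _ _
    · rw [Finset.smul_sum]
      refine Finset.sum_congr rfl fun j _ => ?_
      rw [prismOp_apply, DSec.form_sum, Finset.smul_sum]
      refine Finset.sum_congr rfl fun m _ => ?_
      rw [DSec.form_zsmul, smul_smul, ← pow_add, zsmul_eq_mul]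
      push_cast
      rw [add_comm, ← add_assoc]
      rfl

end Holonomy

/-! ### Naturality in the groupoid. -/

section Naturality

variable {G G' : EtaleGroupoid.{u}} (f : DFunctor G.toD G'.toD) (W : AdmissibleCover)

theorem pull_loopInt (q l : ℕ) (s : DSec (Nerve G'.toD q) (l + 1)) :
    DSec.pull (Nerve.map (loopMap f W)) (Nerve.map_smooth _) l (loopInt G' W q l s) =
      loopInt G W q l (DSec.pull (Nerve.map f) (Nerve.map_smooth f) (l + 1) s) := by
  rw [loopInt_apply, loopInt_apply, map_sum]
  refine Finset.sum_congr rfl fun j _ => (segPath G' W q j).pull_fiberInt _ _ (segPath G W q j)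
    _ _ _ (Nerve.map_smooth f) (fun t Λ => ?_) l s
  refine Nerve.ext rfl (funext fun a => funext fun b => ?_)
  -- The arrows of an evaluated string are composites of a component of a transformation and the
  -- image of an arrow, so functoriality of `f` is all that is needed.
  exact (f.map_comp _ _ _).symm

theorem pull_gluePrism (q l : ℕ) (s : DSec (Nerve G'.toD (q + 1)) l) :
    DSec.pull (Nerve.map (loopMap f W)) (Nerve.map_smooth _) l (gluePrism G' W q l s) =
      gluePrism G W q l (DSec.pull (Nerve.map f) (Nerve.map_smooth f) l s) := by
  rw [gluePrism_apply, gluePrism_apply, map_sum]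
  refine Finset.sum_congr rfl fun j _ => ?_
  rw [prismOp_apply, prismOp_apply, map_sum]
  refine Finset.sum_congr rfl fun m _ => ?_
  rw [map_zsmul]
  congr 1
  refine (DSec.pull_pull _ _ _ _ _ _).trans (Eq.trans (DSec.pull_congr ?_ _ _ l s)
    (DSec.pull_pull (Nerve.evalEdge _ _ _) (Nerve.evalEdge_smooth _ _ _) (Nerve.map f)
      (Nerve.map_smooth f) l s).symm)
  funext Λ
  refine Nerve.ext rfl (funext fun a => funext fun b => ?_)
  exact (f.map_comp _ _ _).symm

theorem holonomy_pull (n : ℕ) (c : Cochain G'.toD (n + 2) (n + 1)) :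
    holonomy G W n (Cochain.pull f (n + 2) (n + 1) c) =
      Cochain.pull (loopMap f W) (n + 1) n (holonomy G' W n c) := by
  funext ⟨k, l, h, hl⟩
  change _ = DSec.pull _ _ l (holonomy G' W n c ⟨k, l, h, hl⟩)
  rw [holonomy_apply, holonomy_apply, map_add, map_zsmul]
  exact congrArg₂ (· + ·) (pull_loopInt f W k l _).symm
    (congrArg _ (pull_gluePrism f W k l _).symm)

end Naturality

/-! ### Normalization of cochains -/

section Normalization

open CategoryTheory Opposite Simplicial AlgebraicTopology AlgebraicTopology.DoldKan

variable (G : DGroupoid.{u})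

/-- The value at an element of a morphism in the opposite category of abelian groups. -/
def unopEval {A B : AddCommGrpCat.{u}ᵒᵖ} (s : B.unop) : (A ⟶ B) →+ A.unop where
  toFun f := f.unop.hom s
  map_zero' := rfl
  map_add' _ _ := rfl

theorem unopEval_comp {A B C : AddCommGrpCat.{u}ᵒᵖ} (f : A ⟶ B) (g : B ⟶ C) (s : C.unop) :
    unopEval s (f ≫ g) = unopEval (unopEval s g) f := rfl

theorem unopEval_comp_eq_zero {A B C : AddCommGrpCat.{u}ᵒᵖ} (f : A ⟶ B) (g : B ⟶ C) (s : C.unop)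
    (h : unopEval s g = 0) : unopEval s (f ≫ g) = 0 := by
  rw [unopEval_comp, h]
  exact map_zero f.unop.hom

/-- The cosimplicial group of sections over the nerve of a groupoid, as a simplicial object of the
opposite category. -/
def sectionsOfNerve (l : ℕ) : SimplicialObject AddCommGrpCat.{u}ᵒᵖ where
  obj Δ := op (AddCommGrpCat.of (DSec (Nerve G Δ.unop.len) l))
  map f := (AddCommGrpCat.ofHom (DSec.pull (Nerve.reindex f.unop.toOrderHom)
    (Nerve.reindex_smooth _) l)).op
  map_id Δ := by
    refine Quiver.Hom.unop_inj ?_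
    ext s
    exact DSec.pull_id rfl _ l s
  map_comp f g := by
    refine Quiver.Hom.unop_inj ?_
    ext s
    exact (DSec.pull_pull (Nerve.reindex f.unop.toOrderHom) (Nerve.reindex_smooth _)
      (Nerve.reindex g.unop.toOrderHom) (Nerve.reindex_smooth _) l s).symm

variable {G} in
/-- A family of homomorphisms of sections that is compatible with all reindexings is a morphism of
cosimplicial groups. -/
def sectionsHom {G' : DGroupoid.{u}} {l l' : ℕ}
    (φ : ∀ k, DSec (Nerve G k) l →+ DSec (Nerve G' k) l')
    (hφ : ∀ (k m : ℕ) (f : Fin (m + 1) → Fin (k + 1)) (s : DSec (Nerve G m) l),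
      φ k (DSec.pull (Nerve.reindex f) (Nerve.reindex_smooth f) l s) =
        DSec.pull (Nerve.reindex f) (Nerve.reindex_smooth f) l' (φ m s)) :
    sectionsOfNerve G' l' ⟶ sectionsOfNerve G l where
  app Δ := (AddCommGrpCat.ofHom (φ Δ.unop.len)).op
  naturality Δ Δ' f := by
    refine Quiver.Hom.unop_inj ?_
    ext s
    exact (hφ _ _ _ s).symm

/-- The projection of the sections over the nerve onto the normalized ones. -/
def normProj (k l : ℕ) : DSec (Nerve G k) l →+ DSec (Nerve G k) l :=
  ((PInfty (X := sectionsOfNerve G l)).f k).unop.hom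

/-- The homotopy between the projection onto the normalized sections and the identity. -/
def normHtpy (k l : ℕ) : DSec (Nerve G (k + 1)) l →+ DSec (Nerve G k) l :=
  ((homotopyPInftyToId (sectionsOfNerve G l)).hom k (k + 1)).unop.hom

/-- Identifies the Čech complex with the alternating face complex to which the Dold–Kan
constructions apply. -/
theorem sectionsOfNerve_d (k l : ℕ) (s : DSec (Nerve G k) l) :
    ((AlternatingFaceMapComplex.obj (sectionsOfNerve G l)).d (k + 1) k).unop.hom s =
      cechDelta G k l s := by
  rw [AlternatingFaceMapComplex.obj_d_eq, cechDelta_apply]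
  refine (map_sum (unopEval (A := op (AddCommGrpCat.of (DSec (Nerve G (k + 1)) l)))
    (B := op (AddCommGrpCat.of (DSec (Nerve G k) l))) s) _ _).trans ?_
  exact Finset.sum_congr rfl fun i _ =>
    map_zsmul (unopEval (A := op (AddCommGrpCat.of (DSec (Nerve G (k + 1)) l)))
      (B := op (AddCommGrpCat.of (DSec (Nerve G k) l))) s) _ ((sectionsOfNerve G l).δ i)

theorem normProj_cechDelta (k l : ℕ) (s : DSec (Nerve G k) l) :
    normProj G (k + 1) l (cechDelta G k l s) = cechDelta G k l (normProj G k l s) := by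
  have h := congrArg (fun f => f.unop.hom s) ((PInfty (X := sectionsOfNerve G l)).comm (k + 1) k)
  rw [← sectionsOfNerve_d, ← sectionsOfNerve_d]
  exact h

/-- `PInfty` vanishes on degeneracies. Passing to the opposite reverses the composition, so the
image of the projection is killed by every degeneracy pullback. -/
theorem pull_degen_normProj (k l : ℕ) (j : Fin (k + 1)) (s : DSec (Nerve G (k + 1)) l) :
    DSec.pull (Nerve.degen (G := G) j) (Nerve.reindex_smooth _) l (normProj G (k + 1) l s) = 0 := by
  have h := congrArg (fun f => f.unop.hom s) (σ_comp_PInfty (sectionsOfNerve G l) j)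
  exact h

/-- In a fixed degree `PInfty` is a finite stage `P`, and its complement `Q` is a sum of maps each
ending with a degeneracy. In the opposite category that last factor acts first, and a normalized
section is killed by it. -/
theorem normProj_eq_self (k l : ℕ) (s : DSec (Nerve G (k + 1)) l)
    (hs : ∀ j : Fin (k + 1),
      DSec.pull (Nerve.degen (G := G) j) (Nerve.reindex_smooth _) l s = 0) :
    normProj G (k + 1) l s = s := by
  have h := congrArg (unopEval s) (P_add_Q_f (X := sectionsOfNerve G l) (k + 1) (k + 1))
  rw [decomposition_Q, map_add, map_sum, Finset.sum_eq_zero, add_zero] at h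
  · exact h
  · intro i _
    have e : unopEval (A := (sectionsOfNerve G l).obj (op ⦋k⦌))
      (B := (sectionsOfNerve G l).obj (op ⦋k + 1⦌)) s ((sectionsOfNerve G l).σ i.rev) = 0 := hs i.rev
    exact unopEval_comp_eq_zero _ _ _ (unopEval_comp_eq_zero _ _ _ e)

/-- The homotopy relation in positive degree: projection minus identity is `δh + hδ`. -/
theorem normProj_sub_succ (k l : ℕ) (s : DSec (Nerve G (k + 1)) l) :
    normProj G (k + 1) l s =
      cechDelta G k l (normHtpy G k l s) + normHtpy G (k + 1) l (cechDelta G (k + 1) l s) + s := by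
  have h := (homotopyPInftyToId (sectionsOfNerve G l)).comm (k + 1)
  rw [Homotopy.dNext_succ_chainComplex, Homotopy.prevD_chainComplex] at h
  rw [← sectionsOfNerve_d, ← sectionsOfNerve_d]
  exact congrArg (unopEval s) h

/-- In degree 0 `PInfty` is the identity and there is no lower term, so the homotopy relation leaves
only this vanishing. -/
theorem normHtpy_cechDelta_zero (l : ℕ) (s : DSec (Nerve G 0) l) :
    normHtpy G 0 l (cechDelta G 0 l s) = 0 := by
  have h := (homotopyPInftyToId (sectionsOfNerve G l)).comm 0
  rw [Homotopy.dNext_zero_chainComplex, Homotopy.prevD_chainComplex, zero_add] at h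
  have h' := congrArg (unopEval s) h
  rw [map_add] at h'
  rw [← sectionsOfNerve_d]
  exact right_eq_add.1 h'

variable {G} in
theorem normProj_naturality {G' : DGroupoid.{u}} {l l' : ℕ}
    (φ : ∀ k, DSec (Nerve G k) l →+ DSec (Nerve G' k) l')
    (hφ : ∀ (k m : ℕ) (f : Fin (m + 1) → Fin (k + 1)) (s : DSec (Nerve G m) l),
      φ k (DSec.pull (Nerve.reindex f) (Nerve.reindex_smooth f) l s) =
        DSec.pull (Nerve.reindex f) (Nerve.reindex_smooth f) l' (φ m s))
    (k : ℕ) (s : DSec (Nerve G k) l) :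
    normProj G' k l' (φ k s) = φ k (normProj G k l s) := by
  have h := congrArg (fun f => f.unop.hom s) (PInfty_f_naturality k (sectionsHom φ hφ))
  exact h.symm

/-- The homotopies are built recursively from the natural maps `P` and `hσ'`, so naturality follows
by induction. It is what lets the normalizing homotopy commute with the differential of forms. -/
theorem homotopyPToId_naturality {C : Type*} [Category* C] [Preadditive C]
    {X Y : SimplicialObject C} (f : X ⟶ Y) (q n : ℕ) :
    f.app (op ⦋n⦌) ≫ (homotopyPToId Y q).hom n (n + 1) =
      (homotopyPToId X q).hom n (n + 1) ≫ f.app (op ⦋n + 1⦌) := by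
  induction q with
  | zero => simp [homotopyPToId]
  | succ q ih =>
    have e : ∀ Z : SimplicialObject C, (homotopyPToId Z (q + 1)).hom n (n + 1) =
        (homotopyPToId Z q).hom n (n + 1) +
          CategoryStruct.comp ((P (X := Z) q).f n) (hσ' (X := Z) q n (n + 1) (c_mk _ _ rfl)) := fun Z => by
      simp only [homotopyPToId, homotopyHσToZero, AlternatingFaceMapComplex.obj_X,
        Homotopy.trans_hom, Homotopy.ofEq_hom, Pi.zero_apply, Homotopy.add_hom, add_zero, zero_add]
      exact congrArg (fun g => _ + CategoryStruct.comp ((P (X := Z) q).f n) g)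
        (dif_pos (c_mk (n + 1) n rfl))
    rw [e, e, Preadditive.comp_add, Preadditive.add_comp, ih, P_f_naturality_assoc,
      hσ'_naturality, Category.assoc]

variable {G} in
theorem normHtpy_naturality {G' : DGroupoid.{u}} {l l' : ℕ}
    (φ : ∀ k, DSec (Nerve G k) l →+ DSec (Nerve G' k) l')
    (hφ : ∀ (k m : ℕ) (f : Fin (m + 1) → Fin (k + 1)) (s : DSec (Nerve G m) l),
      φ k (DSec.pull (Nerve.reindex f) (Nerve.reindex_smooth f) l s) =
        DSec.pull (Nerve.reindex f) (Nerve.reindex_smooth f) l' (φ m s))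
    (k : ℕ) (s : DSec (Nerve G (k + 1)) l) :
    normHtpy G' k l' (φ (k + 1) s) = φ k (normHtpy G k l s) := by
  have h := congrArg (fun f => f.unop.hom s)
    -- The component of `homotopyPInftyToId` from degree `k` to degree `k + 1` is taken from the
    -- homotopy of index `k + 2`.
    (homotopyPToId_naturality (sectionsHom φ hφ) (k + 2) k)
  exact h.symm

end Normalization

/-! ### Normalization of Čech–Deligne cochains. -/

section NormalizedCochains

/-- The projection onto the normalized cochains. -/
def normalize (G : DGroupoid.{u}) (p i : ℕ) : Cochain G p i →+ Cochain G p i where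
  toFun c := fun a => normProj G a.k a.l (c a)
  map_zero' := by
    funext a
    exact map_zero _
  map_add' b c := by
    funext a
    exact map_add _ _ _

theorem normalize_apply {G : DGroupoid.{u}} {p i : ℕ} (c : Cochain G p i) (k l : ℕ)
    (h : k + l = i) (hl : l < p) :
    normalize G p i c ⟨k, l, h, hl⟩ = normProj G k l (c ⟨k, l, h, hl⟩) := rfl

theorem normalize_mem {G : DGroupoid.{u}} {p i : ℕ} (c : Cochain G p i) :
    normalize G p i c ∈ normalized G p i :=
  fun k l _ _ j => pull_degen_normProj G k l j _

theorem normalize_eq_self {G : DGroupoid.{u}} {p i : ℕ} {c : Cochain G p i}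
    (hc : c ∈ normalized G p i) : normalize G p i c = c := by
  funext ⟨k, l, h, hl⟩
  rcases k with _ | k
  -- In nerve degree 0 `PInfty` is the identity.
  · rfl
  · exact normProj_eq_self G k l _ (hc k l h hl)

/-- The differential of forms commutes with all pullbacks, hence is a morphism of cosimplicial
groups, and the projection is natural for those. -/
theorem normProj_d (G : DGroupoid.{u}) (k l : ℕ) (s : DSec (Nerve G k) l) :
    normProj G k (l + 1) (DSec.d l s) = DSec.d l (normProj G k l s) :=
  normProj_naturality (fun _ => DSec.d l) (fun _ _ _ s => (DSec.pull_d _ _ l s).symm) k s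

theorem normHtpy_d (G : DGroupoid.{u}) (k l : ℕ) (s : DSec (Nerve G (k + 1)) l) :
    normHtpy G k (l + 1) (DSec.d l s) = DSec.d l (normHtpy G k l s) :=
  normHtpy_naturality (fun _ => DSec.d l) (fun _ _ _ s => (DSec.pull_d _ _ l s).symm) k s

theorem normalize_D {G : DGroupoid.{u}} {p i : ℕ} (c : Cochain G p i) :
    normalize G p (i + 1) (Cochain.D G p i c) = Cochain.D G p i (normalize G p i c) := by
  funext ⟨k, l, h, hl⟩
  rw [normalize_apply]
  rcases k with _ | k <;> rcases l with _ | l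
  · omega
  · rw [Cochain.D_zero_succ, Cochain.D_zero_succ, map_zsmul, normProj_d, normalize_apply]
  · rw [Cochain.D_succ_zero, Cochain.D_succ_zero, normProj_cechDelta, normalize_apply]
  · rw [Cochain.D_succ_succ, Cochain.D_succ_succ, map_add, map_zsmul, normProj_d,
      normProj_cechDelta, normalize_apply, normalize_apply]

theorem normalize_lift {G : DGroupoid.{u}} {p i : ℕ} (hp : i < p) (c : Cochain G p i) :
    normalize G (p + 1) i (c.lift hp) = (normalize G p i c).lift hp := rfl

theorem normalize_pull {G G' : DGroupoid.{u}} (f : DFunctor G G') {p i : ℕ} (c : Cochain G' p i) :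
    normalize G p i (Cochain.pull f p i c) = Cochain.pull f p i (normalize G' p i c) := by
  funext ⟨k, l, h, hl⟩
  exact normProj_naturality (fun _ => DSec.pull (Nerve.map f) (Nerve.map_smooth f) l)
    (fun _ _ _ s => (DSec.pull_pull _ _ _ _ l s).trans
      (DSec.pull_pull (Nerve.reindex _) (Nerve.reindex_smooth _) (Nerve.map f)
        (Nerve.map_smooth f) l s).symm) k _

/-- A cocycle differs from its normalization by a coboundary. -/
theorem exists_normalize_eq_add {G : DGroupoid.{u}} {n : ℕ} (c : Cochain G (n + 2) (n + 1))
    (hc : Cochain.D G (n + 2) (n + 1) c = 0) :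
    ∃ b : Cochain G (n + 2) n,
      normalize G (n + 2) (n + 1) c = Cochain.D G (n + 2) n b + c := by
  -- The homotopy `h` is applied in the Čech direction, one form degree at a time. Since `h`
  -- commutes with `d` and `Dc = 0`, the term `hδc` equals `(-1)^(n+1) d h c`, so `δhc + hδc` is the
  -- total differential of `hc` with no correction of signs.
  refine ⟨fun a => normHtpy G a.k a.l (c ⟨a.k + 1, a.l, by have := a.add; omega, a.lt⟩), ?_⟩
  have hz : ∀ (k l : ℕ) (h : k + l = n + 1 + 1) (hl : l < n + 2),
      Cochain.D G (n + 2) (n + 1) c ⟨k, l, h, hl⟩ = 0 := fun k l h hl => by rw [hc]; rfl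
  have hn : (-1 : ℤ) ^ (n + 1 + 1) = -(-1 : ℤ) ^ (n + 1) := by rw [pow_succ]; ring
  funext ⟨k, l, h, hl⟩
  rw [normalize_apply, Pi.add_apply]
  rcases k with _ | k <;> rcases l with _ | l
  · omega
  · have e := congrArg (normHtpy G 0 (l + 1)) (hz 1 (l + 1) (by omega) (by omega))
    rw [Cochain.D_succ_succ, map_add, normHtpy_cechDelta_zero, map_zsmul, normHtpy_d, map_zero,
      zero_add, hn, neg_smul, neg_eq_zero] at e
    rw [Cochain.D_zero_succ, e, zero_add]
    rfl
  · have e := congrArg (normHtpy G (k + 1) 0) (hz (k + 2) 0 (by omega) (by omega))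
    rw [Cochain.D_succ_zero, map_zero] at e
    rw [Cochain.D_succ_zero, normProj_sub_succ, e, add_zero]
  · have e := congrArg (normHtpy G (k + 1) (l + 1)) (hz (k + 2) (l + 1) (by omega) (by omega))
    rw [Cochain.D_succ_succ, map_add, map_zsmul, normHtpy_d, map_zero, hn, neg_smul,
      ← sub_eq_add_neg, sub_eq_zero] at e
    rw [Cochain.D_succ_succ, normProj_sub_succ, e]

end NormalizedCochains

/-! ### Induced maps in cohomology. -/

section CohomologyMap

variable {A B : ℕ → Type*} [∀ i, AddCommGroup (A i)] [∀ i, AddCommGroup (B i)]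

theorem exists_cohomologyMap (DA : ∀ i, A i →+ A (i + 1)) (DB : ∀ i, B i →+ B (i + 1)) {i j : ℕ}
    (τ : A i →+ B j) (h₁ : ∀ c, DA i c = 0 → DB j (τ c) = 0)
    (h₂ : ∀ b ∈ coboundaries DA i, τ b ∈ coboundaries DB j) :
    ∃ T : Cohomology DA i →+ Cohomology DB j, ∀ c (hc : DA i c = 0) (hτ : DB j (τ c) = 0),
      T (cls DA i c hc) = cls DB j (τ c) hτ :=
  ⟨QuotientAddGroup.map _ _
    ((τ.comp (DA i).ker.subtype).codRestrict (DB j).ker fun x => h₁ x.1 x.2)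
    (fun x hx => h₂ x.1 hx), fun _ _ _ => rfl⟩

end CohomologyMap

/-! ### Refinement of covers -/

namespace PathFamily

variable {X : Type u} [DiffeologicalSpace X] {Y : Type v} [DiffeologicalSpace Y]
variable (φ : PathFamily X Y)

theorem fiberInt_add_adjacent (a b c : ℝ) : ∀ (l : ℕ) (θ : DSec Y (l + 1)),
    φ.fiberInt a b l θ + φ.fiberInt b c l θ = φ.fiberInt a c l θ := by
  have key : ∀ {l m : ℕ} (θ : DSec Y (l + 1)) (P : Plot m X) (u : Euc m) (v : Fin l → Euc m),
      flatInt a b (DSec.form θ (φ.cyl P)) u v + flatInt b c (DSec.form θ (φ.cyl P)) u v =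
        flatInt a c (DSec.form θ (φ.cyl P)) u v := by
    intro l m θ P u v
    have hc := (DSec.form_contDiff θ (φ.cyl P)).continuous
    have hi := ((ContinuousAlternatingMap.apply ℝ (Euc (m + 1)) ℂ
      (Fin.cons (Euc.e0 m) fun i => Euc.incl m (v i))).continuous.comp hc).comp
        (Euc.continuous_cons_left u)
    rw [flatInt_apply hc, flatInt_apply hc, flatInt_apply hc]
    exact intervalIntegral.integral_add_adjacent_intervals (hi.intervalIntegrable _ _)
      (hi.intervalIntegrable _ _)
  rintro (_ | l) θ
  · refine DSec.ext_fn fun x => Units.ext ?_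
    rw [DSec.fn_add, Units.val_mul]
    exact (Complex.exp_add _ _).symm.trans (congrArg Complex.exp (key θ (constPlot x) 0 ![]))
  · refine DSec.ext_form fun m P u v => ?_
    rw [DSec.form_add, form_fiberInt, form_fiberInt, form_fiberInt, key]

theorem fiberInt_self (a : ℝ) (l : ℕ) (θ : DSec Y (l + 1)) : φ.fiberInt a a l θ = 0 := by
  have h := φ.fiberInt_add_adjacent a a a l θ
  rwa [add_eq_left] at h

/-- Fibre integrals only depend on the interiors of the paths. -/
theorem pull_fiberInt_of_eqOn {X' : Type w} [DiffeologicalSpace X'] (φ' : PathFamily X' Y)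
    (ψ : X' → X) (hψ : DSmooth ψ) {a b : ℝ} (hab : a ≤ b)
    (h : ∀ t ∈ Set.Ioo a b, ∀ x, φ.toFun t (ψ x) = φ'.toFun t x) : ∀ (l : ℕ) (θ : DSec Y (l + 1)),
    DSec.pull ψ hψ l (φ.fiberInt a b l θ) = φ'.fiberInt a b l θ := by
  have key : ∀ {l m : ℕ} (θ : DSec Y (l + 1)) (P : Plot m X') (u : Euc m) (v : Fin l → Euc m),
      flatInt a b (DSec.form θ (φ.cyl (P.map ψ hψ))) u v =
        flatInt a b (DSec.form θ (φ'.cyl P)) u v := by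
    intro l m θ P u v
    rw [flatInt_apply (DSec.form_contDiff _ _).continuous,
      flatInt_apply (DSec.form_contDiff _ _).continuous]
    -- A form at a point depends on the germ of the plot there. The families agree near interior
    -- parameters but not necessarily near the ends, which do not affect the integral.
    refine intervalIntegral.integral_congr_Ioo_of_le hab fun t ht => ?_
    refine congrArg (fun η : (Euc (m + 1)) [⋀^Fin (l + 1)]→L[ℝ] ℂ =>
      η (Fin.cons (Euc.e0 m) fun i => Euc.incl m (v i))) (DSec.form_congr_of_eventuallyEq θ ?_)
    have ho : IsOpen {w : Euc (m + 1) | w 0 ∈ Set.Ioo a b} :=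
      isOpen_Ioo.preimage (by fun_prop)
    filter_upwards [ho.mem_nhds (show Euc.cons t u ∈ _ from ht)] with w hw
    exact h _ hw _
  rintro (_ | l) θ
  · refine DSec.ext_fn fun x => Units.ext ?_
    exact congrArg Complex.exp (key θ (constPlot x) 0 ![])
  · exact DSec.ext_form fun m P u v => key θ P u v

end PathFamily

theorem GroupoidData.inv_one {Obj Arr : Type u} (D : GroupoidData Obj Arr) (x : Obj) :
    D.inv (D.one x) = D.one x := by
  have e : D.tgt (D.one x) = D.src (D.inv (D.one x)) := (D.src_inv _).symm
  have h := D.comp_inv (D.one x)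
  rw [D.src_one] at h
  rw [← D.one_comp' x (D.inv (D.one x)) e, h]

/-! ### Prisms over unit arrows and over images of arrows. -/

section UnitPrism

variable {K : DGroupoid.{v}} {G : DGroupoid.{u}}

theorem Nerve.edge_one (x : K.Obj) {k : ℕ} (b : Fin (k + 1) → Bool) :
    Nerve.edge (K.data.one x) b = Nerve.const x k := by
  have ha : ∀ c d : Bool, Nerve.edgeArr (K.data.one x) c d = K.data.one x := by
    rintro (_ | _) (_ | _)
    · exact congrArg K.data.one (K.data.src_one x)
    · rfl
    · exact K.data.inv_one x
    · exact congrArg K.data.one (K.data.tgt_one x)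
  refine Nerve.ext (funext fun i => ?_) (funext fun i => funext fun j => ha _ _)
  change cond (b i) _ _ = x
  cases b i
  · exact K.data.src_one x
  · exact K.data.tgt_one x

/-- The prism operator of a unit arrow vanishes on normalized sections. -/
theorem prismOp_one (x : K.Obj) (q l : ℕ) (s : DSec (Nerve G (q + 1)) l)
    (hs : ∀ j : Fin (q + 1),
      DSec.pull (Nerve.degen (G := G) j) (Nerve.reindex_smooth _) l s = 0) :
    prismOp G (K.data.one x) q l s = 0 := by
  rw [prismOp_apply]
  refine Finset.sum_eq_zero fun m _ => ?_
  -- Over a unit arrow the `m`-th prism is the value of the string at `x` with its vertex `m`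
  -- repeated, hence degenerate.
  have e : edgePull (K.data.one x) l s m.predAbove (prismBit m) =
      DSec.pull (Nerve.evalAt x) (Nerve.evalAt_smooth x) l
        (DSec.pull (Nerve.degen (G := G) m) (Nerve.reindex_smooth _) l s) := by
    refine (DSec.pull_congr ?_ _ _ l s).trans (DSec.pull_pull (Nerve.evalAt x)
      (Nerve.evalAt_smooth x) (Nerve.degen m) (Nerve.reindex_smooth _) l s).symm
    funext Λ
    exact congrArg (Λ.eval m.predAbove) (Nerve.edge_one x _)
  rw [e, hs, map_zero, smul_zero]

theorem Nerve.map_edge {K' : DGroupoid.{w}} (ρ : DFunctor K' K) (g : K'.Arr) {k : ℕ}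
    (b : Fin (k + 1) → Bool) (hinv : ρ.arr (K'.data.inv g) = K.data.inv (ρ.arr g)) :
    Nerve.map ρ (Nerve.edge g b) = Nerve.edge (ρ.arr g) b := by
  refine Nerve.ext (funext fun i => ?_) (funext fun i => funext fun j => ?_)
  · change ρ.obj (cond (b i) _ _) = cond (b i) _ _
    cases b i
    · exact (ρ.src_arr g).symm
    · exact (ρ.tgt_arr g).symm
  · change ρ.arr (Nerve.edgeArr g (b i) (b j)) = Nerve.edgeArr (ρ.arr g) (b i) (b j)
    cases b i <;> cases b j
    · exact (ρ.map_one _).trans (congrArg K.data.one (ρ.src_arr g).symm)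
    · rfl
    · exact hinv
    · exact (ρ.map_one _).trans (congrArg K.data.one (ρ.tgt_arr g).symm)

theorem pull_precomp_prismOp {K' : DGroupoid.{w}} (ρ : DFunctor K' K) (g : K'.Arr)
    (hinv : ρ.arr (K'.data.inv g) = K.data.inv (ρ.arr g)) (q l : ℕ)
    (s : DSec (Nerve G (q + 1)) l) :
    DSec.pull (Nerve.map (precompFunctor ρ G)) (Nerve.map_smooth _) l (prismOp G g q l s) =
      prismOp G (ρ.arr g) q l s := by
  rw [prismOp_apply, prismOp_apply, map_sum]
  refine Finset.sum_congr rfl fun m _ => ?_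
  rw [map_zsmul]
  congr 1
  refine (DSec.pull_pull _ _ _ _ _ _).trans (DSec.pull_congr ?_ _ _ l s)
  funext Λ
  exact congrArg (Λ.eval m.predAbove) (Nerve.map_edge ρ g _ hinv)

end UnitPrism

/-! ### Invariance under refinement. -/

section Refinement

/-- Comparison of the sums over a subdivision and over a refinement of it; the index `k j` is that
of the segment which contains the `j`-th segment of the refinement. -/
theorem sum_refinement {A : Type*} [AddCommGroup A] (k : ℕ → ℕ) (hk : k 0 = 0) (J I R : ℕ → A)
    (hR : R 0 = 0) (M : ℕ) (hstep : ∀ j < M, (k (j + 1) = k j ∧ R j + I j = R (j + 1)) ∨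
      (k (j + 1) = k j + 1 ∧ R j + I j = J (k j) + R (j + 1))) :
    ∑ i ∈ Finset.range M, I i = ∑ i ∈ Finset.range (k M), J i + R M := by
  -- `R j` plays the part of the contribution of the current coarse segment already covered by fine
  -- segments. The partial sum is always the completed coarse terms plus this remainder.
  induction M with
  | zero => simp [hk, hR]
  | succ M ih =>
    rw [Finset.sum_range_succ, ih fun j hj => hstep j (hj.trans (Nat.lt_succ_self M)), add_assoc]
    rcases hstep M (Nat.lt_succ_self M) with ⟨h₁, h₂⟩ | ⟨h₁, h₂⟩
    · rw [h₁, h₂]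
    · rw [h₁, h₂, Finset.sum_range_succ, add_assoc]

namespace AdmissibleCover.Refines

variable {W W' : AdmissibleCover} (r : Refines W W')

/-- The half-open coarse segments are disjoint, and `W'.pt j` lies in the one of index `r.idx j`
because a fine segment has positive length. So the covers alone determine the index. -/
theorem idx_eq_of_mem {i j : ℤ} (h₁ : W.pt i ≤ W'.pt j) (h₂ : W'.pt j < W.pt (i + 1)) :
    r.idx j = i := by
  have h₃ := r.le_pt j
  have h₄ := (W'.pt_strictMono (lt_add_one j)).trans_le (r.pt_le j)
  have h₅ := W.pt_strictMono.lt_iff_lt.1 (h₃.trans_lt h₂)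
  have h₆ := W.pt_strictMono.lt_iff_lt.1 (h₁.trans_lt h₄)
  omega

theorem idx_zero : r.idx 0 = 0 := by
  have h := W.pt_strictMono (lt_add_one 0)
  rw [W.pt_zero] at h
  exact r.idx_eq_of_mem (by rw [W.pt_zero, W'.pt_zero]) (by rwa [W'.pt_zero])

theorem idx_N : r.idx W'.N = W.N :=
  r.idx_eq_of_mem (by rw [pt_N, pt_N])
    (by rw [pt_N, ← pt_N W]; exact W.pt_strictMono (lt_add_one _))

/-- A fine subdivision point is either interior to a coarse segment or a coarse subdivision point.
-/
theorem idx_succ (j : ℤ) :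
    (r.idx (j + 1) = r.idx j ∧ W'.pt (j + 1) < W.pt (r.idx j + 1)) ∨
      (r.idx (j + 1) = r.idx j + 1 ∧ W'.pt (j + 1) = W.pt (r.idx j + 1)) := by
  rcases (r.pt_le j).lt_or_eq with h | h
  · exact Or.inl ⟨r.idx_eq_of_mem ((r.le_pt j).trans (W'.pt_strictMono (lt_add_one j)).le) h, h⟩
  · exact Or.inr ⟨r.idx_eq_of_mem h.ge
      (by rw [h]; exact W.pt_strictMono (lt_add_one _)), h⟩

theorem idx_nonneg (j : ℕ) : 0 ≤ r.idx j := by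
  induction j with
  | zero => exact r.idx_zero.ge
  | succ j ih =>
    rw [Nat.cast_succ]
    rcases r.idx_succ j with h | h <;> omega

theorem idx_lt {j : ℕ} (h : j < W'.N) : r.idx j < W.N := by
  have h₁ : W'.pt j < W'.pt W'.N := W'.pt_strictMono (by exact_mod_cast h)
  rw [pt_N, ← pt_N W] at h₁
  exact W.pt_strictMono.lt_iff_lt.1 ((r.le_pt j).trans_lt h₁)

theorem map_glue_of_eq (j : Fin W'.N) (h : r.idx (j + 1) = r.idx j) :
    r.functor.arr (W'.glue j) = W.circle.data.one (r.functor.obj (W'.circle.data.src (W'.glue j))) := by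
  -- The closing arrow is excluded: the index jumps to `W.N` at the end of the circle, while it is
  -- smaller before.
  have hj : (j : ℕ) + 1 < W'.N := by
    by_contra hj
    have e : ((j : ℕ) : ℤ) + 1 = W'.N := by omega
    have h₁ := r.idx_lt j.2
    rw [← h, e, r.idx_N] at h₁
    exact lt_irrefl _ h₁
  rw [show W'.glue j = _ from dif_pos hj]
  exact CArr.ext rfl h rfl rfl

theorem map_glue_of_succ (j : Fin W'.N) (i : Fin W.N) (hi : ((i : ℕ) : ℤ) = r.idx j)
    (h : r.idx (j + 1) = r.idx j + 1) (hpt : W'.pt (j + 1) = W.pt (r.idx j + 1)) :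
    r.functor.arr (W'.glue j) = W.glue i := by
  by_cases hj : (j : ℕ) + 1 < W'.N
  · have h₁ := r.idx_lt hj
    rw [Nat.cast_succ, h] at h₁
    rw [show W'.glue j = _ from dif_pos hj,
      show W.glue i = _ from dif_pos (show (i : ℕ) + 1 < W.N by omega)]
    exact CArr.ext hi.symm (h.trans (congrArg (· + 1) hi.symm)) rfl
      (hpt.trans (congrArg (fun a => W.pt (a + 1)) hi.symm))
  · have e : ((j : ℕ) : ℤ) + 1 = W'.N := by omega
    rw [e, r.idx_N] at h
    rw [show W'.glue j = _ from dif_neg hj,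
      show W.glue i = _ from dif_neg (show ¬ (i : ℕ) + 1 < W.N by omega)]
    exact CArr.ext hi.symm r.idx_zero rfl (hpt.trans (congrArg (fun a => W.pt (a + 1)) hi.symm))

/-- The cutoffs `clamp` of the two covers may differ outside the fine segment; on it both are the
identity. -/
theorem functor_seg (j : ℤ) {t : ℝ} (ht : t ∈ Set.Ioo (W'.pt j) (W'.pt (j + 1))) :
    r.functor.obj (W'.seg j t) = W.seg (r.idx j) t := by
  refine CObj.ext rfl ?_
  change W'.clamp j t = W.clamp (r.idx j) t
  rw [W'.clamp_of_mem j t ⟨ht.1.le, ht.2.le⟩, W.clamp_of_mem (r.idx j) t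
    ⟨(r.le_pt j).trans ht.1.le, ht.2.le.trans (r.pt_le j)⟩]

end AdmissibleCover.Refines

variable (G : EtaleGroupoid.{u}) {W W' : AdmissibleCover} (r : Refines W W')

theorem pull_incl_fiberInt (q l : ℕ) (j : ℤ) (s : DSec (Nerve G.toD q) (l + 1)) :
    DSec.pull (Nerve.map (incl G r)) (Nerve.map_smooth _) l
        ((segPath G W' q j).fiberInt (W'.pt j) (W'.pt (j + 1)) l s) =
      (segPath G W q (r.idx j)).fiberInt (W'.pt j) (W'.pt (j + 1)) l s := by
  refine (segPath G W' q j).pull_fiberInt_of_eqOn _ _ _ (W'.pt_strictMono (lt_add_one j)).le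
    (fun t ht Λ => ?_) l s
  change Nerve.evalAt (r.functor.obj (W'.seg j t)) Λ = Nerve.evalAt (W.seg (r.idx j) t) Λ
  rw [r.functor_seg j ht]

/-- Additivity of the integral: the fine segments inside one coarse segment add up to it. -/
theorem pull_incl_loopInt (q l : ℕ) (s : DSec (Nerve G.toD q) (l + 1)) :
    DSec.pull (Nerve.map (incl G r)) (Nerve.map_smooth _) l (loopInt G W' q l s) =
      loopInt G W q l s := by
  have hk : ∀ j : ℕ, ((r.idx j).toNat : ℤ) = r.idx j := fun j => Int.toNat_of_nonneg (r.idx_nonneg j)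
  have key := sum_refinement (fun j : ℕ => (r.idx j).toNat)
    (by change (r.idx 0).toNat = 0; rw [r.idx_zero]; rfl)
    (fun i => (segPath G W q i).fiberInt (W.pt i) (W.pt (i + 1)) l s)
    (fun j => (segPath G W q (r.idx j)).fiberInt (W'.pt j) (W'.pt (j + 1)) l s)
    -- The remainder is the integral from the start of the current coarse segment to the current
    -- fine point; it vanishes at coarse points, in particular at both ends of the circle.
    (fun j => (segPath G W q (r.idx j)).fiberInt (W.pt (r.idx j)) (W'.pt j) l s)
    (by
      change (segPath G W q (r.idx 0)).fiberInt (W.pt (r.idx 0)) (W'.pt 0) l s = 0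
      rw [r.idx_zero, W.pt_zero, W'.pt_zero, PathFamily.fiberInt_self])
    W'.N (fun j _ => by
      simp only [hk, Nat.cast_succ, PathFamily.fiberInt_add_adjacent]
      rcases r.idx_succ j with ⟨h₁, _⟩ | ⟨h₁, h₂⟩
      · exact Or.inl ⟨by rw [h₁], by rw [h₁]⟩
      · refine Or.inr ⟨?_, ?_⟩
        · have := r.idx_nonneg j
          omega
        · rw [h₁, h₂, PathFamily.fiberInt_self, add_zero])
  rw [r.idx_N, pt_N, pt_N, PathFamily.fiberInt_self, add_zero, Int.toNat_natCast,
    Finset.sum_range, Finset.sum_range] at key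
  rw [loopInt_apply, loopInt_apply, map_sum, ← key]
  exact Finset.sum_congr rfl fun j _ => pull_incl_fiberInt G r q l j s

/-- Glueing arrows at coarse points go to coarse glueing arrows. The new points give unit arrows,
and this is where normalization is needed. -/
theorem pull_incl_gluePrism (q l : ℕ) (s : DSec (Nerve G.toD (q + 1)) l)
    (hs : ∀ j : Fin (q + 1),
      DSec.pull (Nerve.degen (G := G.toD) j) (Nerve.reindex_smooth _) l s = 0) :
    DSec.pull (Nerve.map (incl G r)) (Nerve.map_smooth _) l (gluePrism G W' q l s) =
      gluePrism G W q l s := by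
  let term (V V' : AdmissibleCover) (F : V'.circle.Arr → V.circle.Arr) (i : ℕ) :
    DSec (Nerve (LG G V) q) l :=
      if h : i < V'.N then prismOp G.toD (F (V'.glue ⟨i, h⟩)) q l s else 0
  have key := sum_refinement (fun j : ℕ => (r.idx j).toNat)
    (by change (r.idx 0).toNat = 0; rw [r.idx_zero]; rfl)
    (term W W id) (term W W' r.functor.arr) (fun _ => 0) rfl W'.N (fun j hj => by
      have h₀ := r.idx_nonneg j
      have hlt := r.idx_lt hj
      simp only [Nat.cast_succ, zero_add, add_zero]
      rw [show term W W' r.functor.arr j = _ from dif_pos hj]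
      rcases r.idx_succ j with ⟨h₁, _⟩ | ⟨h₁, h₂⟩
      · refine Or.inl ⟨by rw [h₁], ?_⟩
        rw [r.map_glue_of_eq ⟨j, hj⟩ h₁]
        exact prismOp_one _ q l s hs
      · have hi : (r.idx j).toNat < W.N := by omega
        refine Or.inr ⟨by omega, ?_⟩
        rw [r.map_glue_of_succ ⟨j, hj⟩ ⟨_, hi⟩ (Int.toNat_of_nonneg h₀) h₁ h₂]
        exact (show term W W id _ = _ from dif_pos hi).symm)
  rw [r.idx_N, Int.toNat_natCast, add_zero, Finset.sum_range, Finset.sum_range] at key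
  have e : ∀ (V V' : AdmissibleCover) (F : V'.circle.Arr → V.circle.Arr) (j : Fin V'.N),
      term V V' F j = prismOp G.toD (F (V'.glue j)) q l s := fun _ _ _ j => dif_pos j.2
  simp only [e] at key
  rw [gluePrism_apply, gluePrism_apply, map_sum]
  exact (Finset.sum_congr rfl fun j _ => pull_precomp_prismOp r.functor _ rfl q l s).trans key

/-- On normalized cochains the holonomy is compatible with refinements of covers. -/
theorem pull_incl_holonomy (n : ℕ) {c : Cochain G.toD (n + 2) (n + 1)}
    (hc : c ∈ normalized G.toD (n + 2) (n + 1)) :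
    Cochain.pull (incl G r) (n + 1) n (holonomy G W' n c) = holonomy G W n c := by
  funext ⟨k, l, h, hl⟩
  change DSec.pull _ _ l (holonomy G W' n c ⟨k, l, h, hl⟩) = _
  rw [holonomy_apply, holonomy_apply, map_add, map_zsmul]
  exact congrArg₂ (· + ·) (pull_incl_loopInt G r k l _)
    (congrArg _ (pull_incl_gluePrism G r k l _ (hc k l _ _)))

end Refinement

/-! ### Holonomy on the loop groupoid. -/

section LoopHolonomy

/-- The holonomy homomorphism with values in the cochains of the loop groupoid. -/
def loopHolonomy (G : EtaleGroupoid.{u}) (n : ℕ) :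
    Cochain G.toD (n + 2) (n + 1) →+ LoopCochain G (n + 1) n where
  toFun c := ⟨fun W => holonomy G W n (normalize G.toD (n + 2) (n + 1) c),
    fun _ _ r => pull_incl_holonomy G r n (normalize_mem c)⟩
  map_zero' := Subtype.ext (funext fun W => by simp only [map_zero]; rfl)
  map_add' b c := Subtype.ext (funext fun W => by simp only [map_add]; rfl)

variable {G : EtaleGroupoid.{u}} {n : ℕ}

theorem loopHolonomy_apply (c : Cochain G.toD (n + 2) (n + 1)) (W : AdmissibleCover) :
    (loopHolonomy G n c).1 W = holonomy G W n (normalize G.toD (n + 2) (n + 1) c) := rfl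

theorem loopHolonomy_D_eq_zero (c : Cochain G.toD (n + 2) (n + 1))
    (hc : Cochain.D G.toD (n + 2) (n + 1) c = 0) :
    LoopCochain.D G (n + 1) n (loopHolonomy G n c) = 0 :=
  Subtype.ext (funext fun W => holonomy_D_eq_zero G W n (normalize G.toD (n + 2) (n + 1) c)
    ((normalize_D c).symm.trans ((congrArg _ hc).trans (map_zero _))))

theorem loopHolonomy_D (c : Cochain G.toD (n + 2) (n + 1)) :
    loopHolonomy G (n + 1) (Cochain.D G.toD (n + 3) (n + 1) (c.lift (Nat.lt_succ_self _))) =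
      LoopCochain.D G (n + 2) n (LoopCochain.lift (Nat.lt_succ_self _) (loopHolonomy G n c)) :=
  Subtype.ext (funext fun W => by
    rw [loopHolonomy_apply, normalize_D, normalize_lift, holonomy_D]
    rfl)

theorem loopHolonomy_D_zero (b : Cochain G.toD 2 0) :
    loopHolonomy G 0 (Cochain.D G.toD 2 0 b) = 0 :=
  Subtype.ext (funext fun W => by
    rw [loopHolonomy_apply, normalize_D]
    exact holonomy_D_zero G W _)

theorem loopHolonomy_pull {G' : EtaleGroupoid.{u}} (f : DFunctor G.toD G'.toD)
    (c : Cochain G'.toD (n + 2) (n + 1)) :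
    loopHolonomy G n (Cochain.pull f (n + 2) (n + 1) c) =
      LoopCochain.pull f (n + 1) n (loopHolonomy G' n c) :=
  Subtype.ext (funext fun W => by
    rw [loopHolonomy_apply, normalize_pull]
    exact holonomy_pull f W n _)

theorem holonomy_mem_coboundaries (W : AdmissibleCover) :
    ∀ (n : ℕ), ∀ b ∈ coboundaries (Cochain.D G.toD (n + 2)) (n + 1),
      holonomy G W n b ∈ coboundaries (Cochain.D (LG G W) (n + 1)) n
  | 0, _, ⟨b, hb⟩ => by
    rw [← hb, holonomy_D_zero]
    exact zero_mem _
  | n + 1, _, ⟨b, hb⟩ => by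
    rw [← hb]
    -- A cochain of total degree `n + 1` has form degrees at most `n + 1`, so `b` is the lift of the
    -- cochain written here from the shorter complex, and `holonomy_D` applies.
    exact ⟨_, (holonomy_D G W n
      fun a => b ⟨a.k, a.l, a.add, a.lt.trans (Nat.lt_succ_self _)⟩).symm⟩

theorem loopHolonomy_mem_coboundaries :
    ∀ (n : ℕ), ∀ b ∈ coboundaries (Cochain.D G.toD (n + 2)) (n + 1),
      loopHolonomy G n b ∈ coboundaries (LoopCochain.D G (n + 1)) n
  | 0, _, ⟨b, hb⟩ => by
    rw [← hb, loopHolonomy_D_zero]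
    exact zero_mem _
  | n + 1, _, ⟨b, hb⟩ => by
    rw [← hb]
    exact ⟨_, (loopHolonomy_D
      fun a => b ⟨a.k, a.l, a.add, a.lt.trans (Nat.lt_succ_self _)⟩).symm⟩

theorem exists_normalized_cls (G : DGroupoid.{u}) (n : ℕ)
    (x : Cohomology (Cochain.D G (n + 2)) (n + 1)) :
    ∃ c : Cochain G (n + 2) (n + 1), c ∈ normalized G (n + 2) (n + 1) ∧
      ∃ hc : Cochain.D G (n + 2) (n + 1) c = 0, cls (Cochain.D G (n + 2)) (n + 1) c hc = x := by
  obtain ⟨⟨c, hc⟩, rfl⟩ := QuotientAddGroup.mk_surjective x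
  obtain ⟨b, hb⟩ := exists_normalize_eq_add c hc
  refine ⟨_, normalize_mem c, ?_, ?_⟩
  · rw [← normalize_D, hc, map_zero]
  · refine (QuotientAddGroup.eq.2 ?_).symm
    refine ⟨b, ?_⟩
    change _ = -c + normalize G (n + 2) (n + 1) c
    rw [hb]
    abel

end LoopHolonomy

end Holonomy

end

/-! ### Generalized holonomy on `LG(W)` and on `LG`. -/

theorem mainTheorem5 :
    ∃ (τW : ∀ (G : EtaleGroupoid.{u}) (W : AdmissibleCover) (n : ℕ),
          Cochain G.toD (n + 2) (n + 1) →+ Cochain (LG G W) (n + 1) n)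
      (τ : ∀ (G : EtaleGroupoid.{u}) (n : ℕ),
          Cochain G.toD (n + 2) (n + 1) →+ LoopCochain G (n + 1) n),
      -- on `LG(W)`: the explicit formula
      (∀ G W n c, IsHolonomy W c (τW G W n c)) ∧
      -- cocycles are sent to cocycles
      (∀ G W n c, Cochain.D G.toD (n + 2) (n + 1) c = 0 →
        Cochain.D (LG G W) (n + 1) n (τW G W n c) = 0) ∧
      -- the total differentials are intertwined
      (∀ G W n (c : Cochain G.toD (n + 2) (n + 1)),
        τW G W (n + 1) (Cochain.D G.toD (n + 3) (n + 1) (c.lift (Nat.lt_succ_self _))) =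
          Cochain.D (LG G W) (n + 2) n ((τW G W n c).lift (Nat.lt_succ_self _))) ∧
      (∀ G W (b : Cochain G.toD 2 0), τW G W 0 (Cochain.D G.toD 2 0 b) = 0) ∧
      -- the induced map in cohomology
      (∀ G W n, ∃ T : Cohomology (Cochain.D G.toD (n + 2)) (n + 1) →+
          Cohomology (Cochain.D (LG G W) (n + 1)) n,
        ∀ c (hc : Cochain.D G.toD (n + 2) (n + 1) c = 0)
          (hτ : Cochain.D (LG G W) (n + 1) n (τW G W n c) = 0),
          T (cls (Cochain.D G.toD (n + 2)) (n + 1) c hc) =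
            cls (Cochain.D (LG G W) (n + 1)) n (τW G W n c) hτ) ∧
      -- naturality in the groupoid
      (∀ (G G' : EtaleGroupoid.{u}) (f : DFunctor G.toD G'.toD) W n
          (c : Cochain G'.toD (n + 2) (n + 1)),
        τW G W n (Cochain.pull f (n + 2) (n + 1) c) =
          Cochain.pull (loopMap f W) (n + 1) n (τW G' W n c)) ∧
      -- on `LG`: the explicit formula, on normalized cochains, which represent every class
      (∀ G n (c : Cochain G.toD (n + 2) (n + 1)), c ∈ normalized G.toD (n + 2) (n + 1) →
        ∀ W, (τ G n c).1 W = τW G W n c) ∧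
      (∀ (G : EtaleGroupoid.{u}) (n : ℕ)
          (x : Cohomology (Cochain.D G.toD (n + 2)) (n + 1)),
        ∃ c : Cochain G.toD (n + 2) (n + 1), c ∈ normalized G.toD (n + 2) (n + 1) ∧
          ∃ hc : Cochain.D G.toD (n + 2) (n + 1) c = 0,
            cls (Cochain.D G.toD (n + 2)) (n + 1) c hc = x) ∧
      -- cocycles are sent to cocycles
      (∀ G n c, Cochain.D G.toD (n + 2) (n + 1) c = 0 →
        LoopCochain.D G (n + 1) n (τ G n c) = 0) ∧
      -- the total differentials are intertwined
      (∀ G n (c : Cochain G.toD (n + 2) (n + 1)),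
        τ G (n + 1) (Cochain.D G.toD (n + 3) (n + 1) (c.lift (Nat.lt_succ_self _))) =
          LoopCochain.D G (n + 2) n (LoopCochain.lift (Nat.lt_succ_self _) (τ G n c))) ∧
      (∀ G (b : Cochain G.toD 2 0), τ G 0 (Cochain.D G.toD 2 0 b) = 0) ∧
      -- the induced map in cohomology
      (∀ G n, ∃ T : Cohomology (Cochain.D G.toD (n + 2)) (n + 1) →+
          Cohomology (LoopCochain.D G (n + 1)) n,
        ∀ c (hc : Cochain.D G.toD (n + 2) (n + 1) c = 0)
          (hτ : LoopCochain.D G (n + 1) n (τ G n c) = 0),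
          T (cls (Cochain.D G.toD (n + 2)) (n + 1) c hc) =
            cls (LoopCochain.D G (n + 1)) n (τ G n c) hτ) ∧
      -- naturality in the groupoid
      (∀ (G G' : EtaleGroupoid.{u}) (f : DFunctor G.toD G'.toD) n
          (c : Cochain G'.toD (n + 2) (n + 1)),
        τ G n (Cochain.pull f (n + 2) (n + 1) c) =
          LoopCochain.pull f (n + 1) n (τ G' n c)) :=
  ⟨fun G W n => holonomy G W n, fun G n => loopHolonomy G n,
    fun G W n c => isHolonomy_holonomy G W n c,
    fun G W n c hc => holonomy_D_eq_zero G W n c hc,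
    fun G W n c => holonomy_D G W n c,
    fun G W b => holonomy_D_zero G W b,
    fun G W n => exists_cohomologyMap _ _ (holonomy G W n) (holonomy_D_eq_zero G W n)
      (holonomy_mem_coboundaries W n),
    fun _ _ f W n c => holonomy_pull f W n c,
    -- The explicit formula survives on normalized cochains because the projection fixes them.
    fun _ _ c hc W => by rw [loopHolonomy_apply, normalize_eq_self hc],
    fun G n x => exists_normalized_cls G.toD n x,
    fun _ _ c hc => loopHolonomy_D_eq_zero c hc,
    fun _ _ c => loopHolonomy_D c,
    fun _ b => loopHolonomy_D_zero b,
    fun G n => exists_cohomologyMap (B := fun i => LoopCochain G (n + 1) i) _ _ (loopHolonomy G n) loopHolonomy_D_eq_zero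
      (loopHolonomy_mem_coboundaries n),
    fun _ _ f _ c => loopHolonomy_pull f c⟩
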